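/- **Setting.** Let $G=(V,E)$ be a directed graph with $n$ vertices, $m$ edges (parallel edges are allowed), positive real edge capacities $w(e)$, and distinct vertices $s,t$. An $(s,t)$-cut is a set $C\subseteq V$ with $s\in C$, $t\notin C$; its capacity is the sum of $w(e)$ over the edges $e$ leaving $C$, and an $(s,t)$-mincut is one of least capacity. The *vitality* of an edge $e$ is the reduction of the $(s,t)$-mincut capacity caused by removing $e$; $e$ is *vital* if its vitality is positive. A vital edge $e$ is *tight* if $f(e)=w(e)$ for some maximum $(s,t)$-flow $f$ of $G$, and *loose* otherwise. For $1\le k\le m$, a *$k$-th most vital edge* is an edge at the $k$-th place of a list of all the edges in order of decreasing vitality (ties broken arbitrarily). **Model.** Algorithms are fixed (uniform) programs for a unit-cost random access machine with integer and real registers and arrays; integers (also used as array indices) are added, subtracted and compared, real numbers are only added, subtracted and compared. In addition a program may call a subroutine that returns some maximum flow (which one is not under the control of the program) of a network with distinct terminals and nonnegative capacities that the program has written into memory. Every call must be made on a network with at most $n+O(1)$ vertices and $m+O(1)$ edges. The input consists of $n$, $m$, $s$, $t$, the list of edges with their capacities and, in (3), the integer $k$. **Theorem 1.3.** There are three algorithms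 with the following properties for every such $G$ and for every correct maximum-flow subroutine; all the $O(\cdot)$ constants are absolute. 1. The first computes all vital edges of $G$, and tells for each of them whether it is tight or loose, using $O(n)$ maximum-flow computations and $O(n(n+m))$ elementary steps. 2. The second computes a set of at most $n-1$ edges that contains every loose edge of $G$, using at most one maximum-flow computation and $O(n(n+m))$ elementary steps. 3. The third, given also an integer $k$ with $1\le k\le m$, computes a $k$-th most vital edge of $G$ using $O(n)$ maximum-flow computations and $O(n(n+m)+m\log m)$ elementary steps. -/

import Mathlib

namespace VitalEdges

/-! ## Networks, cuts, flows -/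

/-- A directed weighted graph with a designated source and sink. Edges are indexed by `E`, so
parallel edges are allowed. -/
structure Network (V E : Type) where
  tail : E → V
  head : E → V
  cap : E → ℝ
  source : V
  sink : V

namespace Network

/-- `C` is an `(s,t)`-cut. -/
def IsCut {V E : Type} (G : Network V E) (C : Finset V) : Prop :=
  G.source ∈ C ∧ G.sink ∉ C

/-- Sum of the capacities of the edges leaving `C`. -/
def cutCap {V E : Type} [DecidableEq V] [Fintype E] (G : Network V E) (C : Finset V) : ℝ :=
  ∑ e : E, if G.tail e ∈ C ∧ G.head e ∉ C then G.cap e else 0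

/-- Capacity of an `(s,t)`-mincut. When `V` is finite and the source differs from the sink, this
is the minimum of a finite nonempty set of reals. -/
noncomputable def mincutCap {V E : Type} [DecidableEq V] [Fintype E] (G : Network V E) : ℝ :=
  sInf {x : ℝ | ∃ C : Finset V, G.IsCut C ∧ G.cutCap C = x}

/-- The graph after removal of the edge `e`. -/
def delete {V E : Type} (G : Network V E) (e : E) : Network V {e' : E // e' ≠ e} where
  tail := fun e' => G.tail e'.1
  head := fun e' => G.head e'.1
  cap := fun e' => G.cap e'.1
  source := G.source
  sink := G.sink

/-- Reduction of the mincut capacity caused by the removal of `e`. -/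
noncomputable def vitality {V E : Type} [DecidableEq V] [Fintype E] [DecidableEq E]
    (G : Network V E) (e : E) : ℝ :=
  G.mincutCap - (G.delete e).mincutCap

/-- The removal of `e` decreases the capacity of the `(s,t)`-mincut. -/
def IsVital {V E : Type} [DecidableEq V] [Fintype E] [DecidableEq E]
    (G : Network V E) (e : E) : Prop :=
  (G.delete e).mincutCap < G.mincutCap

/-- Total flow on the edges leaving `v`. -/
def outflow {V E : Type} [DecidableEq V] [Fintype E] (G : Network V E) (f : E → ℝ) (v : V) : ℝ :=
  ∑ e : E, if G.tail e = v then f e else 0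

/-- Total flow on the edges entering `v`. -/
def inflow {V E : Type} [DecidableEq V] [Fintype E] (G : Network V E) (f : E → ℝ) (v : V) : ℝ :=
  ∑ e : E, if G.head e = v then f e else 0

def IsFlow {V E : Type} [DecidableEq V] [Fintype E] (G : Network V E) (f : E → ℝ) : Prop :=
  (∀ e : E, 0 ≤ f e ∧ f e ≤ G.cap e) ∧
    ∀ v : V, v ≠ G.source → v ≠ G.sink → G.inflow f v = G.outflow f v

def value {V E : Type} [DecidableEq V] [Fintype E] (G : Network V E) (f : E → ℝ) : ℝ :=
  G.outflow f G.source - G.inflow f G.source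

def IsMaxFlow {V E : Type} [DecidableEq V] [Fintype E] (G : Network V E) (f : E → ℝ) : Prop :=
  G.IsFlow f ∧ ∀ g : E → ℝ, G.IsFlow g → G.value g ≤ G.value f

/-- A vital edge that is saturated by some maximum flow. -/
def IsTight {V E : Type} [DecidableEq V] [Fintype E] [DecidableEq E]
    (G : Network V E) (e : E) : Prop :=
  G.IsVital e ∧ ∃ f : E → ℝ, G.IsMaxFlow f ∧ f e = G.cap e

/-- A vital edge that is not tight. -/
def IsLoose {V E : Type} [DecidableEq V] [Fintype E] [DecidableEq E]
    (G : Network V E) (e : E) : Prop :=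
  G.IsVital e ∧ ¬ ∃ f : E → ℝ, G.IsMaxFlow f ∧ f e = G.cap e

/-- `e` stands at the `k`-th place (counting from 1) of some list of all the edges in the order
of decreasing vitality; ties may be broken arbitrarily. -/
def IsKthMostVital {V : Type} [DecidableEq V] {m : ℕ} (G : Network V (Fin m)) (k : ℕ)
    (e : Fin m) : Prop :=
  ∃ π : Equiv.Perm (Fin m), Antitone (fun i => G.vitality (π i)) ∧
    ∃ i : Fin m, (i : ℕ) + 1 = k ∧ π i = e

end Network

/-! ## A random access machine over the reals with a maximum-flow instruction

Integers are handled by addition, truncated subtraction and comparison, and serve as array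
indices; real numbers are handled by addition, subtraction and comparison only. -/

/-- Memory: integer and real variables, and integer and real arrays. Every program mentions only
finitely many names of variables and arrays. -/
structure State where
  iv : ℕ → ℕ
  ia : ℕ → ℕ → ℕ
  rv : ℕ → ℝ
  ra : ℕ → ℕ → ℝ

namespace State

def setI (σ : State) (x v : ℕ) : State :=
  { σ with iv := fun y => if y = x then v else σ.iv y }

def putI (σ : State) (a i v : ℕ) : State :=
  { σ with ia := fun b j => if b = a ∧ j = i then v else σ.ia b j }

noncomputable def setR (σ : State) (x : ℕ) (v : ℝ) : State :=
  { σ with rv := fun y => if y = x then v else σ.rv y }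

noncomputable def putR (σ : State) (a i : ℕ) (v : ℝ) : State :=
  { σ with ra := fun b j => if b = a ∧ j = i then v else σ.ra b j }

/-- Write the numbers `g 0, …, g (m - 1)` to the first `m` cells of the real array `a`. -/
noncomputable def putFlow (σ : State) (a m : ℕ) (g : Fin m → ℝ) : State :=
  { σ with ra := fun b j => if h : j < m then (if b = a then g ⟨j, h⟩ else σ.ra b j) else σ.ra b j }

end State

inductive IExpr : Type where
  | const (c : ℕ) : IExpr
  | var (x : ℕ) : IExpr
  | get (a : ℕ) (i : IExpr) : IExpr
  | plus (p q : IExpr) : IExpr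
  | minus (p q : IExpr) : IExpr

def IExpr.eval (σ : State) : IExpr → ℕ
  | .const c => c
  | .var x => σ.iv x
  | .get a i => σ.ia a (i.eval σ)
  | .plus p q => p.eval σ + q.eval σ
  | .minus p q => p.eval σ - q.eval σ

inductive RExpr : Type where
  | zero : RExpr
  | var (x : ℕ) : RExpr
  | get (a : ℕ) (i : IExpr) : RExpr
  | plus (p q : RExpr) : RExpr
  | minus (p q : RExpr) : RExpr

noncomputable def RExpr.eval (σ : State) : RExpr → ℝ
  | .zero => 0
  | .var x => σ.rv x
  | .get a i => σ.ra a (i.eval σ)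
  | .plus p q => p.eval σ + q.eval σ
  | .minus p q => p.eval σ - q.eval σ

inductive BExpr : Type where
  | ilt (p q : IExpr) : BExpr
  | ieq (p q : IExpr) : BExpr
  | rlt (p q : RExpr) : BExpr
  | req (p q : RExpr) : BExpr
  | neg (b : BExpr) : BExpr
  | conj (b b' : BExpr) : BExpr

def BExpr.eval (σ : State) : BExpr → Prop
  | .ilt p q => p.eval σ < q.eval σ
  | .ieq p q => p.eval σ = q.eval σ
  | .rlt p q => p.eval σ < q.eval σ
  | .req p q => p.eval σ = q.eval σ
  | .neg b => ¬ b.eval σ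
  | .conj b b' => b.eval σ ∧ b'.eval σ

/-- Programs. `flow nV nE s t T H W F` calls the maximum-flow subroutine on the network with
vertices `0, …, nV - 1`, source `s`, sink `t`, and edges `0, …, nE - 1`, whose tails, heads and
capacities stand in the arrays `T`, `H` and `W`; the flow that it returns is written into the
array `F`. -/
inductive Prog : Type where
  | skip : Prog
  | iset (x : ℕ) (p : IExpr) : Prog
  | iput (a : ℕ) (i p : IExpr) : Prog
  | rset (x : ℕ) (p : RExpr) : Prog
  | rput (a : ℕ) (i : IExpr) (p : RExpr) : Prog
  | seq (P Q : Prog) : Prog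
  | ite (b : BExpr) (P Q : Prog) : Prog
  | loop (b : BExpr) (P : Prog) : Prog
  | flow (nV nE s t : IExpr) (T H W F : ℕ) : Prog

/-- A candidate subroutine: it assigns a real number to every edge of every finite network. -/
abbrev Subroutine : Type :=
  (n m : ℕ) → Network (Fin n) (Fin m) → Fin m → ℝ

/-- The subroutine returns some maximum flow on every network with distinct terminals and
nonnegative capacities. -/
def IsMaxFlowSubroutine (O : Subroutine) : Prop :=
  ∀ (n m : ℕ) (Q : Network (Fin n) (Fin m)), Q.source ≠ Q.sink → (∀ e, 0 ≤ Q.cap e) →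
    Q.IsMaxFlow (O n m Q)

/-- `Exec O N M P σ σ' k q`: started in the state `σ`, the program `P` halts in the state `σ'`
after `k` elementary steps (assignments, evaluations of a test, calls), `q` of which are calls
of the subroutine `O`. A call is possible only on a well-formed network with at most `N` vertices
and at most `M` edges, distinct terminals and nonnegative capacities; otherwise the program is
stuck. -/
inductive Exec (O : Subroutine) (N M : ℕ) : Prog → State → State → ℕ → ℕ → Prop where
  | skip (σ : State) : Exec O N M .skip σ σ 1 0
  | iset (σ : State) (x : ℕ) (p : IExpr) :
      Exec O N M (.iset x p) σ (σ.setI x (p.eval σ)) 1 0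
  | iput (σ : State) (a : ℕ) (i p : IExpr) :
      Exec O N M (.iput a i p) σ (σ.putI a (i.eval σ) (p.eval σ)) 1 0
  | rset (σ : State) (x : ℕ) (p : RExpr) :
      Exec O N M (.rset x p) σ (σ.setR x (p.eval σ)) 1 0
  | rput (σ : State) (a : ℕ) (i : IExpr) (p : RExpr) :
      Exec O N M (.rput a i p) σ (σ.putR a (i.eval σ) (p.eval σ)) 1 0
  | seq (P Q : Prog) (σ₁ σ₂ σ₃ : State) (k₁ k₂ q₁ q₂ : ℕ) :
      Exec O N M P σ₁ σ₂ k₁ q₁ → Exec O N M Q σ₂ σ₃ k₂ q₂ →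
      Exec O N M (.seq P Q) σ₁ σ₃ (k₁ + k₂) (q₁ + q₂)
  | ite_true (b : BExpr) (P Q : Prog) (σ σ' : State) (k q : ℕ) :
      b.eval σ → Exec O N M P σ σ' k q → Exec O N M (.ite b P Q) σ σ' (k + 1) q
  | ite_false (b : BExpr) (P Q : Prog) (σ σ' : State) (k q : ℕ) :
      ¬ b.eval σ → Exec O N M Q σ σ' k q → Exec O N M (.ite b P Q) σ σ' (k + 1) q
  | loop_stop (b : BExpr) (P : Prog) (σ : State) :
      ¬ b.eval σ → Exec O N M (.loop b P) σ σ 1 0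
  | loop_step (b : BExpr) (P : Prog) (σ₁ σ₂ σ₃ : State) (k₁ k₂ q₁ q₂ : ℕ) :
      b.eval σ₁ → Exec O N M P σ₁ σ₂ k₁ q₁ → Exec O N M (.loop b P) σ₂ σ₃ k₂ q₂ →
      Exec O N M (.loop b P) σ₁ σ₃ (k₁ + k₂ + 1) (q₁ + q₂)
  | flow (σ : State) (nV nE s t : IExpr) (T H W F n m : ℕ) (Q : Network (Fin n) (Fin m)) :
      nV.eval σ = n → nE.eval σ = m → n ≤ N → m ≤ M →
      s.eval σ = Q.source → t.eval σ = Q.sink → Q.source ≠ Q.sink →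
      (∀ e : Fin m, σ.ia T e = Q.tail e) → (∀ e : Fin m, σ.ia H e = Q.head e) →
      (∀ e : Fin m, σ.ra W e = Q.cap e) → (∀ e : Fin m, 0 ≤ Q.cap e) →
      Exec O N M (.flow nV nE s t T H W F) σ (σ.putFlow F m (O n m Q)) 1 1

/-- Initial memory: the numbers `n`, `m` of vertices and edges, the source, the sink and a further
integer argument `k` stand in the integer variables `0, 1, 2, 3, 4`, the tails and heads of the
edges in the integer arrays `0, 1`, the capacities in the real array `0`; all else is zero. -/
noncomputable def inputState {n m : ℕ} (G : Network (Fin n) (Fin m)) (k : ℕ) : State where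
  iv := fun x =>
    if x = 0 then n else if x = 1 then m else if x = 2 then (G.source : ℕ)
    else if x = 3 then (G.sink : ℕ) else if x = 4 then k else 0
  ia := fun a i =>
    if h : i < m then
      (if a = 0 then (G.tail ⟨i, h⟩ : ℕ) else if a = 1 then (G.head ⟨i, h⟩ : ℕ) else 0)
    else 0
  rv := fun _ => 0
  ra := fun a i => if h : i < m then (if a = 0 then G.cap ⟨i, h⟩ else 0) else 0

/-- Started in `σ₀`, the program `P` halts within `K` steps, of which at most `q` are calls of the
maximum-flow subroutine `O`, all on networks with at most `N` vertices and at most `M` edges,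
and the final state satisfies `post`. -/
def HaltsWith (P : Prog) (O : Subroutine) (σ₀ : State) (N M q K : ℕ) (post : State → Prop) :
    Prop :=
  ∃ (σ : State) (steps calls : ℕ), Exec O N M P σ₀ σ steps calls ∧ calls ≤ q ∧ steps ≤ K ∧ post σ

end VitalEdges

open VitalEdges

/-!
The vitality of an edge `e` is decided by the cheapest cut that `e` leaves, but all those cuts
together can be handled with linearly many flows, for the following reasons.

Let `f` be a maximum flow and let the slack of `e` be `min (f e) (cap e - f e)`. Take a spanning
forest of greatest slack. An edge `e` outside the forest closes a cycle with forest edges of at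
least its slack, and the flow can be rerouted along this cycle, in either direction, by the slack
of `e`. So some maximum flow avoids `e` or saturates `e`
(`Network.ForestInv.unmarked`). In the first case `e` is not vital, in the second one `e` is not
loose (`Network.not_isLoose_of`): the at most `n - 1` edges of the forest contain all loose edges.
They are treated one by one: a maximum flow of the network without `e` gives the vitality
(`Network.vitality_eq_of_zeroCap`), and a maximum flow of `Network.forceNet` tells whether some
maximum flow saturates `e` (`Network.exists_saturating_iff`).

For an edge from `u` to `v` that is saturated by some maximum flow, it does not matter in which
direction it crosses a cut: its vitality is determined by the least capacity `Network.sepCap` of an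
`(s,t)`-cut that separates `u` and `v` (`Network.vitality_eq_of_saturated`). The function `sepCap`
is symmetric and satisfies the ultrametric inequality (`Network.sepCap_ultra`), although cuts are
directed here, because any function of this form does: of two vertices on different sides of a cut
a third vertex is separated from one. So `n - 1` cut computations find it for all pairs of
vertices, in the manner of Cheng and Hu (`ClassInv.step`): vertices are grouped in classes that
have not been separated so far, a member `q` of a class is separated from the representative of its
class by a cheapest cut, and all members of classes that this cut can split are regrouped. A
cheapest cut comes from two directed ones, each found with one flow in a network where
`u` and `v` are merged with the terminals (`Network.contract`) and a search of the residual graph.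

The `k`-th most vital edge is extracted from a winner tree over the vitalities, which is updated
along a single path after each of the `k - 1` removals (`Tournament.step`).

Programs are verified with a Hoare logic for the deeply embedded machine (`HaltsWith.seq`,
`HaltsWith.loop`, `HaltsWith.forLoop`, `HaltsWith.flow`) whose assertions carry the step and call
bounds. What a program leaves alone is read off its list of written variables and arrays
(`Agrees`).
-/

namespace VitalEdges

namespace Network

/-! ### Flows and cuts -/

variable {V E : Type} [DecidableEq V] [Fintype E]

/-- Net flow leaving the vertex `v`, for an arbitrary real vector on the edges. -/
def excess (G : Network V E) (f : E → ℝ) (v : V) : ℝ :=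
  G.outflow f v - G.inflow f v

theorem excess_add (G : Network V E) (f g : E → ℝ) (v : V) :
    G.excess (f + g) v = G.excess f v + G.excess g v := by
  simp only [excess, outflow, inflow, Pi.add_apply, ← Finset.sum_sub_distrib,
    ← Finset.sum_add_distrib]
  refine Finset.sum_congr rfl fun e _ => ?_
  split_ifs <;> ring

theorem excess_smul (G : Network V E) (c : ℝ) (f : E → ℝ) (v : V) :
    G.excess (c • f) v = c * G.excess f v := by
  simp only [excess, outflow, inflow, Pi.smul_apply, smul_eq_mul, ← Finset.sum_sub_distrib,
    Finset.mul_sum]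
  refine Finset.sum_congr rfl fun e _ => ?_
  split_ifs <;> ring

theorem excess_single [DecidableEq E] (G : Network V E) (e : E) (v : V) :
    G.excess (Pi.single e 1) v
      = (if v = G.tail e then 1 else 0) - (if v = G.head e then 1 else 0) := by
  simp only [excess, outflow, inflow, Pi.single_apply]
  congr 1
  · rw [Finset.sum_eq_single e]
    · simp [eq_comm]
    · intro b _ hb; simp [hb]
    · simp
  · rw [Finset.sum_eq_single e]
    · simp [eq_comm]
    · intro b _ hb; simp [hb]
    · simp

theorem isFlow_iff (G : Network V E) (f : E → ℝ) :
    G.IsFlow f ↔ (∀ e, 0 ≤ f e ∧ f e ≤ G.cap e) ∧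
      ∀ v, v ≠ G.source → v ≠ G.sink → G.excess f v = 0 := by
  unfold IsFlow excess
  refine and_congr_right fun _ => forall₃_congr fun v _ _ => ?_
  rw [sub_eq_zero, eq_comm]

theorem sum_excess (G : Network V E) (f : E → ℝ) (C : Finset V) :
    ∑ v ∈ C, G.excess f v
      = ∑ e, ((if G.tail e ∈ C then f e else 0) - (if G.head e ∈ C then f e else 0)) := by
  simp only [excess, outflow, inflow, Finset.sum_sub_distrib]
  congr 1 <;>
  · rw [Finset.sum_comm]
    refine Finset.sum_congr rfl fun e _ => ?_
    rw [Finset.sum_ite_eq]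

/-- Residual capacity, with respect to `f`, of the cut `C`: unused capacity on the edges that leave
`C` and flow on the edges that enter `C`. -/
def resCut (G : Network V E) (f : E → ℝ) (C : Finset V) : ℝ :=
  ∑ e, if G.tail e ∈ C ∧ G.head e ∉ C then G.cap e - f e
    else if G.head e ∈ C ∧ G.tail e ∉ C then f e else 0

theorem value_eq_sum_excess {G : Network V E} {f : E → ℝ} (hf : G.IsFlow f) {C : Finset V}
    (hC : G.IsCut C) : G.value f = ∑ v ∈ C, G.excess f v := by
  rw [Finset.sum_eq_single G.source]
  · rfl
  · intro v hv hs
    exact ((G.isFlow_iff f).1 hf).2 v hs fun h => hC.2 (h ▸ hv)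
  · exact fun h => absurd hC.1 h

theorem cutCap_eq {G : Network V E} {f : E → ℝ} (hf : G.IsFlow f) {C : Finset V}
    (hC : G.IsCut C) : G.cutCap C = G.value f + G.resCut f C := by
  rw [value_eq_sum_excess hf hC, sum_excess, cutCap, resCut, ← Finset.sum_add_distrib]
  refine Finset.sum_congr rfl fun e _ => ?_
  by_cases h1 : G.tail e ∈ C <;> by_cases h2 : G.head e ∈ C <;> simp [h1, h2]

theorem resCut_term_nonneg {G : Network V E} {f : E → ℝ} (hf : G.IsFlow f) (C : Finset V) (e : E) :
    0 ≤ (if G.tail e ∈ C ∧ G.head e ∉ C then G.cap e - f e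
      else if G.head e ∈ C ∧ G.tail e ∉ C then f e else 0) := by
  have := hf.1 e
  split_ifs <;> linarith

theorem cap_sub_le_resCut {G : Network V E} {f : E → ℝ} (hf : G.IsFlow f) {C : Finset V} {e : E}
    (h1 : G.tail e ∈ C) (h2 : G.head e ∉ C) : G.cap e - f e ≤ G.resCut f C := by
  have := Finset.single_le_sum (fun e _ => resCut_term_nonneg hf C e) (Finset.mem_univ e)
  simpa [resCut, h1, h2] using this

theorem le_resCut {G : Network V E} {f : E → ℝ} (hf : G.IsFlow f) {C : Finset V} {e : E}
    (h1 : G.tail e ∉ C) (h2 : G.head e ∈ C) : f e ≤ G.resCut f C := by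
  have := Finset.single_le_sum (fun e _ => resCut_term_nonneg hf C e) (Finset.mem_univ e)
  simpa [resCut, h1, h2] using this

theorem value_le_cutCap {G : Network V E} {f : E → ℝ} (hf : G.IsFlow f) {C : Finset V}
    (hC : G.IsCut C) : G.value f ≤ G.cutCap C := by
  rw [cutCap_eq hf hC]
  have : 0 ≤ G.resCut f C := Finset.sum_nonneg fun e _ => resCut_term_nonneg hf C e
  linarith

/-- `C` is closed under the arcs of the residual graph of `f`. -/
def ResClosed (G : Network V E) (f : E → ℝ) (C : Finset V) : Prop :=
  ∀ e, (G.tail e ∈ C → f e < G.cap e → G.head e ∈ C) ∧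
    (G.head e ∈ C → 0 < f e → G.tail e ∈ C)

theorem cutCap_eq_value_of_resClosed {G : Network V E} {f : E → ℝ} (hf : G.IsFlow f)
    {C : Finset V} (hC : G.IsCut C) (h : G.ResClosed f C) : G.cutCap C = G.value f := by
  rw [cutCap_eq hf hC, add_eq_left]
  refine Finset.sum_eq_zero fun e _ => ?_
  have := hf.1 e
  split_ifs with h1 h2
  · have := mt ((h e).1 h1.1) h1.2; linarith
  · have := mt ((h e).2 h2.1) h2.2; linarith
  · rfl

/-- Directions `d` in which `f` can be changed a little without violating the capacities. -/
def ResDir (G : Network V E) (f d : E → ℝ) : Prop :=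
  ∀ e, (0 < d e → f e < G.cap e) ∧ (d e < 0 → 0 < f e)

theorem exists_step {G : Network V E} {f d : E → ℝ} (hf : G.IsFlow f) (hd : G.ResDir f d) :
    ∃ ε : ℝ, 0 < ε ∧ ∀ e, 0 ≤ f e + ε * d e ∧ f e + ε * d e ≤ G.cap e := by
  have key : ∀ e, ∀ᶠ ε in nhdsWithin (0 : ℝ) (Set.Ioi 0),
      0 ≤ f e + ε * d e ∧ f e + ε * d e ≤ G.cap e := by
    intro e
    have hb := hf.1 e
    have ht : Filter.Tendsto (fun ε : ℝ => f e + ε * d e) (nhdsWithin (0 : ℝ) (Set.Ioi 0))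
        (nhds (f e)) := by
      have : ContinuousAt (fun ε : ℝ => f e + ε * d e) 0 := by fun_prop
      have := this.tendsto.mono_left (nhdsWithin_le_nhds (s := Set.Ioi (0 : ℝ)))
      simpa using this
    rcases lt_trichotomy (d e) 0 with h | h | h
    · filter_upwards [ht.eventually (lt_mem_nhds ((hd e).2 h)), self_mem_nhdsWithin] with ε h1 h2
      have : ε * d e < 0 := mul_neg_of_pos_of_neg h2 h
      exact ⟨h1.le, by linarith⟩
    · simp [h, hb]
    · filter_upwards [ht.eventually (gt_mem_nhds ((hd e).1 h)), self_mem_nhdsWithin] with ε h1 h2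
      have : 0 < ε * d e := mul_pos h2 h
      exact ⟨by linarith, h1.le⟩
  have := (Filter.eventually_all.2 key).and self_mem_nhdsWithin
  obtain ⟨ε, h1, h2⟩ := this.exists
  exact ⟨ε, h2, h1⟩

/-- The vertices to which the source can send extra flow, together, form a residually closed cut:
this is the max-flow min-cut theorem. -/
theorem IsMaxFlow.exists_resClosed [Fintype V] [DecidableEq E] {G : Network V E} {f : E → ℝ}
    (hf : G.IsMaxFlow f) (hst : G.source ≠ G.sink) : ∃ C, G.IsCut C ∧ G.ResClosed f C := by
  classical
  let R : V → Prop := fun x => ∃ d : E → ℝ, G.ResDir f d ∧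
    ∀ v, G.excess d v = (if v = G.source then 1 else 0) - (if v = x then 1 else 0)
  have ext : ∀ (x y : V) (e : E) (c : ℝ), R x →
      (0 < c → f e < G.cap e) → (c < 0 → 0 < f e) →
      (∀ v, c * G.excess (Pi.single e 1) v = (if v = x then 1 else 0) - (if v = y then 1 else 0)) →
      R y := by
    rintro x y e c ⟨d, hd, hx⟩ h1 h2 hy
    refine ⟨d + c • Pi.single e 1, fun g => ?_, fun v => ?_⟩
    · by_cases hg : g = e
      · subst hg
        have := hd g
        simp only [Pi.add_apply, Pi.smul_apply, Pi.single_eq_same, smul_eq_mul, mul_one]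
        constructor
        · intro h
          rcases lt_or_ge 0 c with hc | hc
          · exact h1 hc
          · exact this.1 (by linarith)
        · intro h
          rcases lt_or_ge c 0 with hc | hc
          · exact h2 hc
          · exact this.2 (by linarith)
      · simpa [hg] using hd g
    · rw [excess_add, excess_smul, hx, hy]; ring
  refine ⟨Finset.univ.filter R, ⟨?_, ?_⟩, fun e => ⟨?_, ?_⟩⟩
  · simp only [Finset.mem_filter, Finset.mem_univ, true_and]
    exact ⟨0, fun e => by simp, fun v => by simp [excess, outflow, inflow]⟩
  · simp only [Finset.mem_filter, Finset.mem_univ, true_and]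
    rintro ⟨d, hd, hx⟩
    obtain ⟨ε, hε, hb⟩ := exists_step hf.1 hd
    have hfl : G.IsFlow (f + ε • d) := by
      rw [isFlow_iff]
      refine ⟨fun e => by simpa using hb e, fun v h1 h2 => ?_⟩
      rw [excess_add, excess_smul, hx, ((G.isFlow_iff f).1 hf.1).2 v h1 h2]
      simp [h1, h2]
    have h := hf.2 _ hfl
    change G.excess (f + ε • d) G.source ≤ G.excess f G.source at h
    rw [excess_add, excess_smul, hx] at h
    simp [hst] at h
    linarith
  · simp only [Finset.mem_filter, Finset.mem_univ, true_and]
    intro hR h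
    exact ext _ _ e 1 hR (fun _ => h) (fun h => by linarith) fun v => by rw [excess_single]; ring
  · simp only [Finset.mem_filter, Finset.mem_univ, true_and]
    intro hR h
    exact ext _ _ e (-1) hR (fun h => by linarith) (fun _ => h) fun v => by
      rw [excess_single]; ring

theorem mincutCap_spec [Fintype V] (G : Network V E) (hst : G.source ≠ G.sink) :
    (∃ C, G.IsCut C ∧ G.cutCap C = G.mincutCap) ∧ ∀ C, G.IsCut C → G.mincutCap ≤ G.cutCap C := by
  have hfin : {x : ℝ | ∃ C : Finset V, G.IsCut C ∧ G.cutCap C = x}.Finite :=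
    (Set.finite_range G.cutCap).subset (by rintro x ⟨C, _, rfl⟩; exact ⟨C, rfl⟩)
  constructor
  · have hne : {x : ℝ | ∃ C : Finset V, G.IsCut C ∧ G.cutCap C = x}.Nonempty :=
      ⟨_, {G.source}, ⟨by simp, by simpa using hst.symm⟩, rfl⟩
    exact hne.csInf_mem hfin
  · exact fun C hC => csInf_le hfin.bddBelow ⟨C, hC, rfl⟩

theorem mincutCap_eq_of [Fintype V] {G : Network V E} {x : ℝ} (hst : G.source ≠ G.sink)
    (h1 : ∃ C, G.IsCut C ∧ G.cutCap C = x) (h2 : ∀ C, G.IsCut C → x ≤ G.cutCap C) :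
    G.mincutCap = x := by
  obtain ⟨⟨C, hC, h⟩, h3⟩ := G.mincutCap_spec hst
  obtain ⟨D, hD, h'⟩ := h1
  have := h2 C hC
  have := h3 D hD
  linarith

theorem IsMaxFlow.mincutCap_eq [Fintype V] [DecidableEq E] {G : Network V E} {f : E → ℝ}
    (hf : G.IsMaxFlow f) (hst : G.source ≠ G.sink) : G.mincutCap = G.value f := by
  obtain ⟨C, hC, h⟩ := hf.exists_resClosed hst
  exact mincutCap_eq_of hst ⟨C, hC, cutCap_eq_value_of_resClosed hf.1 hC h⟩
    fun D hD => value_le_cutCap hf.1 hD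

/-! ### Removing an edge -/

variable [DecidableEq E]

theorem delete_cutCap (G : Network V E) (e : E) (C : Finset V) :
    (G.delete e).cutCap C
      = G.cutCap C - if G.tail e ∈ C ∧ G.head e ∉ C then G.cap e else 0 := by
  have h := Fintype.sum_eq_add_sum_subtype_ne
    (fun e => if G.tail e ∈ C ∧ G.head e ∉ C then G.cap e else 0) e
  rw [cutCap, cutCap, h, add_sub_cancel_left]
  rfl

theorem vitality_eq_zero_of [Fintype V] {G : Network V E} {e : E} (hst : G.source ≠ G.sink)
    (h0 : 0 ≤ G.cap e)
    (h : ∀ C, G.IsCut C → G.tail e ∈ C → G.head e ∉ C → G.mincutCap + G.cap e ≤ G.cutCap C) :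
    G.vitality e = 0 := by
  obtain ⟨⟨C, hC, h1⟩, h2⟩ := G.mincutCap_spec hst
  rw [vitality, sub_eq_zero, eq_comm]
  refine mincutCap_eq_of hst ⟨C, hC, ?_⟩ fun D hD => ?_
  · rw [delete_cutCap, h1]
    split_ifs with h3
    · have := h C hC h3.1 h3.2
      linarith
    · simp
  · rw [delete_cutCap]
    split_ifs with h3
    · have := h D hD h3.1 h3.2
      linarith
    · have := h2 D hD
      linarith

/-- An edge that carries no flow in some maximum flow is not vital. -/
theorem vitality_eq_zero_of_flow_zero [Fintype V] {G : Network V E} {e : E} {f : E → ℝ}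
    (hst : G.source ≠ G.sink) (h0 : 0 ≤ G.cap e) (hf : G.IsMaxFlow f) (hfe : f e = 0) :
    G.vitality e = 0 := by
  refine vitality_eq_zero_of hst h0 fun C hC h1 h2 => ?_
  rw [cutCap_eq hf.1 hC, hf.mincutCap_eq hst]
  have := cap_sub_le_resCut hf.1 h1 h2
  linarith

theorem vitality_eq_zero_of_loop [Fintype V] {G : Network V E} {e : E} (hst : G.source ≠ G.sink)
    (h0 : 0 ≤ G.cap e) (h : G.tail e = G.head e) : G.vitality e = 0 :=
  vitality_eq_zero_of hst h0 fun _ _ h1 h2 => absurd (h ▸ h1) h2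

theorem delete_mincutCap_le [Fintype V] {G : Network V E} {e : E} (hst : G.source ≠ G.sink)
    (h0 : 0 ≤ G.cap e) : (G.delete e).mincutCap ≤ G.mincutCap := by
  obtain ⟨⟨C, hC, h3⟩, -⟩ := G.mincutCap_spec hst
  refine (((G.delete e).mincutCap_spec hst).2 C hC).trans ?_
  rw [delete_cutCap, h3]
  split_ifs <;> linarith

theorem vitality_nonneg [Fintype V] {G : Network V E} {e : E} (hst : G.source ≠ G.sink)
    (h0 : 0 ≤ G.cap e) : 0 ≤ G.vitality e :=
  sub_nonneg.2 (delete_mincutCap_le hst h0)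

/-- For an edge saturated by some maximum flow, the vitality can be read off a cheapest cut that
separates the ends of the edge, whichever way the edge crosses it: a cut entered by the edge has
residual capacity at least the capacity of the edge. -/
theorem vitality_eq_of_saturated [Fintype V] {G : Network V E} {e : E} {f : E → ℝ}
    (hst : G.source ≠ G.sink) (h0 : 0 ≤ G.cap e) (hf : G.IsMaxFlow f) (hfe : f e = G.cap e)
    {x : ℝ} (h1 : ∃ C, G.IsCut C ∧ ¬ (G.tail e ∈ C ↔ G.head e ∈ C) ∧ G.cutCap C = x)
    (h2 : ∀ C, G.IsCut C → ¬ (G.tail e ∈ C ↔ G.head e ∈ C) → x ≤ G.cutCap C) :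
    G.vitality e = max 0 (G.mincutCap + G.cap e - x) := by
  obtain ⟨⟨C, hC, h3⟩, h4⟩ := G.mincutCap_spec hst
  obtain ⟨D, hD, hsep, h5⟩ := h1
  obtain ⟨⟨B, hB, h6⟩, h7⟩ := (G.delete e).mincutCap_spec hst
  have hle := delete_mincutCap_le hst h0
  have hD' : (G.delete e).mincutCap ≤ x - G.cap e := by
    by_cases h : G.tail e ∈ D
    · have h' : G.head e ∉ D := fun h' => hsep (iff_of_true h h')
      have := h7 D hD
      rw [delete_cutCap, h5, if_pos ⟨h, h'⟩] at this
      exact this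
    · have h' : G.head e ∈ D := by
        by_contra h'
        exact hsep (iff_of_false h h')
      have := le_resCut hf.1 h h'
      rw [← h5, cutCap_eq hf.1 hD]
      rw [hf.mincutCap_eq hst] at hle
      linarith
  rw [vitality]
  rw [delete_cutCap] at h6
  split_ifs at h6 with h
  · have := h2 B hB (by simp [h])
    rw [max_eq_right] <;> linarith
  · have := h4 B hB
    rw [max_eq_left] <;> linarith

theorem isVital_iff (G : Network V E) (e : E) : G.IsVital e ↔ 0 < G.vitality e := by
  rw [IsVital, vitality, sub_pos]

/-- The network in which the capacity of `e` is replaced by zero. -/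
def zeroCap (G : Network V E) (e : E) : Network V E :=
  { G with cap := Function.update G.cap e 0 }

theorem zeroCap_cutCap (G : Network V E) (e : E) (C : Finset V) :
    (G.zeroCap e).cutCap C = (G.delete e).cutCap C := by
  rw [delete_cutCap, eq_sub_iff_add_eq, cutCap, cutCap,
    ← Finset.add_sum_erase _ _ (Finset.mem_univ e),
    ← Finset.add_sum_erase (a := e) Finset.univ _ (Finset.mem_univ e)]
  have : ∀ g ∈ Finset.univ.erase e,
      (if (G.zeroCap e).tail g ∈ C ∧ (G.zeroCap e).head g ∉ C then (G.zeroCap e).cap g else 0)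
        = if G.tail g ∈ C ∧ G.head g ∉ C then G.cap g else 0 := by
    intro g hg
    simp [zeroCap, Finset.ne_of_mem_erase hg]
  rw [Finset.sum_congr rfl this]
  simp [zeroCap, add_comm]

theorem vitality_eq_of_zeroCap [Fintype V] {G : Network V E} {e : E} {g : E → ℝ}
    (hst : G.source ≠ G.sink) (hg : (G.zeroCap e).IsMaxFlow g) :
    G.vitality e = G.mincutCap - (G.zeroCap e).value g := by
  rw [vitality, ← hg.mincutCap_eq hst]
  congr 1
  unfold mincutCap
  congr 1
  ext x
  simp only [zeroCap_cutCap]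
  rfl

end Network

namespace Network

variable {V E : Type} [DecidableEq V] [Fintype E]

/-! ### Few candidates for the loose edges -/

/-- Room for changing the flow `f` on the edge `e` in both directions. -/
noncomputable def slack (G : Network V E) (f : E → ℝ) (e : E) : ℝ := min (f e) (G.cap e - f e)

/-- `d` sends one unit from `x` to `y`, and at most one unit along each edge, where the edges may
be traversed in both directions. -/
def UnitPath (G : Network V E) (d : E → ℝ) (x y : V) : Prop :=
  (∀ g, |d g| ≤ 1) ∧
    ∀ v, G.excess d v = (if v = x then 1 else 0) - (if v = y then 1 else 0)

/-- Pushing flow around the cycle that consists of `e` and of a path joining the ends of `e`. -/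
theorem isMaxFlow_push [DecidableEq E] {G : Network V E} {f d : E → ℝ} {e : E} (hf : G.IsMaxFlow f)
    (hd : G.UnitPath d (G.tail e) (G.head e)) (he : d e = 0)
    (hr : ∀ g, d g ≠ 0 → G.slack f e ≤ G.slack f g) {a : ℝ} (ha : |a| ≤ G.slack f e) :
    G.IsMaxFlow (f + a • (Pi.single e 1 - d)) := by
  have hx : ∀ v, G.excess (f + a • (Pi.single e 1 - d)) v = G.excess f v := by
    intro v
    have : (Pi.single e 1 - d : E → ℝ) = Pi.single e 1 + (-1 : ℝ) • d := by
      ext; simp [sub_eq_add_neg]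
    rw [excess_add, excess_smul, this, excess_add, excess_smul, excess_single, hd.2]
    ring
  have hb : ∀ g, 0 ≤ f g + a * ((Pi.single e 1 - d : E → ℝ) g) ∧
      f g + a * ((Pi.single e 1 - d : E → ℝ) g) ≤ G.cap g := by
    intro g
    have hfg := hf.1.1 g
    have key : ∀ c : ℝ, |c| ≤ G.slack f g → 0 ≤ f g + c ∧ f g + c ≤ G.cap g := by
      intro c hc
      have h1 := hc.trans (min_le_left _ _)
      have h2 := hc.trans (min_le_right _ _)
      have h3 := abs_le.1 h1
      have h4 := abs_le.1 h2
      constructor <;> linarith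
    by_cases hg : g = e
    · subst hg
      simpa [he] using key a ha
    · by_cases h0 : d g = 0
      · simpa [hg, h0] using hfg
      · apply key
        simp only [Pi.sub_apply, Pi.single_apply, hg, if_false, zero_sub, abs_mul, abs_neg]
        calc |a| * |d g| ≤ |a| * 1 := mul_le_mul_of_nonneg_left (hd.1 g) (abs_nonneg a)
          _ ≤ _ := by rw [mul_one]; exact ha.trans (hr g h0)
  refine ⟨(G.isFlow_iff _).2 ⟨by simpa using hb, fun v h1 h2 => ?_⟩, fun g hg => ?_⟩
  · rw [hx]
    exact ((G.isFlow_iff f).1 hf.1).2 v h1 h2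
  · have := hf.2 g hg
    change _ ≤ G.excess _ _
    rw [hx]
    exact this

/-- An edge whose ends are joined by a path of edges with at least as much slack is emptied or
saturated by some maximum flow. -/
theorem exists_emptied_or_saturated [DecidableEq E] {G : Network V E} {f d : E → ℝ} {e : E}
    (hf : G.IsMaxFlow f) (hd : G.UnitPath d (G.tail e) (G.head e)) (he : d e = 0)
    (hr : ∀ g, d g ≠ 0 → G.slack f e ≤ G.slack f g) :
    (f e ≤ G.cap e - f e → ∃ f', G.IsMaxFlow f' ∧ f' e = 0) ∧
      (G.cap e - f e ≤ f e → ∃ f', G.IsMaxFlow f' ∧ f' e = G.cap e) := by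
  have hb := hf.1.1 e
  constructor
  · intro h
    refine ⟨_, isMaxFlow_push hf hd he hr (a := - f e) ?_, by simp [he]⟩
    rw [slack, min_eq_left h, abs_neg, abs_of_nonneg hb.1]
  · intro h
    refine ⟨_, isMaxFlow_push hf hd he hr (a := G.cap e - f e) ?_, by simp [he]⟩
    rw [slack, min_eq_right h, abs_of_nonneg (by linarith)]

/-- Invariant of the greedy construction of a spanning forest of greatest total weight `r`. The
labels name the components of the forest that the chosen edges form. -/
structure ForestInv (G : Network V E) (r : E → ℝ) (lab : V → ℕ) (mark : E → Prop) : Prop where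
  internal : ∀ g, mark g → lab (G.tail g) = lab (G.head g)
  joined : ∀ x y, lab x = lab y →
    ∃ d, G.UnitPath d x y ∧ ∀ g, d g ≠ 0 → mark g ∧ lab (G.tail g) = lab x
  heavy : ∀ e, lab (G.tail e) = lab (G.head e) →
    ∃ d, G.UnitPath d (G.tail e) (G.head e) ∧ ∀ g, d g ≠ 0 → mark g ∧ r e ≤ r g
  light : ∀ e, lab (G.tail e) ≠ lab (G.head e) → ∀ g, mark g → r e ≤ r g

theorem UnitPath.nil (G : Network V E) (x : V) : G.UnitPath 0 x x :=
  ⟨by simp, fun v => by simp [excess, outflow, inflow]⟩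

theorem UnitPath.neg {G : Network V E} {d : E → ℝ} {x y : V} (h : G.UnitPath d x y) :
    G.UnitPath (-d) y x := by
  refine ⟨fun g => by simpa using h.1 g, fun v => ?_⟩
  have : -d = (-1 : ℝ) • d := by simp
  rw [this, excess_smul, h.2]
  ring

theorem ForestInv.init (G : Network V E) (r : E → ℝ) {lab : V → ℕ} (h : Function.Injective lab) :
    G.ForestInv r lab fun _ => False where
  internal := fun _ h => h.elim
  joined := fun x y hxy => by
    obtain rfl := h hxy
    exact ⟨0, UnitPath.nil G x, by simp⟩
  heavy := fun e he => by
    rw [h he]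
    exact ⟨0, UnitPath.nil G _, by simp⟩
  light := fun _ _ _ h => h.elim

/-- Choosing a heaviest edge between different components. -/
theorem ForestInv.step [DecidableEq E] {G : Network V E} {r : E → ℝ} {lab : V → ℕ} {mark : E → Prop}
    (h : G.ForestInv r lab mark) {b : E} (hb : lab (G.tail b) ≠ lab (G.head b))
    (hmax : ∀ e, lab (G.tail e) ≠ lab (G.head e) → r e ≤ r b) :
    G.ForestInv r (fun v => if lab v = lab (G.head b) then lab (G.tail b) else lab v)
      (fun e => mark e ∨ e = b) := by
  set lab' : V → ℕ := fun v => if lab v = lab (G.head b) then lab (G.tail b) else lab v with hlab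
  have hold : ∀ x y, lab x = lab y → lab' x = lab' y := by
    intro x y hxy
    simp only [hlab, hxy]
  have hnew : lab' (G.tail b) = lab' (G.head b) := by
    simp only [hlab, if_true]
    split_ifs <;> rfl
  -- a path through the new edge
  have cross : ∀ x y, lab x = lab (G.tail b) → lab y = lab (G.head b) →
      ∃ d, G.UnitPath d x y ∧ ∀ g, d g ≠ 0 → (mark g ∨ g = b) ∧ lab' (G.tail g) = lab' x := by
    intro x y hx hy
    obtain ⟨d₁, h1, h1'⟩ := h.joined x (G.tail b) hx
    obtain ⟨d₂, h2, h2'⟩ := h.joined (G.head b) y hy.symm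
    have hnb : ¬ mark b := fun hm => hb (h.internal b hm)
    have h1b : d₁ b = 0 := by
      by_contra h0; exact hnb (h1' b h0).1
    have h2b : d₂ b = 0 := by
      by_contra h0; exact hnb (h2' b h0).1
    refine ⟨d₁ + Pi.single b 1 + d₂, ⟨fun g => ?_, fun v => ?_⟩, fun g hg => ?_⟩
    · by_cases hg : g = b
      · subst hg
        simp [h1b, h2b]
      · simp only [Pi.add_apply, Pi.single_apply, hg, if_false, add_zero]
        by_cases h0 : d₁ g = 0
        · simpa [h0] using h2.1 g
        · have : d₂ g = 0 := by
            by_contra h0'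
            have e1 := (h1' g h0).2
            have e2 := (h2' g h0').2
            exact hb (hx.symm.trans (e1.symm.trans e2))
          simpa [this] using h1.1 g
    · rw [excess_add, excess_add, excess_single, h1.2, h2.2]
      ring
    · have hxl : lab' x = lab' (G.tail b) := hold _ _ hx
      by_cases hgb : g = b
      · subst hgb
        exact ⟨Or.inr rfl, hxl.symm⟩
      · by_cases h0 : d₁ g = 0
        · have h0' : d₂ g ≠ 0 := by
            intro h0'
            simp [h0, h0', hgb] at hg
          obtain ⟨a1, a2⟩ := h2' g h0'
          exact ⟨Or.inl a1, (hold _ _ a2).trans (hnew.symm.trans hxl.symm)⟩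
        · obtain ⟨a1, a2⟩ := h1' g h0
          exact ⟨Or.inl a1, hold _ _ a2⟩
  have joined' : ∀ x y, lab' x = lab' y →
      ∃ d, G.UnitPath d x y ∧ ∀ g, d g ≠ 0 → (mark g ∨ g = b) ∧ lab' (G.tail g) = lab' x := by
    intro x y hxy
    by_cases hs : lab x = lab y
    · obtain ⟨d, h1, h2⟩ := h.joined x y hs
      exact ⟨d, h1, fun g hg => ⟨Or.inl (h2 g hg).1, hold _ _ (h2 g hg).2⟩⟩
    · simp only [hlab] at hxy
      split_ifs at hxy with hx hy hy
      · exact absurd (hx.trans hy.symm) hs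
      · obtain ⟨d, h1, h2⟩ := cross y x hxy.symm hx
        refine ⟨-d, h1.neg, fun g hg => ?_⟩
        obtain ⟨a1, a2⟩ := h2 g (by simpa using hg)
        refine ⟨a1, a2.trans ?_⟩
        simp only [hlab, hx, hy, if_true, if_false]
        exact hxy.symm
      · exact cross x y hxy hy
      · exact absurd hxy hs
  refine ⟨?_, joined', fun e he => ?_, fun e he g hg => ?_⟩
  · rintro g (hg | rfl)
    · exact hold _ _ (h.internal g hg)
    · exact hnew
  · by_cases hs : lab (G.tail e) = lab (G.head e)
    · obtain ⟨d, h1, h2⟩ := h.heavy e hs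
      exact ⟨d, h1, fun g hg => ⟨Or.inl (h2 g hg).1, (h2 g hg).2⟩⟩
    · obtain ⟨d, h1, h2⟩ := joined' _ _ he
      refine ⟨d, h1, fun g hg => ⟨(h2 g hg).1, ?_⟩⟩
      rcases (h2 g hg).1 with hm | rfl
      · exact h.light e hs g hm
      · exact hmax e hs
  · have hs : lab (G.tail e) ≠ lab (G.head e) := fun hs => he (hold _ _ hs)
    rcases hg with hm | rfl
    · exact h.light e hs g hm
    · exact hmax e hs

/-- Each merge removes a label. -/
theorem card_labels_merge {W : Type*} [Fintype W] (lab : W → ℕ) {x y : W} (h : lab x ≠ lab y) :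
    (Finset.univ.image fun v => if lab v = lab y then lab x else lab v).card + 1
      ≤ (Finset.univ.image lab).card := by
  have hy : lab y ∈ Finset.univ.image lab := Finset.mem_image_of_mem _ (Finset.mem_univ y)
  rw [← Finset.card_erase_add_one hy]
  gcongr
  intro a ha
  obtain ⟨v, _, rfl⟩ := Finset.mem_image.1 ha
  split_ifs with hv
  · exact Finset.mem_erase.2 ⟨h, Finset.mem_image_of_mem _ (Finset.mem_univ x)⟩
  · exact Finset.mem_erase.2 ⟨hv, Finset.mem_image_of_mem _ (Finset.mem_univ v)⟩

/-- When no edge joins different components, the edges outside the forest are emptied or saturated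
by some maximum flow. -/
theorem ForestInv.unmarked [DecidableEq E] {G : Network V E} {f : E → ℝ} {lab : V → ℕ} {mark : E → Prop}
    (h : G.ForestInv (G.slack f) lab mark) (hf : G.IsMaxFlow f) {e : E}
    (he : lab (G.tail e) = lab (G.head e)) (hm : ¬ mark e) :
    (f e ≤ G.cap e - f e → ∃ f', G.IsMaxFlow f' ∧ f' e = 0) ∧
      (G.cap e - f e ≤ f e → ∃ f', G.IsMaxFlow f' ∧ f' e = G.cap e) := by
  obtain ⟨d, h1, h2⟩ := h.heavy e he
  refine exists_emptied_or_saturated hf h1 ?_ fun g hg => (h2 g hg).2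
  by_contra h0
  exact hm (h2 e h0).1

theorem not_isLoose_of [Fintype V] [DecidableEq E] {G : Network V E} {f : E → ℝ} {e : E}
    (hst : G.source ≠ G.sink) (h0 : 0 ≤ G.cap e)
    (h : (f e ≤ G.cap e - f e → ∃ f', G.IsMaxFlow f' ∧ f' e = 0) ∧
      (G.cap e - f e ≤ f e → ∃ f', G.IsMaxFlow f' ∧ f' e = G.cap e)) : ¬ G.IsLoose e := by
  rintro ⟨hv, ht⟩
  rcases le_total (f e) (G.cap e - f e) with h1 | h1
  · obtain ⟨f', hf', h2⟩ := h.1 h1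
    rw [isVital_iff, vitality_eq_zero_of_flow_zero hst h0 hf' h2] at hv
    exact lt_irrefl _ hv
  · exact ht (h.2 h1)

/-! ### Cheapest cuts separating two vertices -/

/-- The cut `C` separates the vertices `u` and `v`, in either direction. -/
def Separates (C : Finset V) (u v : V) : Prop := ¬ (u ∈ C ↔ v ∈ C)

/-- Least capacity of an `(s,t)`-cut that separates `u` and `v`, in either direction. -/
noncomputable def sepCap (G : Network V E) (u v : V) : ℝ :=
  sInf {x : ℝ | ∃ C : Finset V, (G.IsCut C ∧ Separates C u v) ∧ G.cutCap C = x}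

theorem sepCap_comm (G : Network V E) (u v : V) : G.sepCap u v = G.sepCap v u := by
  simp only [sepCap, Separates, iff_comm]

variable [Fintype V]

theorem sepCap_le (G : Network V E) {u v : V} {C : Finset V} (hC : G.IsCut C)
    (h : Separates C u v) : G.sepCap u v ≤ G.cutCap C := by
  refine csInf_le (Set.Finite.bddBelow ?_) ⟨C, ⟨hC, h⟩, rfl⟩
  exact (Set.finite_range G.cutCap).subset (by rintro x ⟨C, _, rfl⟩; exact ⟨C, rfl⟩)

theorem exists_separating {V E : Type} [DecidableEq V] (G : Network V E)
    (hst : G.source ≠ G.sink) {u v : V} (huv : u ≠ v) : ∃ C, G.IsCut C ∧ Separates C u v := by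
  have key : ∀ {u v : V}, u ≠ v → u ≠ G.sink → v ≠ G.source → ∃ C, G.IsCut C ∧ Separates C u v := by
    intro u v huv hu hv
    exact ⟨{G.source, u}, ⟨by simp, by simp [hst.symm, hu.symm]⟩, by simp [Separates, hv, huv.symm]⟩
  by_cases hu : u = G.sink
  · obtain ⟨C, hC, h⟩ := key huv.symm (by rw [← hu]; exact huv.symm) (by rw [hu]; exact hst.symm)
    exact ⟨C, hC, fun h' => h h'.symm⟩
  · by_cases hv : v = G.source
    · obtain ⟨C, hC, h⟩ := key huv.symm (by rw [hv]; exact hst) (by rw [← hv]; exact huv)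
      exact ⟨C, hC, fun h' => h h'.symm⟩
    · exact key huv hu hv

theorem exists_sepCap_eq (G : Network V E) (hst : G.source ≠ G.sink) {u v : V} (huv : u ≠ v) :
    ∃ C, G.IsCut C ∧ Separates C u v ∧ G.cutCap C = G.sepCap u v := by
  have hfin : {x : ℝ | ∃ C : Finset V, (G.IsCut C ∧ Separates C u v) ∧ G.cutCap C = x}.Finite :=
    (Set.finite_range G.cutCap).subset (by rintro x ⟨C, _, rfl⟩; exact ⟨C, rfl⟩)
  obtain ⟨C, hC⟩ := G.exists_separating hst huv
  have hne : {x : ℝ | ∃ C : Finset V, (G.IsCut C ∧ Separates C u v) ∧ G.cutCap C = x}.Nonempty :=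
    ⟨_, C, hC, rfl⟩
  obtain ⟨D, h1, h2⟩ := hne.csInf_mem hfin
  exact ⟨D, h1.1, h1.2, h2⟩

theorem sepCap_ultra (G : Network V E) (hst : G.source ≠ G.sink) {u w : V} (huw : u ≠ w) (v : V) :
    min (G.sepCap u v) (G.sepCap v w) ≤ G.sepCap u w := by
  obtain ⟨C, hC, hs, h⟩ := G.exists_sepCap_eq hst huw
  rw [← h]
  by_cases huv : Separates C u v
  · exact (min_le_left _ _).trans (G.sepCap_le hC huv)
  · refine (min_le_right _ _).trans (G.sepCap_le hC fun h' => ?_)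
    exact hs ((not_not.1 huv).trans h')

/-- The network in which `u` is merged into the source and `v` into the sink. -/
def contract (G : Network V E) (u v : V) : Network V E where
  tail e := if G.tail e = u then G.source else if G.tail e = v then G.sink else G.tail e
  head e := if G.head e = u then G.source else if G.head e = v then G.sink else G.head e
  cap := G.cap
  source := G.source
  sink := G.sink

/-- A set that starts at the source and `u` and is generated by the residual arcs of a maximum flow
of the contracted network is a cheapest cut with `u` inside and `v` outside. -/
theorem contract_cut [DecidableEq E] {G : Network V E} (hst : G.source ≠ G.sink) {u v : V} (huv : u ≠ v)
    (hu : u ≠ G.sink) (hv : v ≠ G.source) {f : E → ℝ} (hf : (G.contract u v).IsMaxFlow f)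
    {S : Finset V} (hsS : G.source ∈ S) (huS : u ∈ S) (hcl : G.ResClosed f S)
    (hmin : ∀ C : Finset V, G.source ∈ C → u ∈ C → G.ResClosed f C → S ⊆ C) :
    G.IsCut S ∧ v ∉ S ∧ ∀ C, G.IsCut C → u ∈ C → v ∉ C → G.cutCap S ≤ G.cutCap C := by
  set ρ : V → V := fun x => if x = u then G.source else if x = v then G.sink else x with hρ
  have htail : ∀ e, (G.contract u v).tail e = ρ (G.tail e) := fun e => rfl
  have hhead : ∀ e, (G.contract u v).head e = ρ (G.head e) := fun e => rfl
  have hρm : ∀ C, G.IsCut C → u ∈ C → v ∉ C → ∀ x, ρ x ∈ C ↔ x ∈ C := by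
    intro C hC h1 h2 x
    simp only [hρ]
    split_ifs with hx hx'
    · simp [hx, hC.1, h1]
    · simp [hx', hC.2, h2]
    · rfl
  have hcap : ∀ C, G.IsCut C → u ∈ C → v ∉ C → (G.contract u v).cutCap C = G.cutCap C := by
    intro C hC h1 h2
    simp only [cutCap, htail, hhead, hρm C hC h1 h2]
    rfl
  have hst' : (G.contract u v).source ≠ (G.contract u v).sink := hst
  obtain ⟨C, hC, hCcl⟩ := hf.exists_resClosed hst'
  have hss : ρ G.source = G.source := by
    simp only [hρ]
    split_ifs with h1 h2
    · rfl
    · exact absurd h2.symm hv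
    · rfl
  have htt : ρ G.sink = G.sink := by
    simp only [hρ]
    split_ifs with h1 h2
    · exact absurd h1.symm hu
    · rfl
    · rfl
  have hsub : S ⊆ Finset.univ.filter fun x => ρ x ∈ C := by
    apply hmin
    · simpa [hss] using (show G.source ∈ C from hC.1)
    · simpa [hρ] using (show G.source ∈ C from hC.1)
    · intro e
      have := hCcl e
      rw [htail, hhead] at this
      change (_ → f e < G.cap e → _) ∧ _ at this
      simpa using this
  have hS : G.IsCut S := by
    refine ⟨hsS, fun h => ?_⟩
    have := hsub h
    simp only [Finset.mem_filter, htt] at this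
    exact hC.2 this.2
  have hvS : v ∉ S := by
    intro h
    have := hsub h
    simp only [Finset.mem_filter, hρ, huv.symm, if_false, if_true] at this
    exact hC.2 this.2
  refine ⟨hS, hvS, fun D hD h1 h2 => ?_⟩
  rw [← hcap S hS huS hvS, ← hcap D hD h1 h2]
  have hcl' : (G.contract u v).ResClosed f S := by
    intro e
    rw [htail, hhead, hρm S hS huS hvS, hρm S hS huS hvS]
    exact hcl e
  rw [cutCap_eq_value_of_resClosed hf.1 hS hcl']
  exact value_le_cutCap hf.1 hD

end Network

/-! ### All cheapest separating cuts from few of them -/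

/-- Invariant of the computation of an ultrametric-like function `F` on `{0, …, n - 1}`. The
vertices below `q` represent classes, `cls` assigns a representative to each vertex, and `M` tells
the values of `F` on pairs of representatives. The last condition says that passing to
representatives does not decrease `F`. -/
structure ClassInv (n : ℕ) (F : ℕ → ℕ → ℝ) (q : ℕ) (cls : ℕ → ℕ) (M : ℕ → ℕ → ℝ) : Prop where
  lt : ∀ v < n, cls v < q
  rep : ∀ a < q, cls a = a
  val : ∀ a < q, ∀ b < q, a ≠ b → M a b = F a b
  le : ∀ v < n, ∀ w < n, cls v ≠ cls w → F v w ≤ F (cls v) (cls w)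

open Classical in
/-- The vertex `q` becomes a representative. Its class takes over the vertices on its side of a
cheapest cut `S` between `q` and its old representative, out of the classes that are harder to
separate from the old representative than `q` is. -/
theorem ClassInv.step {n : ℕ} {F : ℕ → ℕ → ℝ} {q : ℕ} {cls : ℕ → ℕ} {M : ℕ → ℕ → ℝ}
    (h : ClassInv n F q cls M) (hq : q < n) (hsymm : ∀ a b, F a b = F b a)
    (hultra : ∀ a < n, ∀ b < n, ∀ c < n, a ≠ c → min (F a b) (F b c) ≤ F a c)
    {S : ℕ → Prop} (hSq : ¬ (S q ↔ S (cls q)))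
    (hS : ∀ a < n, ∀ b < n, ¬ (S a ↔ S b) → F a b ≤ F (cls q) q)
    {cls' : ℕ → ℕ} {M' : ℕ → ℕ → ℝ}
    (hcls : ∀ v < n, cls' v = if (cls v = cls q ∨ F (cls q) q < M (cls q) (cls v)) ∧ (S v ↔ S q)
      then q else cls v)
    (hM : ∀ a < q, ∀ b < q, M' a b = M a b)
    (hMq : ∀ b < q, M' q b = if b = cls q then F (cls q) q else min (F (cls q) q) (M (cls q) b))
    (hMq' : ∀ b < q, M' b q = M' q b) :
    ClassInv n F (q + 1) cls' M' := by
  have hp : cls q < q := h.lt q hq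
  set p := cls q with hpdef
  have hpn : p < n := hp.trans hq
  set f := F p q with hf
  -- representatives that are hard to separate from `p` lie on the side of `p`
  have hside : ∀ a < q, (a = p ∨ f < M p a) → ¬ (S a ↔ S q) := by
    intro a ha hT hs
    by_cases hap : a = p
    · exact hSq (by rw [← hs, hap])
    · have h1 : f < M p a := hT.resolve_left hap
      rw [h.val p hp a ha (Ne.symm hap)] at h1
      have := hS p hpn a (ha.trans hq) fun h2 => hSq (by rw [← hs, h2])
      exact absurd this (not_le.2 h1)
  have hrep : ∀ a < q, cls' a = a := by
    intro a ha
    rw [hcls a (ha.trans hq), h.rep a ha, if_neg]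
    exact fun hc => hside a ha hc.1 hc.2
  have hrepq : cls' q = q := by
    rw [hcls q hq, if_pos]
    exact ⟨Or.inl rfl, Iff.rfl⟩
  -- the new values
  have hval : ∀ b < q, M' q b = F q b := by
    intro b hb
    rw [hMq b hb]
    split_ifs with hbp
    · rw [hbp, hsymm q p]
    · rw [h.val p hp b hb (Ne.symm hbp)]
      have hbn := hb.trans hq
      have hqb : q ≠ b := hb.ne'
      have hu := hultra q hq p hpn b hbn hqb
      rw [hsymm q p] at hu
      refine le_antisymm hu ?_
      rcases lt_or_ge f (F p b) with h1 | h1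
      · rw [min_eq_left h1.le]
        refine hS q hq b hbn fun h2 => ?_
        refine hside b hb (Or.inr ?_) h2.symm
        rwa [h.val p hp b hb (Ne.symm hbp)]
      · rw [min_eq_right h1]
        have := h.le q hq b hbn (by rw [h.rep b hb]; exact Ne.symm hbp)
        rwa [h.rep b hb] at this
  -- vertices of the new class against the others
  have hle : ∀ v < n, ∀ w < n, cls' v = q → cls' w ≠ q → F v w ≤ F q (cls' w) := by
    intro v hv w hw hvq hwq
    have hw' := hcls w hw
    have hv' := hcls v hv
    have hclsv := h.lt v hv
    have hclsw := h.lt w hw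
    split_ifs at hw' with hTw
    · exact absurd hw' hwq
    split_ifs at hv' with hTv
    swap
    · omega
    rw [hw', ← hval _ hclsw, hMq _ hclsw]
    by_cases hT : cls w = p ∨ f < M p (cls w)
    · have hws : ¬ (S w ↔ S q) := fun hs => hTw ⟨hT, hs⟩
      have h1 : F v w ≤ f := hS v hv w hw fun hs => hws (by rw [← hs, hTv.2])
      split_ifs with hwp
      · exact h1
      · exact le_min h1 (h1.trans (hT.resolve_left hwp).le)
    · have hwp : cls w ≠ p := fun hc => hT (Or.inl hc)
      have hMw : M p (cls w) ≤ f := not_lt.1 fun hc => hT (Or.inr hc)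
      rw [if_neg hwp, min_eq_right hMw]
      rw [h.val p hp _ hclsw (Ne.symm hwp)] at hMw ⊢
      have hne : cls v ≠ cls w := by
        intro hc
        rw [← hc, ← h.val p hp _ hclsv (by rw [hc]; exact Ne.symm hwp)] at hMw
        rcases hTv.1 with h2 | h2
        · exact hwp (hc ▸ h2)
        · exact absurd hMw (not_le.2 h2)
      refine (h.le v hv w hw hne).trans ?_
      by_cases hvp : cls v = p
      · rw [hvp]
      · have h2 : f < F p (cls v) := by
          rw [← h.val p hp _ hclsv (Ne.symm hvp)]
          exact hTv.1.resolve_left hvp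
        have := hultra p hpn (cls v) (hclsv.trans hq) (cls w) (hclsw.trans hq) (Ne.symm hwp)
        rcases min_le_iff.1 this with h3 | h3
        · linarith
        · exact h3
  refine ⟨fun v hv => ?_, fun a ha => ?_, fun a ha b hb hab => ?_, fun v hv w hw hne => ?_⟩
  · rw [hcls v hv]
    have := h.lt v hv
    split_ifs <;> omega
  · rcases Nat.lt_succ_iff_lt_or_eq.1 ha with h1 | rfl
    · exact hrep a h1
    · exact hrepq
  · rcases Nat.lt_succ_iff_lt_or_eq.1 ha with h1 | rfl <;>
      rcases Nat.lt_succ_iff_lt_or_eq.1 hb with h2 | rfl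
    · rw [hM a h1 b h2, h.val a h1 b h2 hab]
    · rw [hMq' a h1, hval a h1, hsymm]
    · exact hval b h2
    · exact absurd rfl hab
  · by_cases hvq : cls' v = q
    · rw [hvq]
      exact hle v hv w hw hvq fun h1 => hne (hvq.trans h1.symm)
    · by_cases hwq : cls' w = q
      · rw [hwq, hsymm v w, hsymm _ q]
        exact hle w hw v hv hwq hvq
      · have hv' := hcls v hv
        have hw' := hcls w hw
        split_ifs at hv' with h1
        · exact absurd hv' hvq
        split_ifs at hw' with h2
        · exact absurd hw' hwq
        rw [hv', hw'] at hne ⊢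
        exact h.le v hv w hw hne

namespace Network

/-! ### Testing whether some maximum flow saturates an edge -/

theorem sum_excess_univ {V E : Type} [DecidableEq V] [Fintype E] [Fintype V] (G : Network V E)
    (f : E → ℝ) : ∑ v, G.excess f v = 0 := by
  simp [sum_excess]

theorem IsFlow.excess_sink {V E : Type} [DecidableEq V] [Fintype E] [Fintype V] {G : Network V E}
    {f : E → ℝ} (hf : G.IsFlow f) (hst : G.source ≠ G.sink) :
    G.excess f G.sink = - G.excess f G.source := by
  have h := G.sum_excess_univ f
  rw [← Finset.add_sum_erase _ _ (Finset.mem_univ G.sink), Finset.sum_eq_single G.source] at h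
  · linarith
  · intro v hv hs
    exact ((G.isFlow_iff f).1 hf).2 v hs (Finset.ne_of_mem_erase hv)
  · exact fun h => absurd (Finset.mem_erase.2 ⟨hst, Finset.mem_univ _⟩) h

theorem IsMaxFlow.value_nonneg {V E : Type} [DecidableEq V] [Fintype E] {G : Network V E}
    {f : E → ℝ} (hf : G.IsMaxFlow f) (h0 : ∀ e, 0 ≤ G.cap e) : 0 ≤ G.value f := by
  have := hf.2 0 ⟨fun e => ⟨le_rfl, h0 e⟩, fun v _ _ => by simp [inflow, outflow]⟩
  simpa [value, inflow, outflow] using this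

variable {n m : ℕ}

/-- The network without `e`, with a new source that feeds `x` units into the old source and `cap e`
units into the head of `e`, and a new sink that takes `x` units from the old sink and `cap e` units
from the tail of `e`. Its new edges can be saturated exactly if the old network has a flow of value
`x` that saturates `e`. -/
def forceNet (G : Network (Fin n) (Fin m)) (e : Fin m) (x : ℝ) :
    Network (Fin (n + 2)) (Fin (m + 4)) where
  tail := Fin.addCases (fun g => Fin.castAdd 2 (G.tail g))
    ![Fin.natAdd n 0, Fin.natAdd n 0, Fin.castAdd 2 G.sink, Fin.castAdd 2 (G.tail e)]
  head := Fin.addCases (fun g => Fin.castAdd 2 (G.head g))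
    ![Fin.castAdd 2 G.source, Fin.castAdd 2 (G.head e), Fin.natAdd n 1, Fin.natAdd n 1]
  cap := Fin.addCases (fun g => if g = e then 0 else G.cap g) ![x, G.cap e, x, G.cap e]
  source := Fin.natAdd n 0
  sink := Fin.natAdd n 1

theorem forceNet_old (G : Network (Fin n) (Fin m)) (e : Fin m) (x : ℝ) (g : Fin m) :
    (G.forceNet e x).tail (Fin.castAdd 4 g) = Fin.castAdd 2 (G.tail g) ∧
      (G.forceNet e x).head (Fin.castAdd 4 g) = Fin.castAdd 2 (G.head g) ∧
      (G.forceNet e x).cap (Fin.castAdd 4 g) = if g = e then 0 else G.cap g := by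
  simp [forceNet]

theorem forceNet_tail_new (G : Network (Fin n) (Fin m)) (e : Fin m) (x : ℝ) (i : Fin 4) :
    (G.forceNet e x).tail (Fin.natAdd m i) = ![Fin.natAdd n 0, Fin.natAdd n 0,
      Fin.castAdd 2 G.sink, Fin.castAdd 2 (G.tail e)] i := by
  simp [forceNet]

theorem forceNet_head_new (G : Network (Fin n) (Fin m)) (e : Fin m) (x : ℝ) (i : Fin 4) :
    (G.forceNet e x).head (Fin.natAdd m i) = ![Fin.castAdd 2 G.source, Fin.castAdd 2 (G.head e),
      Fin.natAdd n 1, Fin.natAdd n 1] i := by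
  simp [forceNet]

theorem forceNet_cap_new (G : Network (Fin n) (Fin m)) (e : Fin m) (x : ℝ) (i : Fin 4) :
    (G.forceNet e x).cap (Fin.natAdd m i) = ![x, G.cap e, x, G.cap e] i := by
  simp [forceNet]

theorem natAdd_ne_castAdd (i : Fin 2) (v : Fin n) : Fin.natAdd n i ≠ Fin.castAdd 2 v := by
  intro hc
  have := congrArg Fin.val hc
  simp at this
  omega

theorem forceNet_excess_old (G : Network (Fin n) (Fin m)) (e : Fin m) (x : ℝ)
    (h : Fin (m + 4) → ℝ) (v : Fin n) :
    (G.forceNet e x).excess h (Fin.castAdd 2 v)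
      = G.excess (fun g => h (Fin.castAdd 4 g)) v
        + ((if v = G.sink then h (Fin.natAdd m 2) else 0)
          + if v = G.tail e then h (Fin.natAdd m 3) else 0)
        - ((if v = G.source then h (Fin.natAdd m 0) else 0)
          + if v = G.head e then h (Fin.natAdd m 1) else 0) := by
  simp only [excess, outflow, inflow, Fin.sum_univ_add (a := m) (b := 4), forceNet_old,
    forceNet_tail_new, forceNet_head_new, Fin.castAdd_inj, Fin.sum_univ_four, Matrix.cons_val,
    natAdd_ne_castAdd, if_false, eq_comm (b := v)]
  ring

theorem forceNet_excess_source (G : Network (Fin n) (Fin m)) (e : Fin m) (x : ℝ)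
    (h : Fin (m + 4) → ℝ) :
    (G.forceNet e x).excess h (Fin.natAdd n 0) = h (Fin.natAdd m 0) + h (Fin.natAdd m 1) := by
  have h2 : (Fin.natAdd n 1 : Fin (n + 2)) ≠ Fin.natAdd n 0 := by
    intro hc
    have := congrArg Fin.val hc
    simp at this
  simp only [excess, outflow, inflow, Fin.sum_univ_add (a := m) (b := 4), forceNet_old,
    forceNet_tail_new, forceNet_head_new, Fin.sum_univ_four, Matrix.cons_val, h2,
    (natAdd_ne_castAdd _ _).symm, if_false, if_true]
  simp

theorem forceNet_cap_nonneg {G : Network (Fin n) (Fin m)} (h0 : ∀ e, 0 ≤ G.cap e) (e : Fin m)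
    {x : ℝ} (hx : 0 ≤ x) (g : Fin (m + 4)) : 0 ≤ (G.forceNet e x).cap g := by
  refine Fin.addCases (fun g => ?_) (fun i => ?_) g
  · simp only [forceNet, Fin.addCases_left]
    split_ifs
    · exact le_rfl
    · exact h0 g
  · simp only [forceNet, Fin.addCases_right]
    fin_cases i <;> simp [hx, h0]

/-- The flow test for tightness. -/
theorem exists_saturating_iff {G : Network (Fin n) (Fin m)} (hst : G.source ≠ G.sink)
    (h0 : ∀ e, 0 ≤ G.cap e) {f : Fin m → ℝ} (hf : G.IsMaxFlow f) (e : Fin m)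
    {h : Fin (m + 4) → ℝ} (hh : (G.forceNet e (G.value f)).IsMaxFlow h) :
    (∃ f', G.IsMaxFlow f' ∧ f' e = G.cap e) ↔
      h (Fin.natAdd m 0) + h (Fin.natAdd m 1) = G.value f + G.cap e := by
  set x := G.value f with hx
  have hx0 : 0 ≤ x := hf.value_nonneg h0
  have hb := hh.1.1
  have b0 := hb (Fin.natAdd m 0)
  have b1 := hb (Fin.natAdd m 1)
  have b2 := hb (Fin.natAdd m 2)
  have b3 := hb (Fin.natAdd m 3)
  simp only [forceNet, Fin.addCases_right, Matrix.cons_val] at b0 b1 b2 b3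
  have hne : ∀ (i : Fin 2) (v : Fin n), Fin.castAdd 2 v ≠ Fin.natAdd n i :=
    fun i v => (natAdd_ne_castAdd i v).symm
  constructor
  · rintro ⟨f', hf', hfe⟩
    refine le_antisymm (by linarith) ?_
    have hval : G.excess f' G.source = x := le_antisymm (hf.2 _ hf'.1) (hf'.2 _ hf.1)
    have hsink := hf'.1.excess_sink hst
    let h' : Fin (m + 4) → ℝ :=
      Fin.addCases (f' + (-G.cap e) • Pi.single e 1) ![x, G.cap e, x, G.cap e]
    have hfl : (G.forceNet e x).IsFlow h' := by
      rw [isFlow_iff]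
      constructor
      · intro g
        refine Fin.addCases (fun g => ?_) (fun i => ?_) g
        · simp only [h', forceNet, Fin.addCases_left, Pi.add_apply, Pi.smul_apply, Pi.single_apply]
          have := hf'.1.1 g
          split_ifs with hg
          · subst hg; simp [hfe]
          · simpa using this
        · simp only [h', forceNet, Fin.addCases_right]
          fin_cases i <;> simp [hx0, h0]
      · intro v
        refine Fin.addCases (fun v => ?_) (fun i => ?_) v
        · intro _ _
          rw [forceNet_excess_old]
          simp only [h', Fin.addCases_left, Fin.addCases_right, Matrix.cons_val]
          change G.excess (f' + (-G.cap e) • Pi.single e 1) v + _ - _ = 0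
          rw [excess_add, excess_smul, excess_single]
          by_cases hs : v = G.source
          · subst hs
            rw [hval, if_neg hst, if_pos rfl]
            split_ifs <;> ring
          · by_cases ht : v = G.sink
            · subst ht
              rw [hsink, hval, if_pos rfl, if_neg hs]
              split_ifs <;> ring
            · rw [((G.isFlow_iff f').1 hf'.1).2 v hs ht, if_neg hs, if_neg ht]
              split_ifs <;> ring
        · intro h1 h2
          fin_cases i
          · exact absurd rfl h1
          · exact absurd rfl h2
    have := hh.2 _ hfl
    change (G.forceNet e x).excess h' (Fin.natAdd n 0)
      ≤ (G.forceNet e x).excess h (Fin.natAdd n 0) at this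
    rw [forceNet_excess_source, forceNet_excess_source] at this
    simpa [h'] using this
  · intro hv
    have hh0 : h (Fin.natAdd m 0) = x := by linarith
    have hh1 : h (Fin.natAdd m 1) = G.cap e := by linarith
    have hex := ((isFlow_iff _ h).1 hh.1).2
    have hexv : ∀ v, (G.forceNet e x).excess h (Fin.castAdd 2 v) = 0 := fun v =>
      hex _ (hne 0 v) (hne 1 v)
    have hsrc : G.excess (fun g => h (Fin.castAdd 4 g)) G.source
        + ((if G.source = G.tail e then h (Fin.natAdd m 3) else 0)
          - if G.source = G.head e then G.cap e else 0) = x := by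
      have := hexv G.source
      rw [forceNet_excess_old, if_neg hst, if_pos rfl, hh0, hh1] at this
      linarith
    -- the new sink receives what the new source emits
    have hh23 : h (Fin.natAdd m 2) = x ∧ h (Fin.natAdd m 3) = G.cap e := by
      have h1 := hh.1.excess_sink (by
        intro hc
        have := congrArg Fin.val hc
        simp [forceNet] at this)
      have hsrc' := forceNet_excess_source G e x h
      have h4 : (G.forceNet e x).excess h (Fin.natAdd n 1)
          = - (h (Fin.natAdd m 2) + h (Fin.natAdd m 3)) := by
        have h6 : (Fin.natAdd n 0 : Fin (n + 2)) ≠ Fin.natAdd n 1 := by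
          intro hc
          have := congrArg Fin.val hc
          simp at this
        simp only [excess, outflow, inflow, Fin.sum_univ_add (a := m) (b := 4), forceNet_old,
          forceNet_tail_new, forceNet_head_new, Fin.sum_univ_four, Matrix.cons_val, h6,
          (natAdd_ne_castAdd _ _).symm, if_false, if_true]
        simp
      change (G.forceNet e x).excess h (Fin.natAdd n 1)
        = - (G.forceNet e x).excess h (Fin.natAdd n 0) at h1
      rw [h4, hsrc'] at h1
      constructor <;> linarith
    obtain ⟨hh2, hh3⟩ := hh23
    have he0 : h (Fin.castAdd 4 e) = 0 := by
      have := hb (Fin.castAdd 4 e)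
      simp only [forceNet, Fin.addCases_left, if_true] at this
      linarith
    let f' : Fin m → ℝ := (fun g => h (Fin.castAdd 4 g)) + G.cap e • Pi.single e 1
    have hexc : ∀ v, G.excess f' v
        = (if v = G.source then x else 0) - (if v = G.sink then x else 0) := by
      intro v
      have := hexv v
      rw [forceNet_excess_old, hh0, hh1, hh2, hh3] at this
      rw [excess_add, excess_smul, excess_single]
      have e1 : G.cap e * ((if v = G.tail e then 1 else 0) - (if v = G.head e then 1 else 0))
          = (if v = G.tail e then G.cap e else 0) - (if v = G.head e then G.cap e else 0) := by
        split_ifs <;> ring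
      rw [e1]
      linarith
    have hfl : G.IsFlow f' := by
      rw [isFlow_iff]
      refine ⟨fun g => ?_, fun v h1 h2 => by rw [hexc, if_neg h1, if_neg h2, sub_zero]⟩
      have := hb (Fin.castAdd 4 g)
      simp only [forceNet, Fin.addCases_left] at this
      simp only [f', Pi.add_apply, Pi.smul_apply, Pi.single_apply]
      split_ifs at this ⊢ with hg
      · subst hg; simp [he0, h0]
      · simpa using this
    refine ⟨f', ⟨hfl, fun g hg => ?_⟩, by simp [f', he0]⟩
    refine (hf.2 g hg).trans_eq ?_
    change _ = G.excess f' G.source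
    rw [hexc, if_pos rfl, if_neg hst, sub_zero]

end Network

/-! ### Rank of an edge -/

/-- `X` holds the first edges of a list by decreasing vitality, and `e` comes next. -/
theorem Network.isKthMostVital_of {V : Type} [DecidableEq V] {m : ℕ} (G : Network V (Fin m))
    {e : Fin m} (X : Finset (Fin m)) (he : e ∉ X) (h1 : ∀ x ∈ X, ∀ y ∉ X, G.vitality y ≤ G.vitality x)
    (h2 : ∀ y ∉ X, G.vitality y ≤ G.vitality e) : G.IsKthMostVital (X.card + 1) e := by
  -- sort with the edges of `X` in front, followed by `e`
  let cl : Fin m → ℕ := fun x => if x ∈ X then 0 else if x = e then 1 else 2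
  let key : Fin m → ℕ ×ₗ ℝᵒᵈ := fun x => toLex (cl x, OrderDual.toDual (G.vitality x))
  set π := Tuple.sort key with hπ
  have hmono : ∀ i j, i ≤ j → cl (π i) < cl (π j) ∨
      cl (π i) = cl (π j) ∧ G.vitality (π j) ≤ G.vitality (π i) := fun i j hij =>
    Prod.Lex.toLex_le_toLex.1 (Tuple.monotone_sort key hij)
  have clX : ∀ x, cl x = 0 ↔ x ∈ X := by
    intro x; simp only [cl]; split_ifs <;> simp_all
  have cle : ∀ x, cl x = 1 ↔ x = e := by
    intro x; simp only [cl]; split_ifs <;> simp_all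
    rintro rfl; exact he ‹_›
  refine ⟨π, fun i j hij => ?_, π.symm e, ?_, π.apply_symm_apply e⟩
  · rcases hmono i j hij with h | h
    · have hj : π j ∉ X := fun hc => by
        rw [(clX _).2 hc] at h; omega
      by_cases hi : π i ∈ X
      · exact h1 _ hi _ hj
      · have : π i = e := by
          rw [← cle]
          have : cl (π j) ≤ 2 := by simp only [cl]; split_ifs <;> omega
          have := mt (clX _).1 hi
          omega
        simp only [this]
        exact h2 _ hj
    · exact h.2
  · have : X = (Finset.Iio (π.symm e)).map π.toEmbedding := by
      ext x
      simp only [Finset.mem_map_equiv, Finset.mem_Iio]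
      constructor
      · intro hx
        by_contra hlt
        have := hmono _ _ (not_lt.1 hlt)
        simp only [Equiv.apply_symm_apply, (clX x).2 hx, (cle e).2 rfl] at this
        omega
      · intro hlt
        have := hmono _ _ hlt.le
        simp only [Equiv.apply_symm_apply, (cle e).2 rfl] at this
        have hne : cl x ≠ 1 := fun hc => by
          rw [(cle x).1 hc] at hlt; exact lt_irrefl _ hlt
        rw [← clX]
        omega
    rw [this, Finset.card_map, Fin.card_Iio]

/-! ### Reasoning about programs -/

/-- Sequential composition of programs. -/
infixr:60 " ;; " => Prog.seq

namespace Prog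

/-- The integer variables that a program may write. -/
def ivs : Prog → List ℕ
  | .iset x _ => [x]
  | .seq P Q => P.ivs ++ Q.ivs
  | .ite _ P Q => P.ivs ++ Q.ivs
  | .loop _ P => P.ivs
  | _ => []

/-- The integer arrays that a program may write. -/
def ias : Prog → List ℕ
  | .iput a _ _ => [a]
  | .seq P Q => P.ias ++ Q.ias
  | .ite _ P Q => P.ias ++ Q.ias
  | .loop _ P => P.ias
  | _ => []

/-- The real variables that a program may write. -/
def rvs : Prog → List ℕ
  | .rset x _ => [x]
  | .seq P Q => P.rvs ++ Q.rvs
  | .ite _ P Q => P.rvs ++ Q.rvs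
  | .loop _ P => P.rvs
  | _ => []

/-- The real arrays that a program may write. -/
def ras : Prog → List ℕ
  | .rput a _ _ => [a]
  | .flow _ _ _ _ _ _ _ F => [F]
  | .seq P Q => P.ras ++ Q.ras
  | .ite _ P Q => P.ras ++ Q.ras
  | .loop _ P => P.ras
  | _ => []

open Classical in
/-- Effect of a program without loops and calls. -/
noncomputable def run : Prog → State → State
  | .iset x p, σ => σ.setI x (p.eval σ)
  | .iput a i p, σ => σ.putI a (i.eval σ) (p.eval σ)
  | .rset x p, σ => σ.setR x (p.eval σ)
  | .rput a i p, σ => σ.putR a (i.eval σ) (p.eval σ)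
  | .seq P Q, σ => Q.run (P.run σ)
  | .ite b P Q, σ => if b.eval σ then P.run σ else Q.run σ
  | _, σ => σ

/-- The program has no loops and no calls. -/
def straight : Prog → Bool
  | .seq P Q => P.straight && Q.straight
  | .ite _ P Q => P.straight && Q.straight
  | .loop _ _ => false
  | .flow _ _ _ _ _ _ _ _ => false
  | _ => true

/-- Bound on the number of steps of a program without loops and calls. -/
def cost : Prog → ℕ
  | .seq P Q => P.cost + Q.cost
  | .ite _ P Q => max P.cost Q.cost + 1
  | _ => 1

/-- Run `P` with the variable `x` going from `a` up to the value of the variable `y`, exclusively. -/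
def forLoop (x a y : ℕ) (P : Prog) : Prog :=
  .iset x (.const a) ;;
    .loop (.ilt (.var x) (.var y)) (P ;; .iset x (.plus (.var x) (.const 1)))

end Prog

/-- The states agree on everything that `P` does not write. -/
structure Agrees (P : Prog) (σ σ' : State) : Prop where
  iv : ∀ x, x ∉ P.ivs → σ'.iv x = σ.iv x
  ia : ∀ a, a ∉ P.ias → σ'.ia a = σ.ia a
  rv : ∀ x, x ∉ P.rvs → σ'.rv x = σ.rv x
  ra : ∀ a, a ∉ P.ras → σ'.ra a = σ.ra a

theorem Agrees.refl (P : Prog) (σ : State) : Agrees P σ σ :=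
  ⟨fun _ _ => rfl, fun _ _ => rfl, fun _ _ => rfl, fun _ _ => rfl⟩

theorem Agrees.trans {P : Prog} {σ₁ σ₂ σ₃ : State} (h : Agrees P σ₁ σ₂) (h' : Agrees P σ₂ σ₃) :
    Agrees P σ₁ σ₃ :=
  ⟨fun x hx => (h'.iv x hx).trans (h.iv x hx), fun x hx => (h'.ia x hx).trans (h.ia x hx),
    fun x hx => (h'.rv x hx).trans (h.rv x hx), fun x hx => (h'.ra x hx).trans (h.ra x hx)⟩

theorem Agrees.of_subset {P Q : Prog} {σ σ' : State} (h : Agrees P σ σ') (h1 : P.ivs ⊆ Q.ivs)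
    (h2 : P.ias ⊆ Q.ias) (h3 : P.rvs ⊆ Q.rvs) (h4 : P.ras ⊆ Q.ras) : Agrees Q σ σ' :=
  ⟨fun x hx => h.iv x fun h => hx (h1 h), fun x hx => h.ia x fun h => hx (h2 h),
    fun x hx => h.rv x fun h => hx (h3 h), fun x hx => h.ra x fun h => hx (h4 h)⟩

theorem Agrees.left {P Q : Prog} {σ σ' : State} (h : Agrees P σ σ') : Agrees (P ;; Q) σ σ' :=
  h.of_subset (List.subset_append_left _ _) (List.subset_append_left _ _)
    (List.subset_append_left _ _) (List.subset_append_left _ _)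

theorem Agrees.right {P Q : Prog} {σ σ' : State} (h : Agrees Q σ σ') : Agrees (P ;; Q) σ σ' :=
  h.of_subset (List.subset_append_right _ _) (List.subset_append_right _ _)
    (List.subset_append_right _ _) (List.subset_append_right _ _)

theorem Agrees.loop {b : BExpr} {P : Prog} {σ σ' : State} (h : Agrees P σ σ') :
    Agrees (.loop b P) σ σ' :=
  ⟨h.iv, h.ia, h.rv, h.ra⟩

theorem Exec.agrees {O : Subroutine} {N M : ℕ} {P : Prog} {σ σ' : State} {k q : ℕ}
    (h : Exec O N M P σ σ' k q) : Agrees P σ σ' := by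
  induction h with
  | skip σ => exact Agrees.refl _ _
  | iset σ x p =>
    refine ⟨fun y hy => ?_, fun _ _ => rfl, fun _ _ => rfl, fun _ _ => rfl⟩
    simp only [Prog.ivs, List.mem_singleton] at hy
    simp [State.setI, hy]
  | iput σ a i p =>
    refine ⟨fun _ _ => rfl, fun y hy => ?_, fun _ _ => rfl, fun _ _ => rfl⟩
    simp only [Prog.ias, List.mem_singleton] at hy
    simp [State.putI, hy]
  | rset σ x p =>
    refine ⟨fun _ _ => rfl, fun _ _ => rfl, fun y hy => ?_, fun _ _ => rfl⟩
    simp only [Prog.rvs, List.mem_singleton] at hy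
    simp [State.setR, hy]
  | rput σ a i p =>
    refine ⟨fun _ _ => rfl, fun _ _ => rfl, fun _ _ => rfl, fun y hy => ?_⟩
    simp only [Prog.ras, List.mem_singleton] at hy
    simp [State.putR, hy]
  | seq P Q σ₁ σ₂ σ₃ k₁ k₂ q₁ q₂ _ _ h1 h2 => exact h1.left.trans h2.right
  | ite_true b P Q σ σ' k q _ _ h =>
    exact h.of_subset (List.subset_append_left _ _) (List.subset_append_left _ _)
      (List.subset_append_left _ _) (List.subset_append_left _ _)
  | ite_false b P Q σ σ' k q _ _ h =>
    exact h.of_subset (List.subset_append_right _ _) (List.subset_append_right _ _)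
      (List.subset_append_right _ _) (List.subset_append_right _ _)
  | loop_stop b P σ _ => exact Agrees.refl _ _
  | loop_step b P σ₁ σ₂ σ₃ k₁ k₂ q₁ q₂ _ _ _ h1 h2 => exact h1.loop.trans h2
  | flow σ nV nE s t T H W F n m Q =>
    refine ⟨fun _ _ => rfl, fun _ _ => rfl, fun _ _ => rfl, fun y hy => ?_⟩
    simp only [Prog.ras, List.mem_singleton] at hy
    simp [State.putFlow, hy]

theorem Exec.loop_of_not {O : Subroutine} {N M : ℕ} {b : BExpr} {P : Prog} {σ : State}
    (h : ¬ b.eval σ) : Exec O N M (.loop b P) σ σ 1 0 := by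
  constructor
  exact h

namespace HaltsWith

variable {O : Subroutine} {N M : ℕ}

theorem mono {P : Prog} {σ : State} {q q' K K' : ℕ} {post post' : State → Prop}
    (h : HaltsWith P O σ N M q K post) (hq : q ≤ q') (hK : K ≤ K')
    (hp : ∀ σ', Agrees P σ σ' → post σ' → post' σ') : HaltsWith P O σ N M q' K' post' := by
  obtain ⟨σ', k, c, h1, h2, h3, h4⟩ := h
  exact ⟨σ', k, c, h1, h2.trans hq, h3.trans hK, hp σ' h1.agrees h4⟩

theorem seq {P Q : Prog} {σ : State} {q₁ q₂ K₁ K₂ : ℕ} {mid post : State → Prop}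
    (h : HaltsWith P O σ N M q₁ K₁ mid)
    (h' : ∀ σ', Agrees P σ σ' → mid σ' → HaltsWith Q O σ' N M q₂ K₂ post) :
    HaltsWith (P ;; Q) O σ N M (q₁ + q₂) (K₁ + K₂) post := by
  obtain ⟨σ', k, c, h1, h2, h3, h4⟩ := h
  obtain ⟨σ'', k', c', h1', h2', h3', h4'⟩ := h' σ' h1.agrees h4
  exact ⟨σ'', _, _, .seq _ _ _ _ _ _ _ _ _ h1 h1', by omega, by omega, h4'⟩

theorem ite {b : BExpr} {P Q : Prog} {σ : State} {q K : ℕ} {post : State → Prop}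
    (h : b.eval σ → HaltsWith P O σ N M q K post)
    (h' : ¬ b.eval σ → HaltsWith Q O σ N M q K post) :
    HaltsWith (.ite b P Q) O σ N M q (K + 1) post := by
  by_cases hb : b.eval σ
  · obtain ⟨σ', k, c, h1, h2, h3, h4⟩ := h hb
    exact ⟨σ', _, _, .ite_true _ _ _ _ _ _ _ hb h1, h2, by omega, h4⟩
  · obtain ⟨σ', k, c, h1, h2, h3, h4⟩ := h' hb
    exact ⟨σ', _, _, .ite_false _ _ _ _ _ _ _ hb h1, h2, by omega, h4⟩

theorem straight {P : Prog} (hs : P.straight = true) {σ : State} {q K : ℕ} {post : State → Prop}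
    (hK : P.cost ≤ K) (h : post (P.run σ)) : HaltsWith P O σ N M q K post := by
  have key : ∀ (P : Prog) (σ : State), P.straight = true →
      ∃ k, Exec O N M P σ (P.run σ) k 0 ∧ k ≤ P.cost := by
    intro P
    induction P with
    | skip => exact fun σ _ => ⟨_, .skip σ, le_rfl⟩
    | iset x p => exact fun σ _ => ⟨_, .iset σ x p, le_rfl⟩
    | iput a i p => exact fun σ _ => ⟨_, .iput σ a i p, le_rfl⟩
    | rset x p => exact fun σ _ => ⟨_, .rset σ x p, le_rfl⟩
    | rput a i p => exact fun σ _ => ⟨_, .rput σ a i p, le_rfl⟩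
    | seq P Q ihP ihQ =>
      intro σ hs
      simp only [Prog.straight, Bool.and_eq_true] at hs
      obtain ⟨k, h1, h2⟩ := ihP σ hs.1
      obtain ⟨k', h1', h2'⟩ := ihQ (P.run σ) hs.2
      exact ⟨_, .seq _ _ _ _ _ _ _ _ _ h1 h1', by simp only [Prog.cost]; omega⟩
    | ite b P Q ihP ihQ =>
      intro σ hs
      simp only [Prog.straight, Bool.and_eq_true] at hs
      by_cases hb : b.eval σ
      · obtain ⟨k, h1, h2⟩ := ihP σ hs.1
        simp only [Prog.run, hb, if_true]
        exact ⟨_, .ite_true _ _ _ _ _ _ _ hb h1, by simp only [Prog.cost]; omega⟩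
      · obtain ⟨k, h1, h2⟩ := ihQ σ hs.2
        simp only [Prog.run, hb, if_false]
        exact ⟨_, .ite_false _ _ _ _ _ _ _ hb h1, by simp only [Prog.cost]; omega⟩
    | loop b P _ => intro σ hs; simp [Prog.straight] at hs
    | flow => intro σ hs; simp [Prog.straight] at hs
  obtain ⟨k, h1, h2⟩ := key P σ hs
  exact ⟨_, k, 0, h1, Nat.zero_le _, h2.trans hK, h⟩

/-- A loop without calls, with a measure `μ` that decreases in each round. -/
theorem loop {b : BExpr} {P : Prog} {K : ℕ} (I : State → Prop) (μ : State → ℕ)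
    {σ : State} (h0 : I σ)
    (h : ∀ σ', Agrees P σ σ' → I σ' → b.eval σ' →
      HaltsWith P O σ' N M 0 K fun σ'' => I σ'' ∧ μ σ'' < μ σ') :
    HaltsWith (.loop b P) O σ N M 0 (μ σ * (K + 1) + 1) fun σ' => I σ' ∧ ¬ b.eval σ' := by
  have key : ∀ (j : ℕ) (σ' : State), μ σ' ≤ j → Agrees P σ σ' → I σ' →
      HaltsWith (.loop b P) O σ' N M 0 (j * (K + 1) + 1) fun σ' => I σ' ∧ ¬ b.eval σ' := by
    intro j
    induction j with
    | zero =>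
      intro σ' hj ha hI
      by_cases hb : b.eval σ'
      · obtain ⟨σ'', k, c, h1, h2, h3, h4⟩ := h σ' ha hI hb
        omega
      · exact ⟨σ', _, _, .loop_of_not hb, le_rfl, by omega, hI, hb⟩
    | succ j ih =>
      intro σ' hj ha hI
      by_cases hb : b.eval σ'
      · obtain ⟨σ'', k, c, h1, h2, h3, h4, h5⟩ := h σ' ha hI hb
        obtain ⟨τ, k', c', h1', h2', h3', h4'⟩ := ih σ'' (by omega) (ha.trans h1.agrees) h4
        refine ⟨τ, _, _, .loop_step _ _ _ _ _ _ _ _ _ hb h1 h1', by omega, ?_, h4'⟩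
        rw [Nat.succ_mul]
        omega
      · refine ⟨σ', _, _, .loop_of_not hb, le_rfl, ?_, hI, hb⟩
        omega
  exact key _ σ le_rfl (Agrees.refl _ _) h0

theorem forLoop {x a y B : ℕ} {P : Prog} {σ : State} (I : ℕ → State → Prop) {q K : ℕ}
    (hx : x ∉ P.ivs) (hy : y ∉ (Prog.forLoop x a y P).ivs) (hB : σ.iv y = B) (hab : a ≤ B)
    (h0 : I a (σ.setI x a))
    (hstep : ∀ i σ', a ≤ i → i < B → Agrees (Prog.forLoop x a y P) σ σ' → σ'.iv x = i → I i σ' →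
      HaltsWith P O σ' N M q K fun σ'' => I (i + 1) (σ''.setI x (i + 1))) :
    HaltsWith (Prog.forLoop x a y P) O σ N M (B * q) (B * (K + 2) + 2) (I B) := by
  set W := Prog.forLoop x a y P with hW
  have hxW : Agrees W σ (σ.setI x a) := (Exec.iset (O := O) (N := N) (M := M) σ x (.const a)).agrees.left
  have key : ∀ (j i : ℕ) (σ' : State), a ≤ i → i + j = B → Agrees W σ σ' → σ'.iv x = i → I i σ' →
      HaltsWith (.loop (.ilt (.var x) (.var y)) (P ;; .iset x (.plus (.var x) (.const 1))))
        O σ' N M (j * q) (j * (K + 2) + 1) (I B) := by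
    intro j
    induction j with
    | zero =>
      intro i σ' _ hi ha hxi hI
      have hb : ¬ (BExpr.ilt (.var x) (.var y)).eval σ' := by
        simp only [BExpr.eval, IExpr.eval, hxi, ha.iv y hy, hB]
        omega
      obtain rfl : i = B := by omega
      exact ⟨σ', _, _, .loop_of_not hb, by omega, by omega, hI⟩
    | succ j ih =>
      intro i σ' hai hi ha hxi hI
      have hb : (BExpr.ilt (.var x) (.var y)).eval σ' := by
        simp only [BExpr.eval, IExpr.eval, hxi, ha.iv y hy, hB]
        omega
      obtain ⟨σ₂, k, c, h1, h2, h3, h4⟩ := hstep i σ' hai (by omega) ha hxi hI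
      have h5 : Exec O N M (P ;; .iset x (.plus (.var x) (.const 1))) σ'
          (σ₂.setI x (i + 1)) (k + 1) (c + 0) := by
        have := Exec.iset (O := O) (N := N) (M := M) σ₂ x (.plus (.var x) (.const 1))
        simp only [IExpr.eval, h1.agrees.iv x hx, hxi] at this
        exact .seq _ _ _ _ _ _ _ _ _ h1 this
      have h6 : Agrees W σ (σ₂.setI x (i + 1)) := ha.trans (Agrees.right h5.agrees.loop)
      obtain ⟨τ, k', c', h1', h2', h3', h4'⟩ :=
        ih (i + 1) _ (by omega) (by omega) h6 (by simp [State.setI]) h4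
      refine ⟨τ, _, _, .loop_step _ _ _ _ _ _ _ _ _ hb h5 h1', ?_, ?_, h4'⟩
      · rw [Nat.succ_mul]; omega
      · rw [Nat.succ_mul]; omega
  have h := key (B - a) a _ le_rfl (by omega) hxW (by simp [State.setI]) h0
  have h' : HaltsWith W O σ N M (0 + (B - a) * q) (1 + ((B - a) * (K + 2) + 1)) (I B) :=
    seq (mid := fun σ' => σ' = σ.setI x a) (straight rfl le_rfl rfl) (fun _ _ e => e ▸ h)
  refine h'.mono ?_ ?_ fun _ _ h => h
  · rw [zero_add]; exact Nat.mul_le_mul_right _ (Nat.sub_le _ _)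
  · have := Nat.mul_le_mul_right (K + 2) (Nat.sub_le B a)
    omega

theorem flow {n m : ℕ} (hO : IsMaxFlowSubroutine O) {σ : State} {nV nE s t : IExpr}
    {T H W F : ℕ} (Q : Network (Fin n) (Fin m)) (hn : nV.eval σ = n) (hm : nE.eval σ = m)
    (hN : n ≤ N) (hM : m ≤ M) (hs : s.eval σ = Q.source) (ht : t.eval σ = Q.sink)
    (hst : Q.source ≠ Q.sink) (hT : ∀ e : Fin m, σ.ia T e = Q.tail e)
    (hH : ∀ e : Fin m, σ.ia H e = Q.head e) (hW : ∀ e : Fin m, σ.ra W e = Q.cap e)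
    (h0 : ∀ e, 0 ≤ Q.cap e) :
    HaltsWith (.flow nV nE s t T H W F) O σ N M 1 1
      fun σ' => Q.IsMaxFlow fun e => σ'.ra F e := by
  refine ⟨_, _, _, .flow σ nV nE s t T H W F n m Q hn hm hN hM hs ht hst hT hH hW h0,
    le_rfl, le_rfl, ?_⟩
  have : (fun e : Fin m => (σ.putFlow F m (O n m Q)).ra F e) = O n m Q := by
    ext e
    simp [State.putFlow]
  change Q.IsMaxFlow fun e : Fin m => (σ.putFlow F m (O n m Q)).ra F e
  rw [this]
  exact hO n m Q hst h0

end HaltsWith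

/-- The memory holds the network `G` in the places prescribed for the input. -/
structure Holds {n m : ℕ} (G : Network (Fin n) (Fin m)) (σ : State) : Prop where
  vertices : σ.iv 0 = n
  edges : σ.iv 1 = m
  source : σ.iv 2 = G.source
  sink : σ.iv 3 = G.sink
  tail : ∀ e : Fin m, σ.ia 0 e = G.tail e
  head : ∀ e : Fin m, σ.ia 1 e = G.head e
  cap : ∀ e : Fin m, σ.ra 0 e = G.cap e

theorem holds_inputState {n m : ℕ} (G : Network (Fin n) (Fin m)) (k : ℕ) :
    Holds G (inputState G k) := by
  constructor <;> simp [inputState]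

/-- The program leaves the input alone. -/
def Prog.keepsInput (P : Prog) : Bool :=
  decide (0 ∉ P.ivs ∧ 1 ∉ P.ivs ∧ 2 ∉ P.ivs ∧ 3 ∉ P.ivs ∧ 0 ∉ P.ias ∧ 1 ∉ P.ias ∧ 0 ∉ P.ras)

theorem Holds.frame {n m : ℕ} {G : Network (Fin n) (Fin m)} {σ σ' : State} (h : Holds G σ)
    {P : Prog} (ha : Agrees P σ σ') (hP : P.keepsInput = true) : Holds G σ' := by
  simp only [Prog.keepsInput, decide_eq_true_eq] at hP
  obtain ⟨h0, h1, h2, h3, h4, h5, h6⟩ := hP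
  constructor
  · rw [ha.iv _ h0, h.vertices]
  · rw [ha.iv _ h1, h.edges]
  · rw [ha.iv _ h2, h.source]
  · rw [ha.iv _ h3, h.sink]
  · rw [ha.ia _ h4]; exact h.tail
  · rw [ha.ia _ h5]; exact h.head
  · rw [ha.ra _ h6]; exact h.cap

attribute [local simp] Prog.run IExpr.eval RExpr.eval BExpr.eval State.setI State.putI State.setR
  State.putR

theorem HaltsWith.forLoop_pure {O : Subroutine} {N M : ℕ} {x a y B : ℕ} {P : Prog} {σ : State}
    (I : ℕ → State → Prop) {K : ℕ}
    (hx : x ∉ P.ivs) (hy : y ∉ (Prog.forLoop x a y P).ivs) (hB : σ.iv y = B) (hab : a ≤ B)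
    (h0 : I a (σ.setI x a))
    (hstep : ∀ i σ', a ≤ i → i < B → Agrees (Prog.forLoop x a y P) σ σ' → σ'.iv x = i → I i σ' →
      HaltsWith P O σ' N M 0 K fun σ'' => I (i + 1) (σ''.setI x (i + 1))) :
    HaltsWith (Prog.forLoop x a y P) O σ N M 0 (B * (K + 2) + 2) (I B) :=
  (HaltsWith.forLoop I hx hy hB hab h0 hstep).mono (by simp) le_rfl fun _ _ h => h

/-! ### The program for the loose edges -/

namespace Prog

/-- A maximum flow of the input network is written to the real array 1. -/
def mainFlow : Prog := .flow (.var 0) (.var 1) (.var 2) (.var 3) 0 1 0 1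

/-- The slacks are written to the real array 2, and the marks in the integer array 2 are erased. -/
def slackLoop : Prog :=
  .forLoop 6 0 1
    (.ite (.rlt (.get 1 (.var 6)) (.minus (.get 0 (.var 6)) (.get 1 (.var 6))))
      (.rput 2 (.var 6) (.get 1 (.var 6)) ;; .iput 2 (.var 6) (.const 0))
      (.rput 2 (.var 6) (.minus (.get 0 (.var 6)) (.get 1 (.var 6))) ;; .iput 2 (.var 6) (.const 0)))

/-- Each vertex gets a label of its own, in the integer array 4. -/
def labelLoop : Prog := .forLoop 6 0 0 (.iput 4 (.var 6) (.var 6))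

/-- The variable 8 gets an edge of greatest slack between vertices of different labels, or `m` if
there is none. -/
def heaviest : Prog :=
  .iset 8 (.var 1) ;;
    .forLoop 6 0 1
      (.ite (.conj (.neg (.ieq (.get 4 (.get 0 (.var 6))) (.get 4 (.get 1 (.var 6)))))
          (.neg (.conj (.neg (.ieq (.var 8) (.var 1)))
            (.neg (.rlt (.get 2 (.var 8)) (.get 2 (.var 6)))))))
        (.iset 8 (.var 6)) .skip)

/-- The label in the variable 10 is replaced by the one in the variable 9. -/
def relabel : Prog :=
  .forLoop 11 0 0 (.ite (.ieq (.get 4 (.var 11)) (.var 10)) (.iput 4 (.var 11) (.var 9)) .skip)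

/-- One step of the greedy construction of a spanning forest. -/
def forestStep : Prog :=
  heaviest ;; .iput 5 (.var 7) (.var 8) ;;
    .ite (.ilt (.var 8) (.var 1))
      ((.iput 2 (.var 8) (.const 1) ;; .iset 9 (.get 4 (.get 0 (.var 8))) ;;
        .iset 10 (.get 4 (.get 1 (.var 8)))) ;; relabel) .skip

/-- The edges of a spanning forest of greatest total slack are marked in the integer array 2 and
listed in the integer array 5. -/
def candidates : Prog := mainFlow ;; slackLoop ;; labelLoop ;; .forLoop 7 0 0 forestStep

end Prog

section

variable {O : Subroutine} {N M n m : ℕ} {G : Network (Fin n) (Fin m)} {σ : State}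

theorem slackLoop_spec (hG : Holds G σ) :
    HaltsWith .slackLoop O σ N M 0 (m * 5 + 2) fun σ' =>
      ∀ e : Fin m, σ'.ra 2 e = G.slack (fun e => σ.ra 1 e) e ∧ σ'.ia 2 e = 0 := by
  refine (HaltsWith.forLoop_pure (K := 3) (fun i σ' => ∀ e : Fin m, (e : ℕ) < i →
    σ'.ra 2 e = G.slack (fun e => σ.ra 1 e) e ∧ σ'.ia 2 e = 0) (by decide) (by decide) hG.edges
    (Nat.zero_le _) (by simp) fun i σ' _ hi ag hx hI => ?_).mono le_rfl le_rfl
    fun σ' _ h e => h e e.2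
  have hG' := hG.frame ag (by decide)
  have h1 : σ'.ra 1 = σ.ra 1 := ag.ra 1 (by decide)
  have hc : σ'.ra 0 i = G.cap ⟨i, hi⟩ := hG'.cap ⟨i, hi⟩
  refine HaltsWith.ite (K := 2) (fun h => HaltsWith.straight (by decide) (by decide) ?_)
    fun h => HaltsWith.straight (by decide) (by decide) ?_ <;>
  · intro e he
    simp only [BExpr.eval, RExpr.eval, IExpr.eval, hx, hc, h1] at h
    rcases Nat.lt_succ_iff_lt_or_eq.1 he with he' | he'
    · simpa [hx, he'.ne] using hI e he'
    · obtain rfl : e = ⟨i, hi⟩ := Fin.ext he'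
      simp only [Prog.run, RExpr.eval, IExpr.eval, State.putR, State.putI, State.setI, hx, hc, h1]
      first
      | simp [Network.slack, min_eq_left h.le]
      | simp [Network.slack, min_eq_right (not_lt.1 h)]

theorem labelLoop_spec (hG : Holds G σ) :
    HaltsWith .labelLoop O σ N M 0 (n * 3 + 2) fun σ' => ∀ v < n, σ'.ia 4 v = v := by
  refine HaltsWith.forLoop_pure (K := 1) (fun i σ' => ∀ v < i, σ'.ia 4 v = v)
    (by decide) (by decide) hG.vertices (Nat.zero_le _) (by simp) fun i σ' _ hi ag hx hI =>
    HaltsWith.straight (by decide) (by decide) fun e he => ?_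
  rcases Nat.lt_succ_iff_lt_or_eq.1 he with he' | rfl
  · simp [hx, he'.ne, hI e he']
  · simp [hx]

/-- The edge `e` joins vertices with different labels. -/
def Crossing (G : Network (Fin n) (Fin m)) (lab : ℕ → ℕ) (e : Fin m) : Prop :=
  lab (G.tail e) ≠ lab (G.head e)

theorem forall_lt_succ {p : Fin m → Prop} {i : ℕ} (hi : i < m) (h : ∀ e : Fin m, (e : ℕ) < i → p e)
    (h' : p ⟨i, hi⟩) : ∀ e : Fin m, (e : ℕ) < i + 1 → p e := by
  intro e he
  rcases Nat.lt_succ_iff_lt_or_eq.1 he with he' | he'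
  · exact h e he'
  · rwa [show e = ⟨i, hi⟩ from Fin.ext he']

theorem heaviest_test (hG : Holds G σ) {σ₁ σ' : State} (ag₁ : Agrees (.iset 8 (.var 1)) σ σ₁)
    (ag : Agrees Prog.heaviest σ₁ σ') {i : ℕ} (hx : σ'.iv 6 = i) (hi : i < m) :
    (BExpr.conj (.neg (.ieq (.get 4 (.get 0 (.var 6))) (.get 4 (.get 1 (.var 6)))))
      (.neg (.conj (.neg (.ieq (.var 8) (.var 1)))
        (.neg (.rlt (.get 2 (.var 8)) (.get 2 (.var 6))))))).eval σ' ↔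
      Crossing G (σ.ia 4) ⟨i, hi⟩ ∧ (σ'.iv 8 = m ∨ σ.ra 2 (σ'.iv 8) < σ.ra 2 i) := by
  have hG' := (hG.frame ag₁ (by decide)).frame ag (by decide)
  have h4 : σ'.ia 4 = σ.ia 4 := (ag.ia 4 (by decide)).trans (ag₁.ia 4 (by decide))
  have h2 : σ'.ra 2 = σ.ra 2 := (ag.ra 2 (by decide)).trans (ag₁.ra 2 (by decide))
  have ht : σ'.ia 0 i = G.tail ⟨i, hi⟩ := hG'.tail ⟨i, hi⟩
  have hh : σ'.ia 1 i = G.head ⟨i, hi⟩ := hG'.head ⟨i, hi⟩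
  simp only [BExpr.eval, IExpr.eval, RExpr.eval, hx, ht, hh, h4, h2, hG'.edges, Crossing]
  tauto

theorem heaviest_spec (hG : Holds G σ) :
    HaltsWith .heaviest O σ N M 0 (m * 4 + 3) fun σ' =>
      (σ'.iv 8 = m ∧ ∀ e, ¬ Crossing G (σ.ia 4) e) ∨
        ∃ b : Fin m, σ'.iv 8 = b ∧ Crossing G (σ.ia 4) b ∧
          ∀ e, Crossing G (σ.ia 4) e → σ.ra 2 e ≤ σ.ra 2 b := by
  refine (HaltsWith.seq (q₁ := 0) (K₁ := 1) (mid := fun σ' => σ'.iv 8 = m)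
    (HaltsWith.straight (by decide) (by decide) (by simp [hG.edges])) fun σ₁ ag₁ h₁ =>
    HaltsWith.forLoop_pure (K := 2) (fun i σ' =>
      (σ'.iv 8 = m ∧ ∀ e : Fin m, (e : ℕ) < i → ¬ Crossing G (σ.ia 4) e) ∨
        ∃ b : Fin m, σ'.iv 8 = b ∧ Crossing G (σ.ia 4) b ∧
          ∀ e : Fin m, (e : ℕ) < i → Crossing G (σ.ia 4) e → σ.ra 2 e ≤ σ.ra 2 b)
    (by decide) (by decide) (hG.frame ag₁ (by decide)).edges (Nat.zero_le _) (by simp [h₁])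
    fun i σ' _ hi ag hx hI => HaltsWith.ite (K := 1)
      (fun h => HaltsWith.straight (by decide) (by decide) ?_)
      fun h => HaltsWith.straight (by decide) (by decide) ?_).mono le_rfl (by omega)
    fun σ' _ h => ?_
  · rw [heaviest_test hG ag₁ ag.right hx hi] at h
    refine Or.inr ⟨⟨i, hi⟩, by simp [hx], h.1, forall_lt_succ hi ?_ fun _ => le_rfl⟩
    rcases hI with ⟨hI1, hI2⟩ | ⟨b, hb, hI1, hI2⟩
    · exact fun e he hc => absurd hc (hI2 e he)
    · rw [hb] at h
      exact fun e he hc => (hI2 e he hc).trans (h.2.resolve_left b.2.ne).le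
  · rw [heaviest_test hG ag₁ ag.right hx hi] at h
    rcases hI with ⟨hI1, hI2⟩ | ⟨b, hb, hI1, hI2⟩
    · exact Or.inl ⟨by simp [hI1], forall_lt_succ hi hI2 fun hc => h ⟨hc, Or.inl hI1⟩⟩
    · refine Or.inr ⟨b, by simp [hb], hI1, forall_lt_succ hi hI2 fun hc => ?_⟩
      rw [hb] at h
      exact not_lt.1 fun hlt => h ⟨hc, Or.inr hlt⟩
  · rcases h with ⟨h1, h2⟩ | ⟨b, h1, h2, h3⟩
    · exact Or.inl ⟨h1, fun e => h2 e e.2⟩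
    · exact Or.inr ⟨b, h1, h2, fun e => h3 e e.2⟩

theorem relabel_spec (hG : Holds G σ) :
    HaltsWith .relabel O σ N M 0 (n * 4 + 2) fun σ' =>
      ∀ v < n, σ'.ia 4 v = if σ.ia 4 v = σ.iv 10 then σ.iv 9 else σ.ia 4 v := by
  refine (HaltsWith.forLoop_pure (K := 2) (fun i σ' => (∀ v < i,
    σ'.ia 4 v = if σ.ia 4 v = σ.iv 10 then σ.iv 9 else σ.ia 4 v) ∧ ∀ v, i ≤ v →
    σ'.ia 4 v = σ.ia 4 v)
    (by decide) (by decide) hG.vertices (Nat.zero_le _) (by simp) fun i σ' _ hi ag hx hI =>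
    HaltsWith.ite (K := 1) (fun h => HaltsWith.straight (by decide) (by decide) ?_)
      fun h => HaltsWith.straight (by decide) (by decide) ?_).mono le_rfl le_rfl fun _ _ h => h.1
  all_goals
    have h9 : σ'.iv 9 = σ.iv 9 := ag.iv 9 (by decide)
    have h10 : σ'.iv 10 = σ.iv 10 := ag.iv 10 (by decide)
    have hi' := hI.2 i le_rfl
    simp only [BExpr.eval, IExpr.eval, hx, hi', h10] at h
    refine ⟨fun v hv => ?_, fun v hv => ?_⟩
  · rcases Nat.lt_succ_iff_lt_or_eq.1 hv with hv' | rfl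
    · simp [hx, hv'.ne, hI.1 v hv']
    · simp [hx, h, h9]
  · have : v ≠ i := by omega
    simp [hx, this, hI.2 v (by omega)]
  · rcases Nat.lt_succ_iff_lt_or_eq.1 hv with hv' | rfl
    · exact hI.1 v hv'
    · simp [h, hi']
  · exact hI.2 v (by omega)

/-- Invariant of the construction of the forest after `i` steps. -/
structure ForestState (G : Network (Fin n) (Fin m)) (r : Fin m → ℝ) (i : ℕ) (σ : State) : Prop where
  forest : G.ForestInv r (fun v => σ.ia 4 v) fun e => σ.ia 2 e = 1
  card : {e : Fin m | σ.ia 2 e = 1}.ncard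
    + (Finset.univ.image fun v : Fin n => σ.ia 4 v).card ≤ n
  progress : (Finset.univ.image fun v : Fin n => σ.ia 4 v).card + i ≤ n ∨
    ∀ e, ¬ Crossing G (σ.ia 4) e
  listed : ∀ e : Fin m, σ.ia 2 e = 1 ↔ ∃ j < i, σ.ia 5 j = e

theorem forestStep_spec (hG : Holds G σ) {r : Fin m → ℝ} (hr : ∀ e : Fin m, σ.ra 2 e = r e)
    (h : ForestState G r (σ.iv 7) σ) :
    HaltsWith .forestStep O σ N M 0 (m * 4 + n * 4 + 10) (ForestState G r (σ.iv 7 + 1)) := by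
  set i := σ.iv 7 with hi
  refine (HaltsWith.seq (heaviest_spec hG) fun σ₁ ag₁ h₁ =>
    HaltsWith.seq (q₁ := 0) (K₁ := 1) (mid := fun σ' => σ'.ia 5 i = σ₁.iv 8 ∧
      ∀ j, j ≠ i → σ'.ia 5 j = σ.ia 5 j)
      (HaltsWith.straight (by decide) (by decide) ?_) fun σ₂ ag₂ h₂ =>
      HaltsWith.ite (q := 0) (K := n * 4 + 5) (fun hb => ?_) fun hb => ?_).mono
    (by omega) (by omega) fun _ _ h => h
  · have h7 : σ₁.iv 7 = i := ag₁.iv 7 (by decide)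
    have h5 : σ₁.ia 5 = σ.ia 5 := ag₁.ia 5 (by decide)
    constructor
    · simp [h7]
    · intro j hj
      simp [h7, hj, h5]
  · -- an edge has been found
    have hG₂ := (hG.frame ag₁ (by decide)).frame ag₂ (by decide)
    have h8 : σ₂.iv 8 = σ₁.iv 8 := ag₂.iv 8 (by decide)
    have h4 : σ₂.ia 4 = σ.ia 4 := (ag₂.ia 4 (by decide)).trans (ag₁.ia 4 (by decide))
    have hm2 : σ₂.ia 2 = σ.ia 2 := (ag₂.ia 2 (by decide)).trans (ag₁.ia 2 (by decide))
    simp only [BExpr.eval, IExpr.eval, h8, hG₂.edges] at hb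
    rcases h₁ with ⟨h1, _⟩ | ⟨b, h1, hc, hmax⟩
    · omega
    have ht : σ₂.ia 0 b = G.tail b := hG₂.tail b
    have hh : σ₂.ia 1 b = G.head b := hG₂.head b
    refine (HaltsWith.seq (q₁ := 0) (K₁ := 3) (q₂ := 0) (K₂ := n * 4 + 2) (mid := fun σ' =>
      (∀ e : Fin m, σ'.ia 2 e = if e = b then 1 else σ.ia 2 e) ∧
      σ'.iv 9 = σ.ia 4 (G.tail b) ∧ σ'.iv 10 = σ.ia 4 (G.head b))
      (HaltsWith.straight (by decide) (by decide) ?_) fun σ₃ ag₃ h₃ =>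
      (relabel_spec (hG₂.frame ag₃ (by decide))).mono le_rfl le_rfl fun σ₄ ag₄ h₄ => ?_).mono
      (by omega) (by omega) fun _ _ h => h
    · refine ⟨fun e => ?_, ?_, ?_⟩
      · by_cases he : e = b
        · simp [he, h8, h1]
        · have : (e : ℕ) ≠ b := fun h => he (Fin.ext h)
          simp [he, h8, h1, this, hm2]
      · simp [h8, h1, ht, h4]
      · simp [h8, h1, hh, h4]
    have hG₃ := hG₂.frame ag₃ (by decide)
    have e4 : σ₃.ia 4 = σ.ia 4 := (ag₃.ia 4 (by decide)).trans h4
    have e5 : σ₄.ia 5 = σ₂.ia 5 := (ag₄.ia 5 (by decide)).trans (ag₃.ia 5 (by decide))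
    have e2 : ∀ e : Fin m, σ₄.ia 2 e = if e = b then 1 else σ.ia 2 e := by
      rw [ag₄.ia 2 (by decide)]
      exact h₃.1
    have el : (fun v : Fin n => σ₄.ia 4 v) = fun v : Fin n =>
        if σ.ia 4 v = σ.ia 4 (G.head b) then σ.ia 4 (G.tail b) else σ.ia 4 v := by
      funext v
      rw [h₄ v v.2, h₃.2.1, h₃.2.2, e4]
    have em : ∀ e : Fin m, σ₄.ia 2 e = 1 ↔ σ.ia 2 e = 1 ∨ e = b := by
      intro e
      rw [e2]
      split_ifs with he <;> simp [he]
    have hcard := Network.card_labels_merge (fun v : Fin n => σ.ia 4 v) hc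
    refine ⟨?_, ?_, ?_, fun e => ?_⟩
    · rw [el]
      simp only [em]
      exact h.forest.step hc fun e he => by rw [← hr, ← hr]; exact hmax e he
    · rw [el]
      have hset : {e : Fin m | σ₄.ia 2 e = 1} = insert b {e : Fin m | σ.ia 2 e = 1} := by
        ext e
        simp [em, or_comm]
      have := Set.ncard_insert_le b {e : Fin m | σ.ia 2 e = 1}
      have := h.card
      rw [hset]
      omega
    · rw [el]
      rcases h.progress with h0 | h0
      · left; omega
      · exact absurd hc (h0 b)
    · rw [em, h.listed e, e5]
      constructor
      · rintro (⟨j, hj, h5⟩ | rfl)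
        · exact ⟨j, by omega, by rw [h₂.2 j hj.ne, h5]⟩
        · exact ⟨i, by omega, by rw [h₂.1, h1]⟩
      · rintro ⟨j, hj, h5⟩
        by_cases hji : j = i
        · rw [hji, h₂.1, h1] at h5
          exact Or.inr (Fin.ext h5.symm)
        · exact Or.inl ⟨j, by omega, by rw [← h₂.2 j hji, h5]⟩
  · -- no edge joins different labels
    rcases h₁ with ⟨h1, hno⟩ | ⟨b, h1, hc, hmax⟩
    · refine HaltsWith.straight (by decide) (show 1 ≤ _ by omega) ?_
      have h4 : σ₂.ia 4 = σ.ia 4 := (ag₂.ia 4 (by decide)).trans (ag₁.ia 4 (by decide))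
      have hm2 : σ₂.ia 2 = σ.ia 2 := (ag₂.ia 2 (by decide)).trans (ag₁.ia 2 (by decide))
      simp only [Prog.run]
      refine ⟨by rw [h4, hm2]; exact h.forest, by rw [h4, hm2]; exact h.card,
        Or.inr (by rw [h4]; exact hno), fun e => ?_⟩
      rw [hm2, h.listed e]
      constructor
      · rintro ⟨j, hj, h5⟩
        exact ⟨j, by omega, by rw [h₂.2 j hj.ne, h5]⟩
      · rintro ⟨j, hj, h5⟩
        by_cases hji : j = i
        · rw [hji, h₂.1, h1] at h5
          exact absurd h5.symm e.2.ne
        · exact ⟨j, by omega, by rw [← h₂.2 j hji, h5]⟩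
    · exfalso
      apply hb
      have h8 : σ₂.iv 8 = σ₁.iv 8 := ag₂.iv 8 (by decide)
      have hG₂ := (hG.frame ag₁ (by decide)).frame ag₂ (by decide)
      simp [h8, h1, hG₂.edges]

/-- What is known after `Prog.candidates`: a maximum flow, and marks on few edges such that each
unmarked edge is emptied or saturated by some maximum flow. -/
structure Candidates (G : Network (Fin n) (Fin m)) (σ : State) : Prop where
  flow : G.IsMaxFlow fun e => σ.ra 1 e
  unmarked : ∀ e : Fin m, σ.ia 2 e ≠ 1 →
    (σ.ra 1 e ≤ G.cap e - σ.ra 1 e → ∃ f, G.IsMaxFlow f ∧ f e = 0) ∧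
      (G.cap e - σ.ra 1 e ≤ σ.ra 1 e → ∃ f, G.IsMaxFlow f ∧ f e = G.cap e)
  card : {e : Fin m | σ.ia 2 e = 1}.ncard ≤ n - 1
  listed : ∀ e : Fin m, σ.ia 2 e = 1 ↔ ∃ j < n, σ.ia 5 j = e

theorem mainFlow_spec (hO : IsMaxFlowSubroutine O) (hN : n ≤ N) (hM : m ≤ M)
    (hst : G.source ≠ G.sink) (h0 : ∀ e, 0 ≤ G.cap e) (hG : Holds G σ) :
    HaltsWith .mainFlow O σ N M 1 1 fun σ' => G.IsMaxFlow fun e : Fin m => σ'.ra 1 e :=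
  HaltsWith.flow hO G hG.vertices hG.edges hN hM hG.source hG.sink hst hG.tail hG.head hG.cap h0

theorem candidates_spec (hO : IsMaxFlowSubroutine O) (hN : n ≤ N) (hM : m ≤ M)
    (hst : G.source ≠ G.sink) (h0 : ∀ e, 0 ≤ G.cap e) (hG : Holds G σ) :
    HaltsWith .candidates O σ N M 1 (30 * (n * (n + m))) (Candidates G) := by
  have hn : 0 < n := G.source.pos
  refine (HaltsWith.seq (K₂ := (m * 5 + 2) + ((n * 3 + 2) + (n * ((m * 4 + n * 4 + 10) + 2) + 2)))
    (q₂ := 0 + (0 + 0))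
    (mainFlow_spec hO hN hM hst h0 hG) fun σ₁ ag₁ h₁ =>
    have hG₁ := hG.frame ag₁ (by decide)
    HaltsWith.seq (slackLoop_spec hG₁) fun σ₂ ag₂ h₂ =>
    have hG₂ := hG₁.frame ag₂ (by decide)
    HaltsWith.seq (labelLoop_spec hG₂) fun σ₃ ag₃ h₃ =>
    have hG₃ := hG₂.frame ag₃ (by decide)
    (HaltsWith.forLoop_pure (ForestState G (G.slack fun e => σ₁.ra 1 e)) (by decide) (by decide)
      hG₃.vertices (Nat.zero_le _) ?_ fun i σ' _ hi ag hx hI =>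
      (forestStep_spec (hG₃.frame ag (by decide)) ?_ (by rw [hx]; exact hI)).mono le_rfl le_rfl
        fun σ'' _ h => ?_).mono le_rfl le_rfl fun σ₄ ag₄ h => ?_).mono (by omega) ?_ fun _ _ h => h
  · -- initially each vertex is a component
    have e2 : ∀ e : Fin m, σ₃.ia 2 e = 0 := by
      rw [ag₃.ia 2 (by decide)]
      exact fun e => (h₂ e).2
    have el : (fun v : Fin n => σ₃.ia 4 v) = fun v : Fin n => (v : ℕ) := by
      funext v
      exact h₃ v v.2
    change ForestState G _ 0 (σ₃.setI 7 0)
    have hc : (Finset.univ.image fun v : Fin n => σ₃.ia 4 v).card ≤ n :=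
      Finset.card_image_le.trans (by simp)
    refine ⟨?_, ?_, Or.inl hc, fun e => ?_⟩
    · change G.ForestInv _ (fun v : Fin n => σ₃.ia 4 v) fun e : Fin m => σ₃.ia 2 e = 1
      rw [el]
      simp only [e2, zero_ne_one]
      exact Network.ForestInv.init G _ Fin.val_injective
    · change {e : Fin m | σ₃.ia 2 e = 1}.ncard + (Finset.univ.image fun v : Fin n => σ₃.ia 4 v).card
        ≤ n
      simpa [e2] using hc
    · change σ₃.ia 2 e = 1 ↔ _
      simp [e2]
  · intro e
    rw [ag.ra 2 (by decide), ag₃.ra 2 (by decide)]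
    exact (h₂ e).1
  · rw [hx] at h
    exact ⟨h.forest, h.card, h.progress, h.listed⟩
  · have e1 : σ₄.ra 1 = σ₁.ra 1 := (ag₄.ra 1 (by decide)).trans
      ((ag₃.ra 1 (by decide)).trans (ag₂.ra 1 (by decide)))
    have hpos : 0 < (Finset.univ.image fun v : Fin n => σ₄.ia 4 v).card :=
      Finset.card_pos.2 ⟨_, Finset.mem_image_of_mem _ (Finset.mem_univ G.source)⟩
    refine ⟨by rw [e1]; exact h₁, fun e he => ?_, ?_, h.listed⟩
    · rw [e1]
      refine h.forest.unmarked h₁ ?_ he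
      rcases h.progress with h1 | h1
      · omega
      · exact not_not.1 (h1 e)
    · have := h.card
      omega
  · nlinarith [Nat.zero_le m]

end

/-! ### The value of a flow -/

namespace Prog

/-- The sum of the entries of the real array `F` over the edges `e` such that the entry of the
integer array `A` at `e` is the source is written to the real variable `r`. -/
def sumLoop (A F r : ℕ) : Prog :=
  .rset r .zero ;; .forLoop 6 0 1 (.ite (.ieq (.get A (.var 6)) (.var 2))
    (.rset r (.plus (.var r) (.get F (.var 6)))) .skip)

/-- The value of the flow in the real array `F` is written to the real variable `r`. -/
def flowValue (F r : ℕ) : Prog :=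
  sumLoop 0 F r ;; sumLoop 1 F 9 ;; .rset r (.minus (.var r) (.var 9))

end Prog

section

variable {O : Subroutine} {N M n m : ℕ} {G : Network (Fin n) (Fin m)} {σ : State}

theorem sumLoop_spec (hG : Holds G σ) (A F r : ℕ) {g : Fin m → Fin n}
    (hg : ∀ e : Fin m, σ.ia A e = g e) :
    HaltsWith (.sumLoop A F r) O σ N M 0 (m * 4 + 3) fun σ' =>
      σ'.rv r = ∑ e : Fin m, if g e = G.source then σ.ra F e else 0 := by
  refine (HaltsWith.seq (q₁ := 0) (K₁ := 1) (q₂ := 0) (K₂ := m * (2 + 2) + 2)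
    (mid := fun σ' => σ' = σ.setR r 0)
    (HaltsWith.straight rfl le_rfl rfl) fun σ₁ ag₁ h₁ =>
    (HaltsWith.forLoop_pure (K := 2) (fun i σ' =>
      σ'.rv r = ∑ j ∈ Finset.range i, if σ.ia A j = σ.iv 2 then σ.ra F j else 0)
      (by simp [Prog.ivs]) (by simp [Prog.ivs, Prog.forLoop]) (by rw [h₁]; exact hG.edges)
      (Nat.zero_le _) (by simp [h₁])
      fun i σ' _ hi ag hx hI => HaltsWith.ite (K := 1)
        (fun h => HaltsWith.straight rfl le_rfl ?_)
        fun h => HaltsWith.straight rfl le_rfl ?_).mono le_rfl le_rfl fun σ' _ h => ?_).mono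
    le_rfl (by omega) fun _ _ h => h
  rotate_left 2
  · rw [h, Finset.sum_range]
    refine Finset.sum_congr rfl fun e _ => ?_
    rw [hg, hG.source]
    simp only [Fin.val_inj]
  all_goals
    have e0 : σ'.ia A i = σ.ia A i := by
      rw [ag.ia A (by simp [Prog.ias, Prog.forLoop]), h₁]; rfl
    have e1 : σ'.iv 2 = σ.iv 2 := by rw [ag.iv 2 (by simp [Prog.ivs, Prog.forLoop]), h₁]; rfl
    have e2 : σ'.ra F i = σ.ra F i := by rw [ag.ra F (by simp [Prog.ras, Prog.forLoop]), h₁]; rfl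
    simp only [BExpr.eval, IExpr.eval, hx, e0, e1] at h
    rw [Finset.sum_range_succ]
    simp [h, hI, hx, e2]

theorem flowValue_spec (hG : Holds G σ) {F r : ℕ} (hr : r ≠ 9) :
    HaltsWith (.flowValue F r) O σ N M 0 (m * 8 + 7) fun σ' =>
      σ'.rv r = G.value fun e => σ.ra F e := by
  refine (HaltsWith.seq (q₂ := 0) (K₂ := (m * 4 + 3) + 1) (sumLoop_spec hG 0 F r hG.tail)
    fun σ₁ ag₁ h₁ => ?_).mono le_rfl (by omega) fun _ _ h => h
  have hG₁ : Holds G σ₁ := by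
    constructor
    · rw [ag₁.iv 0 (by simp [Prog.ivs, Prog.forLoop, Prog.sumLoop]), hG.vertices]
    · rw [ag₁.iv 1 (by simp [Prog.ivs, Prog.forLoop, Prog.sumLoop]), hG.edges]
    · rw [ag₁.iv 2 (by simp [Prog.ivs, Prog.forLoop, Prog.sumLoop]), hG.source]
    · rw [ag₁.iv 3 (by simp [Prog.ivs, Prog.forLoop, Prog.sumLoop]), hG.sink]
    · rw [ag₁.ia 0 (by simp [Prog.ias, Prog.forLoop, Prog.sumLoop])]; exact hG.tail
    · rw [ag₁.ia 1 (by simp [Prog.ias, Prog.forLoop, Prog.sumLoop])]; exact hG.head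
    · rw [ag₁.ra 0 (by simp [Prog.ras, Prog.forLoop, Prog.sumLoop])]; exact hG.cap
  refine HaltsWith.seq (q₁ := 0) (q₂ := 0) (sumLoop_spec hG₁ 1 F 9 hG₁.head) fun σ₂ ag₂ h₂ =>
    HaltsWith.straight rfl le_rfl ?_
  have e1 : σ₁.ra F = σ.ra F := ag₁.ra F (by simp [Prog.ras, Prog.forLoop, Prog.sumLoop])
  have e2 : σ₂.rv r = σ₁.rv r := ag₂.rv r (by simp [Prog.rvs, Prog.forLoop, Prog.sumLoop, hr])
  rw [e1] at h₂
  simp [h₁, h₂, e2, Network.value, Network.outflow, Network.inflow]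

end

/-! ### Graph search in linear time -/

/-- The greatest number `a + 1` with `a < i` and `A a = v`, or `0` if there is none. -/
def prev (A : ℕ → ℕ) (v : ℕ) : ℕ → ℕ
  | 0 => 0
  | i + 1 => if A i = v then i + 1 else prev A v i

theorem prev_spec (A : ℕ → ℕ) (v i : ℕ) :
    (prev A v i = 0 ∨ ∃ c < i, prev A v i = c + 1 ∧ A c = v) ∧
      ∀ a < i, A a = v → a < prev A v i := by
  induction i with
  | zero => simp [prev]
  | succ i ih =>
    rw [prev]
    split_ifs with h
    · exact ⟨Or.inr ⟨i, by omega, rfl, h⟩, fun a ha _ => ha⟩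
    · refine ⟨ih.1.imp id ?_, fun a ha hav => ?_⟩
      · rintro ⟨c, hc, h1⟩
        exact ⟨c, by omega, h1⟩
      · have : a ≠ i := fun hai => h (hai ▸ hav)
        exact ih.2 a (by omega) hav

theorem prev_le (A : ℕ → ℕ) (v i : ℕ) : prev A v i ≤ i := by
  rcases (prev_spec A v i).1 with h | ⟨c, hc, h, _⟩ <;> omega

/-- Invariant of the search, from the vertices in `start`, of the graph with the vertices
`0, …, n - 1` and those arcs among `0, …, k - 1` that satisfy `R`. The tails and heads of the arcs
are `A` and `B`; `vis` is `1` at the visited vertices. The arcs that leave `v` and are still to be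
inspected are those below `cur v`. The vertices with arcs to be inspected are among
`stk 0, …, stk (sp - 1)`. -/
structure SearchInv (n k : ℕ) (A B : ℕ → ℕ) (R start : ℕ → Prop) (vis cur stk : ℕ → ℕ) (sp : ℕ) :
    Prop where
  stack : ∀ i < sp, stk i < n ∧ vis (stk i) = 1
  pending : ∀ v < n, vis v = 1 → cur v = 0 ∨ ∃ i < sp, stk i = v
  done : ∀ a < k, vis (A a) = 1 → R a → cur (A a) ≤ a → vis (B a) = 1
  pointer : ∀ v < n, cur v = 0 ∨ ∃ c < k, cur v = c + 1 ∧ A c = v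
  starts : ∀ v < n, start v → vis v = 1
  reached : ∀ C : ℕ → Prop, (∀ v, start v → C v) → (∀ a < k, C (A a) → R a → C (B a)) →
    ∀ v < n, vis v = 1 → C v
  fresh : ∀ a < k, vis (A a) ≠ 1 → a < cur (A a)

/-- Bound on the number of steps that the search still has to make. -/
def searchMeasure (n k : ℕ) (A vis cur : ℕ → ℕ) (sp : ℕ) : ℕ :=
  2 * ((Finset.range n).filter fun v => vis v ≠ 1).card + sp +
    ((Finset.range k).filter fun a => a < cur (A a)).card

namespace SearchInv

variable {n k : ℕ} {A B : ℕ → ℕ} {R start : ℕ → Prop} {vis cur stk : ℕ → ℕ} {sp : ℕ}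

theorem init {s u : ℕ} (hs : s < n) (hu : u < n) (hst : ∀ v, start v ↔ v = s ∨ v = u)
    (hvis : ∀ v < n, vis v = 1 ↔ v = s ∨ v = u) (hA : ∀ a < k, A a < n)
    (hcur : ∀ v < n, cur v = prev A v k) (h0 : stk 0 = s) (h1 : stk 1 = u) :
    SearchInv n k A B R start vis cur stk 2 where
  stack i hi := by
    obtain rfl | rfl : i = 0 ∨ i = 1 := by omega
    · rw [h0]; exact ⟨hs, (hvis s hs).2 (Or.inl rfl)⟩
    · rw [h1]; exact ⟨hu, (hvis u hu).2 (Or.inr rfl)⟩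
  pending v hv h := by
    rcases (hvis v hv).1 h with rfl | rfl
    · exact Or.inr ⟨0, by omega, h0⟩
    · exact Or.inr ⟨1, by omega, h1⟩
  done a ha _ _ h := by
    rw [hcur _ (hA a ha)] at h
    exact absurd ((prev_spec A (A a) k).2 a ha rfl) (not_lt.2 h)
  pointer v hv := by
    rw [hcur v hv]
    exact (prev_spec A v k).1
  starts v hv h := (hvis v hv).2 ((hst v).1 h)
  reached C h _ v hv hvis' := h v ((hst v).2 ((hvis v hv).1 hvis'))
  fresh a ha _ := by
    rw [hcur _ (hA a ha)]
    exact (prev_spec A (A a) k).2 a ha rfl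

theorem pop (h : SearchInv n k A B R start vis cur stk sp) (hsp : 0 < sp)
    (h0 : cur (stk (sp - 1)) = 0) : SearchInv n k A B R start vis cur stk (sp - 1) :=
  { h with
    stack := fun i hi => h.stack i (by omega)
    pending := fun v hv hvis => by
      rcases h.pending v hv hvis with h1 | ⟨i, hi, h1⟩
      · exact Or.inl h1
      · by_cases hi' : i = sp - 1
        · left; rw [← h1, hi', h0]
        · exact Or.inr ⟨i, by omega, h1⟩ }

theorem measure_pop (hsp : 0 < sp) :
    searchMeasure n k A vis cur (sp - 1) < searchMeasure n k A vis cur sp := by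
  unfold searchMeasure
  omega

/-- Visit the head of an arc out of a visited vertex. -/
theorem push (h : SearchInv n k A B R start vis cur stk sp) {a : ℕ} (ha : a < k)
    (hA : A a < n) (hvis : vis (A a) = 1) (hR : R a) (hB : B a < n) :
    SearchInv n k A B R start (Function.update vis (B a) 1) cur (Function.update stk sp (B a))
      (sp + 1) := by
  have hmono : ∀ v, vis v = 1 → Function.update vis (B a) 1 v = 1 := by
    intro v hv
    by_cases hvB : v = B a
    · simp [hvB]
    · simpa [hvB] using hv
  refine ⟨fun i hi => ?_, fun v hv h1 => ?_, fun b hb h1 h2 h3 => ?_, h.pointer,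
    fun v hv hs => hmono _ (h.starts v hv hs), fun C h1 h2 v hv h3 => ?_, fun b hb h1 => ?_⟩
  · by_cases hi' : i = sp
    · simp [hi', hB]
    · have := h.stack i (by omega)
      simp only [Function.update_of_ne hi']
      exact ⟨this.1, hmono _ this.2⟩
  · by_cases hvB : v = B a
    · exact Or.inr ⟨sp, by omega, by simp [hvB]⟩
    · rw [Function.update_of_ne hvB] at h1
      refine (h.pending v hv h1).imp id ?_
      rintro ⟨i, hi, h2⟩
      exact ⟨i, by omega, by rwa [Function.update_of_ne (by omega)]⟩
  · by_cases hA : vis (A b) = 1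
    · exact hmono _ (h.done b hb hA h2 h3)
    · exact absurd h3 (not_le.2 (h.fresh b hb hA))
  · by_cases hvB : v = B a
    · rw [hvB]
      exact h2 a ha (h.reached C h1 h2 _ hA hvis) hR
    · rw [Function.update_of_ne hvB] at h3
      exact h.reached C h1 h2 v hv h3
  · exact h.fresh b hb fun hA => h1 (hmono _ hA)

theorem measure_push {a : ℕ} (hB : B a < n) (hvis : vis (B a) ≠ 1) :
    searchMeasure n k A (Function.update vis (B a) 1) cur (sp + 1)
      < searchMeasure n k A vis cur sp := by
  have : ((Finset.range n).filter fun v => Function.update vis (B a) 1 v ≠ 1).card <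
      ((Finset.range n).filter fun v => vis v ≠ 1).card := by
    refine Finset.card_lt_card (Finset.ssubset_iff_of_subset ?_ |>.2 ⟨B a, ?_, ?_⟩)
    · intro v hv
      simp only [Finset.mem_filter, Finset.mem_range] at hv ⊢
      by_cases hvB : v = B a
      · simp [hvB] at hv
      · simpa [hvB] using hv
    · simpa [hB] using hvis
    · simp
  unfold searchMeasure
  omega

/-- Move on to the next arc out of `v`. -/
theorem advance (h : SearchInv n k A B R start vis cur stk sp) {v c : ℕ} (hv : v < n)
    (hst : ∃ i < sp, stk i = v) (hvis : vis v = 1) (hc : cur v = c + 1)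
    (hR : R c → vis (B c) = 1) :
    SearchInv n k A B R start vis (Function.update cur v (prev A v c)) stk sp := by
  obtain ⟨c', hc', h1, hA⟩ := (h.pointer v hv).resolve_left (by omega)
  obtain rfl : c' = c := by omega
  refine { h with
    pending := fun w hw hw1 => ?_
    done := fun a ha h1 h2 h3 => ?_
    pointer := fun w hw => ?_
    fresh := fun a ha h1 => ?_ }
  · by_cases hwv : w = v
    · exact Or.inr (hwv ▸ hst)
    · rw [Function.update_of_ne hwv]
      exact h.pending w hw hw1
  · by_cases hav : A a = v
    · rw [hav, Function.update_self] at h3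
      rcases lt_trichotomy a c' with h4 | rfl | h4
      · exact absurd ((prev_spec A v c').2 a h4 hav) (not_lt.2 h3)
      · exact hR h2
      · exact h.done a ha h1 h2 (by rw [hav]; omega)
    · rw [Function.update_of_ne hav] at h3
      exact h.done a ha h1 h2 h3
  · by_cases hwv : w = v
    · rw [hwv, Function.update_self]
      refine (prev_spec A v c').1.imp id ?_
      rintro ⟨d, hd, h2⟩
      exact ⟨d, by omega, h2⟩
    · rw [Function.update_of_ne hwv]
      exact h.pointer w hw
  · have hav : A a ≠ v := fun hav => h1 (hav ▸ hvis)
    rw [Function.update_of_ne hav]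
    exact h.fresh a ha h1

theorem measure_advance (h : SearchInv n k A B R start vis cur stk sp) {v c : ℕ} (hv : v < n)
    (hc : cur v = c + 1) :
    searchMeasure n k A vis (Function.update cur v (prev A v c)) sp
      < searchMeasure n k A vis cur sp := by
  obtain ⟨c', hc', h1, hA⟩ := (h.pointer v hv).resolve_left (by omega)
  obtain rfl : c' = c := by omega
  have hle := prev_le A v c'
  have : ((Finset.range k).filter fun a => a < Function.update cur v (prev A v c') (A a)).card <
      ((Finset.range k).filter fun a => a < cur (A a)).card := by
    refine Finset.card_lt_card (Finset.ssubset_iff_of_subset ?_ |>.2 ⟨c', ?_, ?_⟩)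
    · intro a ha
      simp only [Finset.mem_filter, Finset.mem_range] at ha ⊢
      by_cases hav : A a = v
      · rw [hav, Function.update_self] at ha
        exact ⟨ha.1, by rw [hav]; omega⟩
      · simpa [hav] using ha
    · simp only [Finset.mem_filter, Finset.mem_range]
      exact ⟨hc', by rw [hA]; omega⟩
    · simp only [Finset.mem_filter, Finset.mem_range, hA, Function.update_self]
      omega
  unfold searchMeasure
  omega

theorem closed (h : SearchInv n k A B R start vis cur stk 0) {a : ℕ} (ha : a < k) (hA : A a < n)
    (hvis : vis (A a) = 1) (hR : R a) : vis (B a) = 1 := by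
  refine h.done a ha hvis hR ?_
  rcases h.pending _ hA hvis with h1 | ⟨i, hi, _⟩ <;> omega

end SearchInv

namespace Prog

/-- The arcs of the residual graph: the edges, in the integer arrays 6 and 7, followed by the
reversed edges. Their number is written to the variable 12. -/
def arcLoop : Prog :=
  .iset 12 (.plus (.var 1) (.var 1)) ;;
    .forLoop 6 0 1
      (.iput 6 (.var 6) (.get 0 (.var 6)) ;; .iput 6 (.plus (.var 1) (.var 6)) (.get 1 (.var 6)) ;;
        .iput 7 (.var 6) (.get 1 (.var 6)) ;; .iput 7 (.plus (.var 1) (.var 6)) (.get 0 (.var 6)))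

/-- Linked lists of the arcs that leave a vertex: the integer array 8 holds the heads of the lists
and the array 9 the links. -/
def chainLoop : Prog :=
  .forLoop 6 0 0 (.iput 8 (.var 6) (.const 0)) ;;
    .forLoop 6 0 12
      (.iput 9 (.var 6) (.get 8 (.get 6 (.var 6))) ;;
        .iput 8 (.get 6 (.var 6)) (.plus (.var 6) (.const 1)))

/-- The residual capacities of the arcs, for the flow in the real array 3, are written to the real
array 5. -/
def residualLoop : Prog :=
  .forLoop 6 0 1
    (.rput 5 (.var 6) (.minus (.get 0 (.var 6)) (.get 3 (.var 6))) ;;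
      .rput 5 (.plus (.var 1) (.var 6)) (.get 3 (.var 6)))

/-- Begin a search of the residual graph at the source and at the vertex in the variable 14. -/
def searchInit : Prog :=
  .forLoop 6 0 0 (.iput 10 (.var 6) (.const 0) ;; .iput 11 (.var 6) (.get 8 (.var 6))) ;;
    (.iput 10 (.var 2) (.const 1) ;; .iput 10 (.var 14) (.const 1) ;;
      .iput 12 (.const 0) (.var 2) ;; .iput 12 (.const 1) (.var 14) ;; .iset 13 (.const 2))

/-- Inspect the arc in the variable 18. -/
def searchArc : Prog :=
  .ite (.conj (.rlt .zero (.get 5 (.var 18))) (.neg (.ieq (.get 10 (.get 7 (.var 18))) (.const 1))))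
    (.iput 10 (.get 7 (.var 18)) (.const 1) ;; .iput 12 (.var 13) (.get 7 (.var 18)) ;;
      .iset 13 (.plus (.var 13) (.const 1))) .skip

/-- One step of the search: the topmost vertex of the stack is dropped or one more of its arcs is
inspected. -/
def searchStep : Prog :=
  (.iset 16 (.get 12 (.minus (.var 13) (.const 1))) ;; .iset 17 (.get 11 (.var 16)) ;;
    .iset 18 (.minus (.var 17) (.const 1))) ;;
    .ite (.ieq (.var 17) (.const 0)) (.iset 13 (.minus (.var 13) (.const 1)))
      (searchArc ;; .iput 11 (.var 16) (.get 9 (.var 18)))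

/-- The search itself. -/
def searchLoop : Prog := .loop (.ilt (.const 0) (.var 13)) searchStep

end Prog

section

variable {O : Subroutine} {N M n m : ℕ} {G : Network (Fin n) (Fin m)} {σ : State}

/-- The arcs and their linked lists are in memory. -/
structure HoldsArcs (G : Network (Fin n) (Fin m)) (σ : State) : Prop where
  count : σ.iv 12 = m + m
  tail : ∀ e : Fin m, σ.ia 6 e = G.tail e ∧ σ.ia 6 (m + e) = G.head e
  head : ∀ e : Fin m, σ.ia 7 e = G.head e ∧ σ.ia 7 (m + e) = G.tail e
  first : ∀ v < n, σ.ia 8 v = prev (σ.ia 6) v (m + m)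
  next : ∀ a < m + m, σ.ia 9 a = prev (σ.ia 6) (σ.ia 6 a) a

theorem arc_cases {p : ℕ → Prop} (h1 : ∀ e : Fin m, p e) (h2 : ∀ e : Fin m, p (m + e)) :
    ∀ a < m + m, p a := by
  intro a ha
  by_cases ham : a < m
  · exact h1 ⟨a, ham⟩
  · have := h2 ⟨a - m, by omega⟩
    simpa [Nat.add_sub_cancel' (not_lt.1 ham)] using this

theorem HoldsArcs.tail_lt (h : HoldsArcs G σ) : ∀ a < m + m, σ.ia 6 a < n :=
  arc_cases (fun e => by rw [(h.tail e).1]; exact (G.tail e).2)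
    fun e => by rw [(h.tail e).2]; exact (G.head e).2

theorem HoldsArcs.head_lt (h : HoldsArcs G σ) : ∀ a < m + m, σ.ia 7 a < n :=
  arc_cases (fun e => by rw [(h.head e).1]; exact (G.head e).2)
    fun e => by rw [(h.head e).2]; exact (G.tail e).2

theorem HoldsArcs.frame (h : HoldsArcs G σ) {P : Prog} {σ' : State} (ha : Agrees P σ σ')
    (h12 : 12 ∉ P.ivs) (h6 : 6 ∉ P.ias) (h7 : 7 ∉ P.ias) (h8 : 8 ∉ P.ias) (h9 : 9 ∉ P.ias) :
    HoldsArcs G σ' := by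
  constructor
  · rw [ha.iv _ h12, h.count]
  · rw [ha.ia _ h6]; exact h.tail
  · rw [ha.ia _ h7]; exact h.head
  · rw [ha.ia _ h8, ha.ia _ h6]; exact h.first
  · rw [ha.ia _ h9, ha.ia _ h6]; exact h.next

theorem arcLoop_spec (hG : Holds G σ) :
    HaltsWith .arcLoop O σ N M 0 (m * 6 + 3) fun σ' =>
      σ'.iv 12 = m + m ∧ (∀ e : Fin m, σ'.ia 6 e = G.tail e ∧ σ'.ia 6 (m + e) = G.head e) ∧
        ∀ e : Fin m, σ'.ia 7 e = G.head e ∧ σ'.ia 7 (m + e) = G.tail e := by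
  refine (HaltsWith.seq (q₁ := 0) (K₁ := 1) (q₂ := 0) (K₂ := m * (4 + 2) + 2)
    (mid := fun σ' => σ'.iv 12 = m + m)
    (HaltsWith.straight (by decide) (by decide) (by simp [hG.edges])) fun σ₁ ag₁ h₁ =>
    (HaltsWith.forLoop_pure (K := 4) (fun i σ' => ∀ e : Fin m, (e : ℕ) < i →
      (σ'.ia 6 e = G.tail e ∧ σ'.ia 6 (m + e) = G.head e) ∧
        (σ'.ia 7 e = G.head e ∧ σ'.ia 7 (m + e) = G.tail e))
    (by decide) (by decide) (hG.frame ag₁ (by decide)).edges (Nat.zero_le _) (by simp)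
    fun i σ' _ hi ag hx hI => HaltsWith.straight (by decide) (by decide) ?_).mono le_rfl le_rfl
    fun σ' ag h => ⟨(ag.iv 12 (by decide)).trans h₁, fun e => (h e e.2).1,
      fun e => (h e e.2).2⟩).mono le_rfl (by omega) fun _ _ h => h
  have hG' := (hG.frame ag₁ (by decide)).frame ag (by decide)
  have ht : σ'.ia 0 i = G.tail ⟨i, hi⟩ := hG'.tail ⟨i, hi⟩
  have hh : σ'.ia 1 i = G.head ⟨i, hi⟩ := hG'.head ⟨i, hi⟩
  refine forall_lt_succ hi (fun e he => ?_) ?_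
  · have h1 : (e : ℕ) ≠ m + i := by omega
    have h2 : m + (e : ℕ) ≠ i := by omega
    simpa [hx, hG'.edges, he.ne, h1, h2] using hI e he
  · simp [hx, hG'.edges, ht, hh]
    omega

theorem chainLoop_spec (hG : Holds G σ) (h12 : σ.iv 12 = m + m)
    (hA : ∀ a < m + m, σ.ia 6 a < n) :
    HaltsWith .chainLoop O σ N M 0 (n * 3 + m * 8 + 4) fun σ' =>
      (∀ v < n, σ'.ia 8 v = prev (σ.ia 6) v (m + m)) ∧
        ∀ a < m + m, σ'.ia 9 a = prev (σ.ia 6) (σ.ia 6 a) a := by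
  refine (HaltsWith.seq (q₂ := 0) (K₂ := (m + m) * (2 + 2) + 2)
    (HaltsWith.forLoop_pure (K := 1) (fun i σ' => ∀ v < i, σ'.ia 8 v = 0)
    (by decide) (by decide) hG.vertices (Nat.zero_le _) (by simp)
    fun i σ' _ hi ag hx hI => HaltsWith.straight (by decide) (by decide) ?_)
    fun σ₁ ag₁ h₁ => HaltsWith.forLoop_pure (K := 2)
      (fun i σ' => (∀ v < n, σ'.ia 8 v = prev (σ.ia 6) v i) ∧
        ∀ a < i, σ'.ia 9 a = prev (σ.ia 6) (σ.ia 6 a) a) (by decide) (by decide)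
      ((ag₁.iv 12 (by decide)).trans h12) (Nat.zero_le _) ?_ fun i σ' _ hi ag hx hI =>
      HaltsWith.straight (by decide) (by decide) ?_).mono le_rfl (by omega) fun _ _ h => h
  · intro v hv
    rcases Nat.lt_succ_iff_lt_or_eq.1 hv with hv' | rfl
    · simp [hx, hv'.ne, hI v hv']
    · simp [hx]
  · exact ⟨h₁, fun a ha => absurd ha (Nat.not_lt_zero a)⟩
  · have e6 : σ'.ia 6 = σ.ia 6 := (ag.ia 6 (by decide)).trans (ag₁.ia 6 (by decide))
    refine ⟨fun v hv => ?_, fun a ha => ?_⟩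
    · by_cases hvi : σ.ia 6 i = v
      · simp [hx, e6, hvi, prev]
      · simp [hx, e6, hvi, prev, Ne.symm hvi, hI.1 v hv]
    · rcases Nat.lt_succ_iff_lt_or_eq.1 ha with ha' | rfl
      · simp [hx, ha'.ne, hI.2 a ha']
      · simp [hx, e6, hI.1 _ (hA a hi)]

theorem residualLoop_spec (hG : Holds G σ) :
    HaltsWith .residualLoop O σ N M 0 (m * 4 + 2) fun σ' => ∀ e : Fin m,
      σ'.ra 5 e = G.cap e - σ.ra 3 e ∧ σ'.ra 5 (m + e) = σ.ra 3 e := by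
  refine (HaltsWith.forLoop_pure (K := 2) (fun i σ' => ∀ e : Fin m, (e : ℕ) < i →
      (σ'.ra 5 e = G.cap e - σ.ra 3 e ∧ σ'.ra 5 (m + e) = σ.ra 3 e))
    (by decide) (by decide) hG.edges (Nat.zero_le _) (by simp)
    fun i σ' _ hi ag hx hI => HaltsWith.straight (by decide) (by decide) ?_).mono le_rfl le_rfl
    fun σ' ag h e => h e e.2
  have hG' := hG.frame ag (by decide)
  have hc : σ'.ra 0 i = G.cap ⟨i, hi⟩ := hG'.cap ⟨i, hi⟩
  have e3 : σ'.ra 3 = σ.ra 3 := ag.ra 3 (by decide)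
  refine forall_lt_succ hi (fun e he => ?_) ?_
  · have h1 : (e : ℕ) ≠ m + i := by omega
    have h2 : m + (e : ℕ) ≠ i := by omega
    simpa [hx, hG'.edges, he.ne, h1, h2] using hI e he
  · simp [hx, hG'.edges, hc, e3]
    omega

end

section

variable {O : Subroutine} {N M n m : ℕ} {G : Network (Fin n) (Fin m)} {σ : State}

theorem searchInit_spec (hG : Holds G σ) (ha : HoldsArcs G σ) {u : Fin n} (hu : σ.iv 14 = u)
    (R : ℕ → Prop) :
    HaltsWith .searchInit O σ N M 0 (n * 4 + 7) fun σ' =>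
      SearchInv n (m + m) (σ.ia 6) (σ.ia 7) R (fun v => v = G.source ∨ v = u)
        (σ'.ia 10) (σ'.ia 11) (σ'.ia 12) (σ'.iv 13) ∧ σ'.iv 13 = 2 := by
  refine (HaltsWith.seq (q₂ := 0) (K₂ := 5)
    (HaltsWith.forLoop_pure (K := 2) (fun i σ' => ∀ v < i, σ'.ia 10 v = 0 ∧ σ'.ia 11 v = σ.ia 8 v)
    (by decide) (by decide) hG.vertices (Nat.zero_le _) (by simp)
    fun i σ' _ hi ag hx hI => HaltsWith.straight (by decide) (by decide) ?_)
    fun σ₁ ag₁ h₁ => HaltsWith.straight (by decide) (by decide) ?_).mono le_rfl (by omega)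
    fun _ _ h => h
  · intro v hv
    have e8 : σ'.ia 8 = σ.ia 8 := ag.ia 8 (by decide)
    rcases Nat.lt_succ_iff_lt_or_eq.1 hv with hv' | rfl
    · simp [hx, hv'.ne, hI v hv']
    · simp [hx, e8]
  · have e2 : σ₁.iv 2 = G.source := (hG.frame ag₁ (by decide)).source
    have e14 : σ₁.iv 14 = u := (ag₁.iv 14 (by decide)).trans hu
    refine ⟨?_, by simp⟩
    have e13 : (Prog.run (.iput 10 (.var 2) (.const 1) ;; .iput 10 (.var 14) (.const 1) ;;
      .iput 12 (.const 0) (.var 2) ;; .iput 12 (.const 1) (.var 14) ;; .iset 13 (.const 2))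
        σ₁).iv 13 = 2 := by simp
    rw [e13]
    refine SearchInv.init G.source.2 u.2 (fun v => Iff.rfl) (fun v hv => ?_) ha.tail_lt
      (fun v hv => ?_) (by simp [e2]) (by simp [e14])
    · by_cases h1 : v = u
      · simp [e14, h1]
      · by_cases h2 : v = G.source
        · simp [e2, e14, h2]
        · simp [e2, e14, h1, h2, (h₁ v hv).1]
    · simp [(h₁ v hv).2, ha.first v hv]

theorem searchArc_spec (ha : HoldsArcs G σ) {R start : ℕ → Prop}
    (hR : ∀ a < m + m, R a ↔ 0 < σ.ra 5 a) {c v : ℕ} (hv : v < n) (hc : c < m + m)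
    (h18 : σ.iv 18 = c) (hA : σ.ia 6 c = v) (hvis : σ.ia 10 v = 1)
    (hst : ∃ i < σ.iv 13, σ.ia 12 i = v)
    (h : SearchInv n (m + m) (σ.ia 6) (σ.ia 7) R start (σ.ia 10) (σ.ia 11) (σ.ia 12) (σ.iv 13)) :
    HaltsWith .searchArc O σ N M 0 4 fun σ' =>
      SearchInv n (m + m) (σ.ia 6) (σ.ia 7) R start (σ'.ia 10) (σ'.ia 11) (σ'.ia 12) (σ'.iv 13) ∧
      searchMeasure n (m + m) (σ.ia 6) (σ'.ia 10) (σ'.ia 11) (σ'.iv 13)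
        ≤ searchMeasure n (m + m) (σ.ia 6) (σ.ia 10) (σ.ia 11) (σ.iv 13) ∧
      σ'.ia 10 v = 1 ∧ (∃ i < σ'.iv 13, σ'.ia 12 i = v) ∧ (R c → σ'.ia 10 (σ.ia 7 c) = 1) := by
  have hB := ha.head_lt c hc
  refine HaltsWith.ite (K := 3) (fun hb => HaltsWith.straight (by decide) (by decide) ?_)
    fun hb => HaltsWith.straight (by decide) (by decide) ?_
  · simp only [BExpr.eval, RExpr.eval, IExpr.eval, h18, ← hR c hc] at hb
    have e10 : (Prog.run (.iput 10 (.get 7 (.var 18)) (.const 1) ;;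
        .iput 12 (.var 13) (.get 7 (.var 18)) ;; .iset 13 (.plus (.var 13) (.const 1))) σ).ia 10
        = Function.update (σ.ia 10) (σ.ia 7 c) 1 := by
      funext w
      simp [h18, Function.update_apply]
    have e12 : (Prog.run (.iput 10 (.get 7 (.var 18)) (.const 1) ;;
        .iput 12 (.var 13) (.get 7 (.var 18)) ;; .iset 13 (.plus (.var 13) (.const 1))) σ).ia 12
        = Function.update (σ.ia 12) (σ.iv 13) (σ.ia 7 c) := by
      funext w
      simp [h18, Function.update_apply]
    have e11 : (Prog.run (.iput 10 (.get 7 (.var 18)) (.const 1) ;;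
        .iput 12 (.var 13) (.get 7 (.var 18)) ;; .iset 13 (.plus (.var 13) (.const 1))) σ).ia 11
        = σ.ia 11 := by
      funext w
      simp
    have e13 : (Prog.run (.iput 10 (.get 7 (.var 18)) (.const 1) ;;
        .iput 12 (.var 13) (.get 7 (.var 18)) ;; .iset 13 (.plus (.var 13) (.const 1))) σ).iv 13
        = σ.iv 13 + 1 := by simp
    rw [e10, e11, e12, e13]
    refine ⟨h.push hc (by rw [hA]; exact hv) (by rw [hA]; exact hvis) hb.1 hB,
      (SearchInv.measure_push hB hb.2).le, ?_, ?_, fun _ => by simp⟩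
    · by_cases hvB : v = σ.ia 7 c
      · simp [hvB]
      · simpa [hvB] using hvis
    · obtain ⟨i, hi, h1⟩ := hst
      exact ⟨i, by omega, by rwa [Function.update_of_ne (by omega)]⟩
  · simp only [BExpr.eval, RExpr.eval, IExpr.eval, h18, ← hR c hc, not_and, not_not] at hb
    exact ⟨h, le_rfl, hvis, hst, hb⟩

theorem searchLoop_spec (ha : HoldsArcs G σ) {R start : ℕ → Prop}
    (hR : ∀ a < m + m, R a ↔ 0 < σ.ra 5 a) (h2 : σ.iv 13 = 2)
    (h : SearchInv n (m + m) (σ.ia 6) (σ.ia 7) R start (σ.ia 10) (σ.ia 11) (σ.ia 12) (σ.iv 13)) :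
    HaltsWith .searchLoop O σ N M 0 ((2 * n + 2 + (m + m)) * 10 + 1) fun σ' =>
      SearchInv n (m + m) (σ.ia 6) (σ.ia 7) R start (σ'.ia 10) (σ'.ia 11) (σ'.ia 12) 0 := by
  have hμ : searchMeasure n (m + m) (σ.ia 6) (σ.ia 10) (σ.ia 11) (σ.iv 13)
      ≤ 2 * n + 2 + (m + m) := by
    have h1 := Finset.card_filter_le (Finset.range n) fun v => σ.ia 10 v ≠ 1
    have h3 := Finset.card_filter_le (Finset.range (m + m)) fun a => a < σ.ia 11 (σ.ia 6 a)
    rw [Finset.card_range] at h1 h3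
    unfold searchMeasure
    omega
  refine (HaltsWith.loop (K := 9) (fun σ' => SearchInv n (m + m) (σ.ia 6) (σ.ia 7) R start
      (σ'.ia 10) (σ'.ia 11) (σ'.ia 12) (σ'.iv 13))
    (fun σ' => searchMeasure n (m + m) (σ.ia 6) (σ'.ia 10) (σ'.ia 11) (σ'.iv 13)) h
    fun σ' ag hI hb => ?_).mono le_rfl ?_ fun σ' ag hI => ?_
  · have ha' := ha.frame ag (by decide) (by decide) (by decide) (by decide) (by decide)
    have e6 : σ'.ia 6 = σ.ia 6 := ag.ia 6 (by decide)
    have e7 : σ'.ia 7 = σ.ia 7 := ag.ia 7 (by decide)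
    have e5 : σ'.ra 5 = σ.ra 5 := ag.ra 5 (by decide)
    simp only [BExpr.eval, IExpr.eval] at hb
    set v := σ'.ia 12 (σ'.iv 13 - 1) with hv
    obtain ⟨hvn, hvis⟩ := hI.stack (σ'.iv 13 - 1) (by omega)
    rw [← hv] at hvn hvis
    refine HaltsWith.seq (q₁ := 0) (K₁ := 3) (q₂ := 0) (K₂ := 6) (mid := fun τ => τ.iv 16 = v ∧
      τ.iv 17 = σ'.ia 11 v ∧ τ.iv 18 = σ'.ia 11 v - 1 ∧ τ.ia = σ'.ia ∧ τ.iv 13 = σ'.iv 13)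
      (HaltsWith.straight (by decide) (by decide) (by simp [hv])) fun τ agτ hτ => ?_
    obtain ⟨t16, t17, t18, tia, t13⟩ := hτ
    have haτ := ha'.frame agτ (by decide) (by decide) (by decide) (by decide) (by decide)
    refine HaltsWith.ite (K := 5) (fun hb' => HaltsWith.straight (by decide) (by decide) ?_)
      fun hb' => ?_
    · simp only [BExpr.eval, IExpr.eval, t17] at hb'
      have := hI.pop hb hb'
      have := SearchInv.measure_pop (n := n) (k := m + m) (A := σ.ia 6) (vis := σ'.ia 10)
        (cur := σ'.ia 11) hb
      simpa [tia, t13] using And.intro ‹SearchInv _ _ _ _ _ _ _ _ _ _› this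
    · simp only [BExpr.eval, IExpr.eval, t17] at hb'
      obtain ⟨c, hc, hcv, hA⟩ := (hI.pointer v hvn).resolve_left hb'
      rw [hcv, Nat.add_sub_cancel] at t18
      refine HaltsWith.seq (q₁ := 0) (q₂ := 0) (K₁ := 4) (K₂ := 1)
        (searchArc_spec (G := G) haτ (R := R) (start := start) (c := c) (v := v) ?_ hvn hc t18 ?_ ?_ ?_ ?_)
        fun σ₂ ag₂ h₂ => HaltsWith.straight (by decide) (by decide) ?_
      · rw [agτ.ra 5 (by decide), e5]; exact hR
      · rw [tia, e6]; exact hA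
      · rw [tia]; exact hvis
      · rw [tia, t13]; exact ⟨_, by omega, hv.symm⟩
      · rw [tia, t13, e6, e7]; exact hI
      · rw [tia, t13, e6, e7] at h₂
        obtain ⟨g1, g2, g3, g4, g5⟩ := h₂
        have s16 : σ₂.iv 16 = v := (ag₂.iv 16 (by decide)).trans t16
        have s18 : σ₂.iv 18 = c := (ag₂.iv 18 (by decide)).trans t18
        have s9 : σ₂.ia 9 c = prev (σ.ia 6) v c := by
          rw [ag₂.ia 9 (by decide), haτ.next c hc, tia, e6, hA]
        have s11 : σ₂.ia 11 = σ'.ia 11 := by rw [ag₂.ia 11 (by decide), tia]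
        have hcv' : σ₂.ia 11 v = c + 1 := by rw [s11, hcv]
        have k1 := g1.advance hvn g4 g3 hcv' g5
        have k2 := g1.measure_advance hvn hcv'
        have e11 : (Prog.run (.iput 11 (.var 16) (.get 9 (.var 18))) σ₂).ia 11
            = Function.update (σ₂.ia 11) v (prev (σ.ia 6) v c) := by
          funext w
          simp [s16, s18, s9, Function.update_apply]
        have e10 : (Prog.run (.iput 11 (.var 16) (.get 9 (.var 18))) σ₂).ia 10 = σ₂.ia 10 := by
          funext w
          simp
        have e12 : (Prog.run (.iput 11 (.var 16) (.get 9 (.var 18))) σ₂).ia 12 = σ₂.ia 12 := by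
          funext w
          simp
        rw [e11, e10, e12]
        exact ⟨k1, k2.trans_le g2⟩
  · gcongr
  · have : σ'.iv 13 = 0 := by
      have := hI.2
      simpa using this
    rw [this] at hI
    exact hI.1

end

/-! ### The program for cheapest separating cuts -/

namespace Prog

/-- The vertices that can be reached from the source and the vertex in the variable 14, in the
residual graph of the flow in the real array 3, are marked in the integer array 10. -/
def search : Prog := residualLoop ;; searchInit ;; searchLoop

/-- The array `A` is copied to `D`, with the vertex in the variable 14 merged into the source and
the one in the variable 15 merged into the sink. -/
def mergeLoop (A D : ℕ) : Prog :=
  .forLoop 6 0 1 (.ite (.ieq (.get A (.var 6)) (.var 14)) (.iput D (.var 6) (.var 2))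
    (.ite (.ieq (.get A (.var 6)) (.var 15)) (.iput D (.var 6) (.var 3))
      (.iput D (.var 6) (.get A (.var 6)))))

/-- Maximum flow of the contracted network. -/
def contractFlow : Prog := .flow (.var 0) (.var 1) (.var 2) (.var 3) 13 14 0 3

/-- The capacity of the cut in the integer array 10 is written to the real variable 2. -/
def cutLoop : Prog :=
  .rset 2 .zero ;; .forLoop 6 0 1
    (.ite (.conj (.ieq (.get 10 (.get 0 (.var 6))) (.const 1))
        (.neg (.ieq (.get 10 (.get 1 (.var 6))) (.const 1))))
      (.rset 2 (.plus (.var 2) (.get 0 (.var 6)))) .skip)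

/-- If the cut just found is the first one or cheaper than the best one so far, it becomes the best
one: it is copied to the integer array 15, and its capacity to the real variable 3. The variable 20
tells whether there is a best cut already. -/
def keepBest : Prog :=
  .ite (.conj (.ieq (.var 20) (.const 1)) (.neg (.rlt (.var 2) (.var 3)))) .skip
    ((.rset 3 (.var 2) ;; .iset 20 (.const 1)) ;;
      .forLoop 6 0 0 (.ite (.ieq (.get 10 (.var 6)) (.const 1)) (.iput 15 (.var 6) (.const 1))
        (.iput 15 (.var 6) (.const 0))))

/-- Take into account the cuts with the vertex in the variable 14 inside and the vertex in the
variable 15 outside. -/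
def directedCut : Prog :=
  .ite (.conj (.neg (.ieq (.var 14) (.var 3))) (.neg (.ieq (.var 15) (.var 2))))
    (mergeLoop 0 13 ;; mergeLoop 1 14 ;; contractFlow ;; search ;; cutLoop ;; keepBest) .skip

/-- A cheapest cut that separates the vertices in the variables 21 and 22. -/
def separatingCut : Prog :=
  (.iset 20 (.const 0) ;; .iset 14 (.var 21) ;; .iset 15 (.var 22)) ;; directedCut ;;
    (.iset 14 (.var 22) ;; .iset 15 (.var 21)) ;; directedCut

end Prog

section

variable {O : Subroutine} {N M n m : ℕ} {G : Network (Fin n) (Fin m)} {σ : State}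

/-- The set of vertices that the integer array 10 describes. -/
def visited (n : ℕ) (σ : State) : Finset (Fin n) := Finset.univ.filter fun v => σ.ia 10 v = 1

theorem mem_visited {v : Fin n} : v ∈ visited n σ ↔ σ.ia 10 v = 1 := by simp [visited]

theorem search_spec (hG : Holds G σ) (ha : HoldsArcs G σ) {u : Fin n} (hu : σ.iv 14 = u) :
    HaltsWith .search O σ N M 0 (24 * (n + m) + 30) fun σ' =>
      G.source ∈ visited n σ' ∧ u ∈ visited n σ' ∧
        G.ResClosed (fun e => σ.ra 3 e) (visited n σ') ∧
        ∀ C : Finset (Fin n), G.source ∈ C → u ∈ C → G.ResClosed (fun e => σ.ra 3 e) C →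
          visited n σ' ⊆ C := by
  refine (HaltsWith.seq (q₂ := 0) (K₂ := (n * 4 + 7) + ((2 * n + 2 + (m + m)) * 10 + 1))
    (residualLoop_spec hG) fun σ₁ ag₁ h₁ =>
    HaltsWith.seq (q₂ := 0) (searchInit_spec (hG.frame ag₁ (by decide))
      (ha.frame ag₁ (by decide) (by decide) (by decide) (by decide) (by decide))
      ((ag₁.iv 14 (by decide)).trans hu) fun a => 0 < σ₁.ra 5 a) fun σ₂ ag₂ h₂ =>
    (searchLoop_spec ((ha.frame ag₁ (by decide) (by decide) (by decide) (by decide)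
      (by decide)).frame ag₂ (by decide) (by decide) (by decide) (by decide) (by decide))
      (R := fun a => 0 < σ₁.ra 5 a) (start := fun v => v = G.source ∨ v = u) ?_ h₂.2 ?_).mono le_rfl
      le_rfl fun σ₃ ag₃ h₃ => ?_).mono le_rfl (by omega) fun _ _ h => h
  · rw [ag₂.ra 5 (by decide)]
    exact fun _ _ => Iff.rfl
  · rw [ag₂.ia 6 (by decide), ag₂.ia 7 (by decide)]
    exact h₂.1
  · rw [ag₂.ia 6 (by decide), ag₂.ia 7 (by decide), ag₁.ia 6 (by decide),
      ag₁.ia 7 (by decide)] at h₃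
    have key : ∀ e : Fin m, (G.tail e ∈ visited n σ₃ → σ.ra 3 e < G.cap e →
        G.head e ∈ visited n σ₃) ∧
        (G.head e ∈ visited n σ₃ → 0 < σ.ra 3 e → G.tail e ∈ visited n σ₃) := by
      intro e
      have c1 := h₃.closed (a := e) (by omega) (by rw [(ha.tail e).1]; exact (G.tail e).2)
      have c2 := h₃.closed (a := m + e) (by omega) (by rw [(ha.tail e).2]; exact (G.head e).2)
      rw [(ha.tail e).1, (ha.head e).1, (h₁ e).1] at c1
      rw [(ha.tail e).2, (ha.head e).2, (h₁ e).2] at c2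
      simp only [mem_visited]
      exact ⟨fun h h' => c1 h (by linarith), c2⟩
    refine ⟨mem_visited.2 (h₃.starts _ G.source.2 (Or.inl rfl)),
      mem_visited.2 (h₃.starts _ u.2 (Or.inr rfl)), key, fun C h1 h2 h3 v hv => ?_⟩
    refine (h₃.reached (fun v => ∃ h : v < n, (⟨v, h⟩ : Fin n) ∈ C) ?_ ?_ v v.2
      (mem_visited.1 hv)).2
    · rintro w (rfl | rfl)
      · exact ⟨G.source.2, h1⟩
      · exact ⟨u.2, h2⟩
    · refine arc_cases (fun e => ?_) fun e => ?_
      · rw [(ha.tail e).1, (ha.head e).1, (h₁ e).1]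
        rintro ⟨_, h⟩ h'
        exact ⟨(G.head e).2, (h3 e).1 h (by linarith)⟩
      · rw [(ha.tail e).2, (ha.head e).2, (h₁ e).2]
        rintro ⟨_, h⟩ h'
        exact ⟨(G.tail e).2, (h3 e).2 h h'⟩

theorem mergeLoop_spec (hG : Holds G σ) {A D : ℕ} (hAD : A ≠ D) {g : Fin m → Fin n}
    (hg : ∀ e : Fin m, σ.ia A e = g e) {a b : Fin n} (ha : σ.iv 14 = a) (hb : σ.iv 15 = b) :
    HaltsWith (.mergeLoop A D) O σ N M 0 (m * 5 + 2) fun σ' => ∀ e : Fin m,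
      σ'.ia D e = (if g e = a then G.source else if g e = b then G.sink else g e : Fin n) := by
  refine (HaltsWith.forLoop_pure (K := 3) (fun i σ' => ∀ e : Fin m, (e : ℕ) < i →
      σ'.ia D e = (if g e = a then G.source else if g e = b then G.sink else g e : Fin n))
    (by simp [Prog.ivs]) (by simp [Prog.ivs, Prog.forLoop]) hG.edges (Nat.zero_le _) (by simp)
    fun i σ' _ hi ag hx hI => HaltsWith.ite (K := 2)
      (fun h => HaltsWith.straight rfl (Nat.one_le_ofNat) ?_)
      fun h => HaltsWith.ite (K := 1) (fun h' => HaltsWith.straight rfl le_rfl ?_)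
      fun h' => HaltsWith.straight rfl le_rfl ?_).mono le_rfl le_rfl
    fun σ' ag h e => h e e.2
  all_goals
    have e14 : σ'.iv 14 = a := (ag.iv 14 (by simp [Prog.ivs, Prog.forLoop])).trans ha
    have e15 : σ'.iv 15 = b := (ag.iv 15 (by simp [Prog.ivs, Prog.forLoop])).trans hb
    have e2 : σ'.iv 2 = G.source := (ag.iv 2 (by simp [Prog.ivs, Prog.forLoop])).trans hG.source
    have e3 : σ'.iv 3 = G.sink := (ag.iv 3 (by simp [Prog.ivs, Prog.forLoop])).trans hG.sink
    have eA : σ'.ia A i = g ⟨i, hi⟩ := by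
      rw [ag.ia A (by simp [Prog.ias, Prog.forLoop, hAD])]
      exact hg ⟨i, hi⟩
    simp only [BExpr.eval, IExpr.eval, hx, eA, e14, Fin.val_inj] at h
    refine forall_lt_succ hi (fun e he => by simpa [hx, he.ne] using hI e he) ?_
  · simp [hx, h, e2]
  all_goals simp only [BExpr.eval, IExpr.eval, hx, eA, e15, Fin.val_inj] at h'
  · rw [if_neg h, if_pos h']
    simp [hx, e3]
  · rw [if_neg h, if_neg h']
    simp [hx, eA]

theorem cutLoop_spec (hG : Holds G σ) :
    HaltsWith .cutLoop O σ N M 0 (m * 4 + 3) fun σ' => σ'.rv 2 = G.cutCap (visited n σ) := by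
  refine (HaltsWith.seq (q₁ := 0) (K₁ := 1) (q₂ := 0) (K₂ := m * (2 + 2) + 2)
    (mid := fun σ' => σ'.rv 2 = 0)
    (HaltsWith.straight rfl le_rfl (by simp)) fun σ₁ ag₁ h₁ =>
    (HaltsWith.forLoop_pure (K := 2) (fun i σ' =>
      σ'.rv 2 = ∑ j ∈ Finset.range i, if σ.ia 10 (σ.ia 0 j) = 1 ∧ ¬ σ.ia 10 (σ.ia 1 j) = 1
        then σ.ra 0 j else 0)
      (by decide) (by decide) (hG.frame ag₁ (by decide)).edges
      (Nat.zero_le _) (by simp [h₁])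
      fun i σ' _ hi ag hx hI => HaltsWith.ite (K := 1)
        (fun h => HaltsWith.straight rfl le_rfl ?_)
        fun h => HaltsWith.straight rfl le_rfl ?_).mono le_rfl le_rfl fun σ' _ h => ?_).mono
    le_rfl (by omega) fun _ _ h => h
  rotate_left 2
  · rw [h, Finset.sum_range, Network.cutCap]
    refine Finset.sum_congr rfl fun e _ => ?_
    rw [hG.tail, hG.head, hG.cap]
    simp only [mem_visited]
  all_goals
    have e0 : σ'.ia 0 = σ.ia 0 := (ag.ia 0 (by decide)).trans (ag₁.ia 0 (by decide))
    have e1 : σ'.ia 1 = σ.ia 1 := (ag.ia 1 (by decide)).trans (ag₁.ia 1 (by decide))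
    have e10 : σ'.ia 10 = σ.ia 10 := (ag.ia 10 (by decide)).trans (ag₁.ia 10 (by decide))
    have e2 : σ'.ra 0 = σ.ra 0 := (ag.ra 0 (by decide)).trans (ag₁.ra 0 (by decide))
    simp only [BExpr.eval, IExpr.eval, hx, e0, e1, e10] at h
    rw [Finset.sum_range_succ]
  · rw [if_pos h]
    simp [hI, hx, e2]
  · rw [if_neg h, add_zero]
    exact hI

/-- The best cut so far among those that satisfy `P`. -/
def Best (G : Network (Fin n) (Fin m)) (P : Finset (Fin n) → Prop) (σ : State) : Prop :=
  (σ.iv 20 = 0 ∧ ∀ C, G.IsCut C → ¬ P C) ∨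
    (σ.iv 20 = 1 ∧ ∃ C, G.IsCut C ∧ P C ∧ G.cutCap C = σ.rv 3 ∧
      (∀ v : Fin n, σ.ia 15 v = if v ∈ C then 1 else 0) ∧
      ∀ D, G.IsCut D → P D → σ.rv 3 ≤ G.cutCap D)

theorem Best.frame {Q : Finset (Fin n) → Prop} (h : Best G Q σ) {P : Prog} {σ' : State}
    (ha : Agrees P σ σ') (h1 : 20 ∉ P.ivs) (h2 : 3 ∉ P.rvs) (h3 : 15 ∉ P.ias) : Best G Q σ' := by
  unfold Best
  rw [ha.iv _ h1, ha.rv _ h2, ha.ia _ h3]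
  exact h

theorem keepBest_spec (hG : Holds G σ) {P P' : Finset (Fin n) → Prop} (h : Best G P σ)
    (hcut : G.IsCut (visited n σ)) (hP' : P' (visited n σ)) (hval : σ.rv 2 = G.cutCap (visited n σ))
    (hmin : ∀ D, G.IsCut D → P' D → σ.rv 2 ≤ G.cutCap D) :
    HaltsWith .keepBest O σ N M 0 (n * 4 + 5) (Best G fun C => P C ∨ P' C) := by
  refine HaltsWith.ite (K := n * 4 + 4)
    (fun hb => HaltsWith.straight rfl (show 1 ≤ n * 4 + 4 by omega) ?_) fun hb => ?_
  · simp only [BExpr.eval, IExpr.eval, RExpr.eval, not_lt] at hb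
    rcases h with ⟨h1, _⟩ | ⟨h1, C, h2, h3, h4, h5, h6⟩
    · omega
    · refine Or.inr ⟨h1, C, h2, Or.inl h3, h4, h5, fun D hD hPD => ?_⟩
      rcases hPD with hPD | hPD
      · exact h6 D hD hPD
      · exact hb.2.trans (hmin D hD hPD)
  · simp only [BExpr.eval, IExpr.eval, RExpr.eval, not_and, not_not] at hb
    refine (HaltsWith.seq (q₁ := 0) (K₁ := 2) (q₂ := 0) (K₂ := n * (2 + 2) + 2)
      (mid := fun τ => τ.rv 3 = σ.rv 2 ∧ τ.iv 20 = 1)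
      (HaltsWith.straight rfl le_rfl (by simp)) fun σ₁ ag₁ h₁ =>
      (HaltsWith.forLoop_pure (K := 2) (fun i σ' => ∀ v < i,
        σ'.ia 15 v = if σ.ia 10 v = 1 then 1 else 0)
      (by decide) (by decide) (hG.frame ag₁ (by decide)).vertices (Nat.zero_le _) (by simp)
      fun i σ' _ hi ag hx hI => HaltsWith.ite (K := 1)
        (fun h => HaltsWith.straight rfl le_rfl ?_)
        fun h => HaltsWith.straight rfl le_rfl ?_).mono le_rfl le_rfl fun σ' ag hside => ?_).mono
      le_rfl (by omega) fun _ _ h => h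
    rotate_left 2
    · have e3 : σ'.rv 3 = σ.rv 2 := (ag.rv 3 (by decide)).trans h₁.1
      refine Or.inr ⟨(ag.iv 20 (by decide)).trans h₁.2, visited n σ, hcut, Or.inr hP',
        by rw [e3, hval], fun v => ?_, fun D hD hPD => ?_⟩
      · rw [hside v v.2]
        simp only [mem_visited]
      · rw [e3]
        rcases hPD with hPD | hPD
        · rcases h with ⟨_, h1⟩ | ⟨h1, C, h2, h3, h4, h5, h6⟩
          · exact absurd hPD (h1 D hD)
          · exact (hb h1).le.trans (h6 D hD hPD)
        · exact hmin D hD hPD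
    all_goals
      have e10 : σ'.ia 10 = σ.ia 10 := (ag.ia 10 (by decide)).trans (ag₁.ia 10 (by decide))
      simp only [BExpr.eval, IExpr.eval, hx, e10] at h
      intro v hv
      rcases Nat.lt_succ_iff_lt_or_eq.1 hv with hv' | rfl
      · simpa [hx, hv'.ne] using hI v hv'
      · simp [hx, h]

theorem directedCut_spec (hO : IsMaxFlowSubroutine O) (hN : n ≤ N) (hM : m ≤ M)
    (hst : G.source ≠ G.sink) (h0 : ∀ e, 0 ≤ G.cap e) (hG : Holds G σ) (hA : HoldsArcs G σ)
    {P : Finset (Fin n) → Prop} (hP : Best G P σ) {a b : Fin n} (hab : a ≠ b) (ha : σ.iv 14 = a)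
    (hb : σ.iv 15 = b) :
    HaltsWith .directedCut O σ N M 1 (40 * (n + m) + 60)
      (Best G fun C => P C ∨ a ∈ C ∧ b ∉ C) := by
  refine HaltsWith.ite (K := 40 * (n + m) + 59) (fun ht => ?_) fun ht =>
    HaltsWith.straight rfl (show 1 ≤ _ by omega) ?_
  · simp only [BExpr.eval, IExpr.eval, ha, hb, hG.source, hG.sink, Fin.val_inj] at ht
    refine (HaltsWith.seq (q₂ := 1) (K₂ := (m * 5 + 2) + (1 + ((24 * (n + m) + 30) +
        ((m * 4 + 3) + (n * 4 + 5))))) (mergeLoop_spec hG (by decide) hG.tail ha hb)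
      fun σ₁ ag₁ h₁ => ?_).mono (by omega) (by omega) fun _ _ h => h
    have hG₁ := hG.frame ag₁ (by decide)
    have ha₁ := (ag₁.iv 14 (by decide)).trans ha
    have hb₁ := (ag₁.iv 15 (by decide)).trans hb
    refine (HaltsWith.seq (q₂ := 1) (mergeLoop_spec hG₁ (by decide) hG₁.head ha₁ hb₁)
      fun σ₂ ag₂ h₂ => ?_).mono (by omega) le_rfl fun _ _ h => h
    have hG₂ := hG₁.frame ag₂ (by decide)
    have ha₂ := (ag₂.iv 14 (by decide)).trans ha₁
    have e13 : σ₂.ia 13 = σ₁.ia 13 := ag₂.ia 13 (by decide)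
    have hflow : HaltsWith .contractFlow O σ₂ N M 1 1 fun σ' =>
        (G.contract a b).IsMaxFlow fun e : Fin m => σ'.ra 3 e :=
      HaltsWith.flow hO (G.contract a b) hG₂.vertices hG₂.edges hN hM hG₂.source hG₂.sink hst
        (fun e => by rw [e13]; exact h₁ e) h₂ hG₂.cap h0
    refine HaltsWith.seq (q₂ := 0) hflow fun σ₃ ag₃ h₃ => ?_
    have hG₃ := hG₂.frame ag₃ (by decide)
    have hA₃ := ((hA.frame ag₁ (by decide) (by decide) (by decide) (by decide) (by decide)).frame
      ag₂ (by decide) (by decide) (by decide) (by decide) (by decide)).frame ag₃ (by decide)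
      (by decide) (by decide) (by decide) (by decide)
    have ha₃ := (ag₃.iv 14 (by decide)).trans ha₂
    refine HaltsWith.seq (q₁ := 0) (q₂ := 0) (search_spec hG₃ hA₃ ha₃) fun σ₄ ag₄ h₄ => ?_
    have hG₄ := hG₃.frame ag₄ (by decide)
    obtain ⟨c1, c2, c3⟩ := Network.contract_cut hst hab ht.1 ht.2 h₃ h₄.1 h₄.2.1 h₄.2.2.1 h₄.2.2.2
    refine HaltsWith.seq (q₁ := 0) (q₂ := 0) (cutLoop_spec hG₄) fun σ₅ ag₅ h₅ => ?_
    have hG₅ := hG₄.frame ag₅ (by decide)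
    have hv : visited n σ₅ = visited n σ₄ := by
      unfold visited
      rw [ag₅.ia 10 (by decide)]
    have hP₅ := ((((hP.frame ag₁ (by decide) (by decide) (by decide)).frame ag₂ (by decide)
      (by decide) (by decide)).frame ag₃ (by decide) (by decide) (by decide)).frame ag₄ (by decide)
      (by decide) (by decide)).frame ag₅ (by decide) (by decide) (by decide)
    refine keepBest_spec hG₅ hP₅ (by rw [hv]; exact c1) (P' := fun C => a ∈ C ∧ b ∉ C)
      (by rw [hv]; exact ⟨h₄.2.1, c2⟩) (by rw [hv]; exact h₅) fun D hD hD' => ?_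
    rw [h₅]
    exact c3 D hD hD'.1 hD'.2
  · -- no cut has the sink inside or the source outside
    have hno : ∀ C, G.IsCut C → ¬ (a ∈ C ∧ b ∉ C) := by
      rintro C hC ⟨h1, h2⟩
      apply ht
      simp only [BExpr.eval, IExpr.eval, ha, hb, hG.source, hG.sink, Fin.val_inj]
      exact ⟨fun h => hC.2 (h ▸ h1), fun h => h2 (h ▸ hC.1)⟩
    rcases hP with ⟨h1, h2⟩ | ⟨h1, C, h2, h3, h4, h5, h6⟩
    · exact Or.inl ⟨h1, fun C hC h => h.elim (h2 C hC) (hno C hC)⟩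
    · exact Or.inr ⟨h1, C, h2, Or.inl h3, h4, h5, fun D hD h => h6 D hD (h.resolve_right (hno D hD))⟩

theorem separatingCut_spec (hO : IsMaxFlowSubroutine O) (hN : n ≤ N) (hM : m ≤ M)
    (hst : G.source ≠ G.sink) (h0 : ∀ e, 0 ≤ G.cap e) (hG : Holds G σ) (hA : HoldsArcs G σ)
    {p q : Fin n} (hpq : p ≠ q) (hp : σ.iv 21 = p) (hq : σ.iv 22 = q) :
    HaltsWith .separatingCut O σ N M 2 (80 * (n + m) + 125) fun σ' =>
      σ'.rv 3 = G.sepCap p q ∧ ∃ C, G.IsCut C ∧ Network.Separates C p q ∧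
        G.cutCap C = G.sepCap p q ∧ ∀ v : Fin n, σ'.ia 15 v = if v ∈ C then 1 else 0 := by
  refine (HaltsWith.seq (q₁ := 0) (K₁ := 3) (q₂ := 1 + (0 + 1))
    (K₂ := (40 * (n + m) + 60) + (2 + (40 * (n + m) + 60)))
    (mid := fun τ => τ.iv 20 = 0 ∧ τ.iv 14 = p ∧ τ.iv 15 = q)
    (HaltsWith.straight rfl le_rfl (by simp [hp, hq])) fun σ₁ ag₁ h₁ => ?_).mono (by omega)
    (by omega) fun _ _ h => h
  have hG₁ := hG.frame ag₁ (by decide)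
  have hA₁ := hA.frame ag₁ (by decide) (by decide) (by decide) (by decide) (by decide)
  refine HaltsWith.seq (directedCut_spec hO hN hM hst h0 hG₁ hA₁ (P := fun _ => False)
    (Or.inl ⟨h₁.1, fun _ _ h => h⟩) hpq h₁.2.1 h₁.2.2) fun σ₂ ag₂ h₂ => ?_
  have hG₂ := hG₁.frame ag₂ (by decide)
  have hA₂ := hA₁.frame ag₂ (by decide) (by decide) (by decide) (by decide) (by decide)
  have e21 : σ₂.iv 21 = p := (ag₂.iv 21 (by decide)).trans ((ag₁.iv 21 (by decide)).trans hp)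
  have e22 : σ₂.iv 22 = q := (ag₂.iv 22 (by decide)).trans ((ag₁.iv 22 (by decide)).trans hq)
  refine HaltsWith.seq (q₁ := 0) (K₁ := 2) (mid := fun τ => τ.iv 14 = q ∧ τ.iv 15 = p)
    (HaltsWith.straight rfl le_rfl (by simp [e21, e22])) fun σ₃ ag₃ h₃ => ?_
  refine (directedCut_spec hO hN hM hst h0 (hG₂.frame ag₃ (by decide))
    (hA₂.frame ag₃ (by decide) (by decide) (by decide) (by decide) (by decide))
    (h₂.frame ag₃ (by decide) (by decide) (by decide)) hpq.symm h₃.1 h₃.2).mono le_rfl le_rfl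
    fun σ₄ _ h₄ => ?_
  have hsep : ∀ C : Finset (Fin n), ((False ∨ p ∈ C ∧ q ∉ C) ∨ q ∈ C ∧ p ∉ C) ↔
      Network.Separates C p q := by
    intro C
    unfold Network.Separates
    tauto
  simp only [Best, hsep] at h₄
  rcases h₄ with ⟨_, h⟩ | ⟨_, C, h2, h3, h4, h5, h6⟩
  · obtain ⟨C, h1, h2⟩ := G.exists_separating hst hpq
    exact absurd h2 (h C h1)
  · have : G.cutCap C = G.sepCap p q := by
      obtain ⟨D, d1, d2, d3⟩ := G.exists_sepCap_eq hst hpq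
      refine le_antisymm ?_ (G.sepCap_le h2 h3)
      rw [h4, ← d3]
      exact h6 D d1 d2
    exact ⟨by rw [← h4, this], C, h2, h3, this, h5⟩

end

/-! ### The program for all pairs of vertices -/

namespace Prog

/-- The arcs of the residual graph and their linked lists. -/
def arcs : Prog := arcLoop ;; chainLoop

/-- The offsets of the rows of a square matrix are written to the integer array 17, and all
vertices are put into the class of the vertex 0, in the integer array 16. -/
def rowLoop : Prog :=
  .iset 25 (.const 0) ;; .forLoop 6 0 0
    (.iput 17 (.var 6) (.var 25) ;; .iput 16 (.var 6) (.const 0) ;;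
      .iset 25 (.plus (.var 25) (.var 0)))

/-- The class of the vertex in the variable 22 is split off, according to the cut in the integer
array 15. -/
def classLoop : Prog :=
  .forLoop 6 0 0
    (.ite (.conj (.neg (.conj (.neg (.ieq (.get 16 (.var 6)) (.var 21)))
        (.neg (.rlt (.var 3) (.get 6 (.plus (.var 23) (.get 16 (.var 6))))))))
        (.ieq (.get 15 (.var 6)) (.get 15 (.var 22))))
      (.iput 16 (.var 6) (.var 22)) .skip)

/-- The entries for the vertex in the variable 22 are added to the matrix in the real array 6. -/
def matrixLoop : Prog :=
  .forLoop 6 0 22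
    (.ite (.conj (.neg (.ieq (.var 6) (.var 21)))
        (.neg (.rlt (.var 3) (.get 6 (.plus (.var 23) (.var 6))))))
      (.rset 4 (.get 6 (.plus (.var 23) (.var 6)))) (.rset 4 (.var 3)) ;;
    (.rput 6 (.plus (.var 24) (.var 6)) (.var 4) ;;
      .rput 6 (.plus (.get 17 (.var 6)) (.var 22)) (.var 4)))

/-- The vertex in the variable 22 becomes a representative. -/
def classStep : Prog :=
  (.iset 21 (.get 16 (.var 22)) ;; .iset 23 (.get 17 (.var 21)) ;; .iset 24 (.get 17 (.var 22))) ;;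
    separatingCut ;; classLoop ;; matrixLoop

/-- The least capacities of cuts that separate two vertices are written to the real array 6. -/
def allPairs : Prog := rowLoop ;; .forLoop 22 1 0 classStep

end Prog

section

variable {O : Subroutine} {N M n m : ℕ} {G : Network (Fin n) (Fin m)} {σ : State}

theorem arcs_spec (hG : Holds G σ) :
    HaltsWith .arcs O σ N M 0 (n * 3 + m * 14 + 7) (HoldsArcs G) := by
  refine (HaltsWith.seq (q₂ := 0) (K₂ := n * 3 + m * 8 + 4) (arcLoop_spec hG) fun σ₁ ag₁ h₁ =>
    (chainLoop_spec (hG.frame ag₁ (by decide)) h₁.1 ?_).mono le_rfl le_rfl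
      fun σ₂ ag₂ h₂ => ?_).mono (by omega) (by omega) fun _ _ h => h
  · exact arc_cases (fun e => by rw [(h₁.2.1 e).1]; exact (G.tail e).2)
      fun e => by rw [(h₁.2.1 e).2]; exact (G.head e).2
  · refine ⟨(ag₂.iv 12 (by decide)).trans h₁.1, ?_, ?_, ?_, ?_⟩
    · rw [ag₂.ia 6 (by decide)]; exact h₁.2.1
    · rw [ag₂.ia 7 (by decide)]; exact h₁.2.2
    · rw [ag₂.ia 6 (by decide)]; exact h₂.1
    · rw [ag₂.ia 6 (by decide)]; exact h₂.2

theorem rowLoop_spec (hG : Holds G σ) :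
    HaltsWith .rowLoop O σ N M 0 (n * 5 + 3) fun σ' =>
      ∀ v < n, σ'.ia 17 v = v * n ∧ σ'.ia 16 v = 0 := by
  refine (HaltsWith.seq (q₁ := 0) (K₁ := 1) (q₂ := 0) (K₂ := n * (3 + 2) + 2)
    (mid := fun σ' => σ'.iv 25 = 0)
    (HaltsWith.straight rfl le_rfl (by simp)) fun σ₁ ag₁ h₁ =>
    have hG₁ := hG.frame ag₁ (by decide)
    (HaltsWith.forLoop_pure (K := 3) (fun i σ' => σ'.iv 25 = i * n ∧ ∀ v < i,
      σ'.ia 17 v = v * n ∧ σ'.ia 16 v = 0)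
      (by decide) (by decide) hG₁.vertices (Nat.zero_le _) (by simp [h₁])
      fun i σ' _ hi ag hx hI => HaltsWith.straight rfl le_rfl ?_).mono le_rfl le_rfl
      fun σ' _ h => h.2).mono le_rfl (by omega) fun _ _ h => h
  have hn := (hG₁.frame ag (by decide)).vertices
  refine ⟨by simp [hI.1, hn, Nat.succ_mul], fun v hv => ?_⟩
  rcases Nat.lt_succ_iff_lt_or_eq.1 hv with hv' | rfl
  · simpa [hx, hv'.ne] using hI.2 v hv'
  · simp [hx, hI.1]

open Classical in
theorem classLoop_spec (hG : Holds G σ) :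
    HaltsWith .classLoop O σ N M 0 (n * 4 + 2) fun σ' =>
      ∀ v < n, σ'.ia 16 v = if (σ.ia 16 v = σ.iv 21 ∨ σ.rv 3 < σ.ra 6 (σ.iv 23 + σ.ia 16 v)) ∧
        σ.ia 15 v = σ.ia 15 (σ.iv 22) then σ.iv 22 else σ.ia 16 v := by
  refine (HaltsWith.forLoop_pure (K := 2) (fun i σ' => (∀ v < i,
    σ'.ia 16 v = if (σ.ia 16 v = σ.iv 21 ∨ σ.rv 3 < σ.ra 6 (σ.iv 23 + σ.ia 16 v)) ∧
        σ.ia 15 v = σ.ia 15 (σ.iv 22) then σ.iv 22 else σ.ia 16 v) ∧ ∀ v, i ≤ v →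
    σ'.ia 16 v = σ.ia 16 v)
    (by decide) (by decide) hG.vertices (Nat.zero_le _) (by simp) fun i σ' _ hi ag hx hI =>
    HaltsWith.ite (K := 1) (fun h => HaltsWith.straight rfl le_rfl ?_)
      fun h => HaltsWith.straight rfl le_rfl ?_).mono le_rfl le_rfl fun _ _ h => h.1
  all_goals
    have e21 : σ'.iv 21 = σ.iv 21 := ag.iv 21 (by decide)
    have e22 : σ'.iv 22 = σ.iv 22 := ag.iv 22 (by decide)
    have e23 : σ'.iv 23 = σ.iv 23 := ag.iv 23 (by decide)
    have e15 : σ'.ia 15 = σ.ia 15 := ag.ia 15 (by decide)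
    have e3 : σ'.rv 3 = σ.rv 3 := ag.rv 3 (by decide)
    have e6 : σ'.ra 6 = σ.ra 6 := ag.ra 6 (by decide)
    simp only [BExpr.eval, IExpr.eval, RExpr.eval, hx, hI.2 i le_rfl, e21, e22, e23, e15, e3, e6,
      ← not_or, not_not] at h
    refine ⟨fun v hv => ?_, fun v hv => ?_⟩
  · rcases Nat.lt_succ_iff_lt_or_eq.1 hv with hv' | rfl
    · rw [← hI.1 v hv']
      simp [hx, hv'.ne]
    · rw [if_pos h]
      simp [hx, e22]
  · have : v ≠ i := by omega
    simpa [hx, this] using hI.2 v (by omega)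
  · rcases Nat.lt_succ_iff_lt_or_eq.1 hv with hv' | rfl
    · exact hI.1 v hv'
    · rw [if_neg h]
      exact hI.2 v le_rfl
  · exact hI.2 v (by omega)

theorem mul_add_inj {n a b c d : ℕ} (hb : b < n) (hd : d < n) :
    a * n + b = c * n + d ↔ a = c ∧ b = d := by
  constructor
  · intro h
    have h1 := congrArg (· / n) h
    have hn : 0 < n := by omega
    simp only [mul_comm _ n, Nat.mul_add_div hn, Nat.div_eq_of_lt hb, Nat.div_eq_of_lt hd,
      add_zero] at h1
    subst h1
    exact ⟨rfl, by omega⟩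
  · rintro ⟨rfl, rfl⟩
    rfl

theorem matrixLoop_spec {p q : ℕ} (hpq : p < q) (hq : q < n) (h21 : σ.iv 21 = p)
    (h22 : σ.iv 22 = q) (h23 : σ.iv 23 = p * n) (h24 : σ.iv 24 = q * n)
    (hrow : ∀ v < n, σ.ia 17 v = v * n) :
    HaltsWith .matrixLoop O σ N M 0 (n * 6 + 2) fun σ' =>
      (∀ a < q, ∀ b < q, σ'.ra 6 (a * n + b) = σ.ra 6 (a * n + b)) ∧
      ∀ b < q, σ'.ra 6 (q * n + b)
          = (if b = p then σ.rv 3 else min (σ.rv 3) (σ.ra 6 (p * n + b))) ∧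
        σ'.ra 6 (b * n + q) = σ'.ra 6 (q * n + b) := by
  refine (HaltsWith.forLoop_pure (K := 4) (fun i σ' =>
      (∀ a < q, ∀ b < q, σ'.ra 6 (a * n + b) = σ.ra 6 (a * n + b)) ∧
      ∀ b < i, σ'.ra 6 (q * n + b)
          = (if b = p then σ.rv 3 else min (σ.rv 3) (σ.ra 6 (p * n + b))) ∧
        σ'.ra 6 (b * n + q) = σ'.ra 6 (q * n + b))
    (by decide) (by decide) h22 (Nat.zero_le _) (by simp) fun i σ' _ hi ag hx hI => ?_).mono
    le_rfl (by gcongr) fun _ _ h => h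
  have e21 : σ'.iv 21 = p := (ag.iv 21 (by decide)).trans h21
  have e22 : σ'.iv 22 = q := (ag.iv 22 (by decide)).trans h22
  have e23 : σ'.iv 23 = p * n := (ag.iv 23 (by decide)).trans h23
  have e24 : σ'.iv 24 = q * n := (ag.iv 24 (by decide)).trans h24
  have e3 : σ'.rv 3 = σ.rv 3 := ag.rv 3 (by decide)
  have e17 : σ'.ia 17 i = i * n := by rw [ag.ia 17 (by decide), hrow i (by omega)]
  refine HaltsWith.seq (q₁ := 0) (K₁ := 2) (q₂ := 0) (K₂ := 2) (mid := fun τ =>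
    τ.rv 4 = (if i = p then σ.rv 3 else min (σ.rv 3) (σ.ra 6 (p * n + i))))
    (HaltsWith.ite (K := 1) (fun h => HaltsWith.straight rfl le_rfl ?_)
      fun h => HaltsWith.straight rfl le_rfl ?_) fun τ agτ hτ => HaltsWith.straight rfl le_rfl ?_
  · simp only [BExpr.eval, IExpr.eval, RExpr.eval, hx, e21, e23, e3, hI.1 p hpq i hi,
      not_lt] at h
    rw [if_neg h.1, min_eq_right h.2]
    simp [hx, e23, hI.1 p hpq i hi]
  · simp only [BExpr.eval, IExpr.eval, RExpr.eval, hx, e21, e23, e3, hI.1 p hpq i hi,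
      not_and, not_not] at h
    split_ifs with hip
    · simp [e3]
    · rw [min_eq_left (h hip).le]
      simp [e3]
  · have t6 : τ.iv 6 = i := (agτ.iv 6 (by decide)).trans hx
    have t22 : τ.iv 22 = q := (agτ.iv 22 (by decide)).trans e22
    have t24 : τ.iv 24 = q * n := (agτ.iv 24 (by decide)).trans e24
    have t17 : τ.ia 17 i = i * n := by rw [agτ.ia 17 (by decide), e17]
    have tM : τ.ra 6 = σ'.ra 6 := agτ.ra 6 (by decide)
    have hin : i < n := hi.trans hq
    have new : ∀ a b, b < n → (Prog.run (.rput 6 (.plus (.var 24) (.var 6)) (.var 4) ;;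
        .rput 6 (.plus (.get 17 (.var 6)) (.var 22)) (.var 4)) τ).ra 6 (a * n + b)
        = if (a = i ∧ b = q) ∨ (a = q ∧ b = i) then τ.rv 4 else σ'.ra 6 (a * n + b) := by
      intro a b hb
      simp only [Prog.run, State.putR, IExpr.eval, RExpr.eval, t6, t22, t24, t17, tM, true_and,
        mul_add_inj hb hin, mul_add_inj hb hq]
      split_ifs <;> tauto
    refine ⟨fun a ha b hb => ?_, fun b hb => ?_⟩
    · have := new a b (by omega)
      rw [if_neg (by omega), hI.1 a ha b hb] at this
      exact this
    · have h1 := new q b (by omega)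
      have h2 := new b q hq
      rcases Nat.lt_succ_iff_lt_or_eq.1 hb with hb' | rfl
      · rw [if_neg (by omega)] at h1 h2
        have := hI.2 b hb'
        exact ⟨h1.trans this.1, h2.trans (this.2.trans h1.symm)⟩
      · rw [if_pos (by simp)] at h1 h2
        exact ⟨h1.trans hτ, h2.trans h1.symm⟩

/-- `Network.sepCap` on vertices given as natural numbers. -/
noncomputable def sepNat (G : Network (Fin n) (Fin m)) (a b : ℕ) : ℝ :=
  if h : a < n ∧ b < n then G.sepCap ⟨a, h.1⟩ ⟨b, h.2⟩ else 0

theorem sepNat_fin (G : Network (Fin n) (Fin m)) (u v : Fin n) : sepNat G u v = G.sepCap u v := by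
  simp [sepNat]

theorem sepNat_comm (G : Network (Fin n) (Fin m)) (a b : ℕ) : sepNat G a b = sepNat G b a := by
  unfold sepNat
  by_cases h : a < n ∧ b < n
  · rw [dif_pos h, dif_pos h.symm, G.sepCap_comm]
  · rw [dif_neg h, dif_neg fun h' => h h'.symm]

theorem sepNat_ultra (G : Network (Fin n) (Fin m)) (hst : G.source ≠ G.sink) :
    ∀ a < n, ∀ b < n, ∀ c < n, a ≠ c → min (sepNat G a b) (sepNat G b c) ≤ sepNat G a c := by
  intro a ha b hb c hc hac
  have := G.sepCap_ultra hst (u := ⟨a, ha⟩) (w := ⟨c, hc⟩) (by simpa using hac) ⟨b, hb⟩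
  simpa [sepNat, ha, hb, hc] using this

theorem classStep_spec (hO : IsMaxFlowSubroutine O) (hN : n ≤ N) (hM : m ≤ M)
    (hst : G.source ≠ G.sink) (h0 : ∀ e, 0 ≤ G.cap e) (hG : Holds G σ) (hA : HoldsArcs G σ)
    (hrow : ∀ v < n, σ.ia 17 v = v * n) {q : ℕ} (hq : q < n) (h22 : σ.iv 22 = q)
    (h : ClassInv n (sepNat G) q (σ.ia 16) fun a b => σ.ra 6 (a * n + b)) :
    HaltsWith .classStep O σ N M 2 (90 * (n + m) + 132) fun σ' =>
      ClassInv n (sepNat G) (q + 1) (σ'.ia 16) fun a b => σ'.ra 6 (a * n + b) := by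
  set p := σ.ia 16 q with hp
  have hpq : p < q := h.lt q hq
  have hpn : p < n := hpq.trans hq
  refine (HaltsWith.seq (q₁ := 0) (K₁ := 3) (q₂ := 2 + (0 + 0))
    (K₂ := (80 * (n + m) + 125) + ((n * 4 + 2) + (n * 6 + 2)))
    (mid := fun τ => τ.iv 21 = p ∧ τ.iv 23 = p * n ∧ τ.iv 24 = q * n)
    (HaltsWith.straight rfl le_rfl (by simp [h22, ← hp, hrow p hpn, hrow q hq])) fun σ₁ ag₁ h₁ =>
    ?_).mono (by omega) (by omega) fun _ _ h => h
  have hG₁ := hG.frame ag₁ (by decide)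
  have e22₁ : σ₁.iv 22 = q := (ag₁.iv 22 (by decide)).trans h22
  refine HaltsWith.seq (separatingCut_spec hO hN hM hst h0 hG₁
    (hA.frame ag₁ (by decide) (by decide) (by decide) (by decide) (by decide))
    (p := ⟨p, hpn⟩) (q := ⟨q, hq⟩) (by simpa using hpq.ne) h₁.1 e22₁) fun σ₂ ag₂ h₂ => ?_
  obtain ⟨hf, C, hC, hsep, hcap, hside⟩ := h₂
  have hG₂ := hG₁.frame ag₂ (by decide)
  refine HaltsWith.seq (classLoop_spec hG₂) fun σ₃ ag₃ h₃ => ?_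
  have e21 : σ₂.iv 21 = p := (ag₂.iv 21 (by decide)).trans h₁.1
  have e22 : σ₂.iv 22 = q := (ag₂.iv 22 (by decide)).trans e22₁
  have e23 : σ₂.iv 23 = p * n := (ag₂.iv 23 (by decide)).trans h₁.2.1
  have e24 : σ₂.iv 24 = q * n := (ag₂.iv 24 (by decide)).trans h₁.2.2
  have e6 : σ₂.ra 6 = σ.ra 6 := (ag₂.ra 6 (by decide)).trans (ag₁.ra 6 (by decide))
  have e16 : σ₂.ia 16 = σ.ia 16 := (ag₂.ia 16 (by decide)).trans (ag₁.ia 16 (by decide))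
  have f6 : σ₃.ra 6 = σ.ra 6 := (ag₃.ra 6 (by decide)).trans e6
  have f3 : σ₃.rv 3 = σ₂.rv 3 := ag₃.rv 3 (by decide)
  refine (matrixLoop_spec hpq hq ((ag₃.iv 21 (by decide)).trans e21)
    ((ag₃.iv 22 (by decide)).trans e22) ((ag₃.iv 23 (by decide)).trans e23)
    ((ag₃.iv 24 (by decide)).trans e24) ?_).mono le_rfl le_rfl fun σ₄ ag₄ h₄ => ?_
  · rw [ag₃.ia 17 (by decide), ag₂.ia 17 (by decide), ag₁.ia 17 (by decide)]
    exact hrow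
  · have g16 : σ₄.ia 16 = σ₃.ia 16 := ag₄.ia 16 (by decide)
    rw [f6, f3, hf] at h₄
    have hF : sepNat G p q = G.sepCap ⟨p, hpn⟩ ⟨q, hq⟩ := by simp [sepNat, hpn, hq]
    rw [← hF] at hf h₄ hcap
    have hSmem : ∀ a (ha : a < n), (∃ h : a < n, (⟨a, h⟩ : Fin n) ∈ C) ↔ (⟨a, ha⟩ : Fin n) ∈ C :=
      fun a ha => ⟨fun ⟨_, h⟩ => h, fun h => ⟨ha, h⟩⟩
    refine h.step hq (sepNat_comm G) (sepNat_ultra G hst)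
      (S := fun a => ∃ h : a < n, (⟨a, h⟩ : Fin n) ∈ C) ?_ ?_ (fun v hv => ?_) h₄.1
      (fun b hb => (h₄.2 b hb).1) fun b hb => (h₄.2 b hb).2
    · rw [hSmem q hq, ← hp, hSmem p hpn]
      exact fun h' => hsep h'.symm
    · intro a ha b hb hab
      rw [hSmem a ha, hSmem b hb] at hab
      rw [← hp, ← hcap]
      have := G.sepCap_le hC (u := ⟨a, ha⟩) (v := ⟨b, hb⟩) hab
      simpa [sepNat, ha, hb] using this
    · rw [g16, h₃ v hv, e21, e22, e23, e6, e16, hf]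
      have hs : σ₂.ia 15 v = σ₂.ia 15 q ↔
          ((∃ h : v < n, (⟨v, h⟩ : Fin n) ∈ C) ↔ ∃ h : q < n, (⟨q, h⟩ : Fin n) ∈ C) := by
        rw [hSmem v hv, hSmem q hq]
        have s1 := hside ⟨v, hv⟩
        have s2 := hside ⟨q, hq⟩
        simp only at s1 s2
        rw [s1, s2]
        split_ifs <;> simp_all
      simp only [hs]
      congr

theorem allPairs_spec (hO : IsMaxFlowSubroutine O) (hN : n ≤ N) (hM : m ≤ M)
    (hst : G.source ≠ G.sink) (h0 : ∀ e, 0 ≤ G.cap e) (hG : Holds G σ) (hA : HoldsArcs G σ) :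
    HaltsWith .allPairs O σ N M (n * 2) (n * 5 + 3 + (n * (90 * (n + m) + 132 + 2) + 2)) fun σ' =>
      (∀ u v : Fin n, u ≠ v → σ'.ra 6 (u * n + v) = G.sepCap u v) ∧
        ∀ v < n, σ'.ia 17 v = v * n := by
  have hn : 0 < n := G.source.pos
  refine (HaltsWith.seq (rowLoop_spec hG) fun σ₁ ag₁ h₁ => (HaltsWith.forLoop (fun i σ' =>
    ClassInv n (sepNat G) i (σ'.ia 16) fun a b => σ'.ra 6 (a * n + b)) (by decide) (by decide)
    (hG.frame ag₁ (by decide)).vertices hn ?_ fun i σ' hi hin ag hx hI =>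
    classStep_spec hO hN hM hst h0 ((hG.frame ag₁ (by decide)).frame ag (by decide))
      ((hA.frame ag₁ (by decide) (by decide) (by decide) (by decide) (by decide)).frame ag
        (by decide) (by decide) (by decide) (by decide) (by decide)) ?_ hin hx hI).mono
      le_rfl le_rfl fun σ' ag h => ⟨fun u v huv => ?_, ?_⟩).mono (by omega) le_rfl fun _ _ h => h
  · constructor
    · intro v hv
      change σ₁.ia 16 v < 1
      rw [(h₁ v hv).2]
      exact Nat.one_pos
    · intro a ha
      obtain rfl : a = 0 := by omega
      exact (h₁ 0 hn).2
    · intro a ha b hb hab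
      omega
    · intro v hv w hw hne
      exact absurd (((h₁ v hv).2).trans (h₁ w hw).2.symm) hne
  · rw [ag.ia 17 (by decide)]
    exact fun v hv => (h₁ v hv).1
  · rw [h.val u u.2 v v.2 (fun h => huv (Fin.ext h)), sepNat_fin]
  · rw [ag.ia 17 (by decide)]
    exact fun v hv => (h₁ v hv).1

end

/-! ### The program for the vitalities of all edges -/

namespace Prog

/-- Unmarked edges are classified by means of the cut capacities in the real array 6; the
vitalities are written to the real array 7. If at most half of the capacity of such an edge is used,
then some maximum flow avoids it; otherwise some maximum flow saturates it, so that it is tight if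
it is vital. -/
def unmarkedLoop : Prog :=
  .forLoop 6 0 1
    (.ite (.ieq (.get 2 (.var 6)) (.const 1)) .skip
      (.ite (.conj (.neg (.ieq (.get 0 (.var 6)) (.get 1 (.var 6))))
          (.rlt (.minus (.get 0 (.var 6)) (.get 1 (.var 6))) (.get 1 (.var 6))))
        (.rset 2 (.minus (.plus (.var 0) (.get 0 (.var 6)))
            (.get 6 (.plus (.get 17 (.get 0 (.var 6))) (.get 1 (.var 6))))) ;;
          .ite (.rlt .zero (.var 2)) (.rput 7 (.var 6) (.var 2) ;; .iput 2 (.var 6) (.const 1))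
            (.rput 7 (.var 6) .zero ;; .iput 2 (.var 6) (.const 0)))
        (.rput 7 (.var 6) .zero ;; .iput 2 (.var 6) (.const 0))))

/-- The edges are copied to the integer arrays 18 and 19 and the real array 8. -/
def copyLoop : Prog :=
  .forLoop 6 0 1 (.iput 18 (.var 6) (.get 0 (.var 6)) ;; .iput 19 (.var 6) (.get 1 (.var 6)) ;;
    .rput 8 (.var 6) (.get 0 (.var 6)))

/-- The vitality of the edge in the variable 8 is computed from a flow that avoids this edge. -/
def removal : Prog :=
  copyLoop ;; .rput 8 (.var 8) .zero ;;
    .flow (.var 0) (.var 1) (.var 2) (.var 3) 18 19 8 4 ;; flowValue 4 1 ;;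
    .rput 7 (.var 8) (.minus (.var 0) (.var 1))

/-- The four new edges of `Network.forceNet`. -/
def newEdges : Prog :=
  .iput 18 (.var 1) (.var 0) ;; .iput 19 (.var 1) (.var 2) ;; .rput 8 (.var 1) (.var 0) ;;
  .iput 18 (.plus (.var 1) (.const 1)) (.var 0) ;;
  .iput 19 (.plus (.var 1) (.const 1)) (.get 1 (.var 8)) ;;
  .rput 8 (.plus (.var 1) (.const 1)) (.get 0 (.var 8)) ;;
  .iput 18 (.plus (.var 1) (.const 2)) (.var 3) ;;
  .iput 19 (.plus (.var 1) (.const 2)) (.plus (.var 0) (.const 1)) ;;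
  .rput 8 (.plus (.var 1) (.const 2)) (.var 0) ;;
  .iput 18 (.plus (.var 1) (.const 3)) (.get 0 (.var 8)) ;;
  .iput 19 (.plus (.var 1) (.const 3)) (.plus (.var 0) (.const 1)) ;;
  .rput 8 (.plus (.var 1) (.const 3)) (.get 0 (.var 8))

/-- A maximum flow of `Network.forceNet` is written to the real array 4. -/
def forcedFlow : Prog :=
  newEdges ;; .flow (.plus (.var 0) (.const 2)) (.plus (.var 1) (.const 4)) (.var 0)
    (.plus (.var 0) (.const 1)) 18 19 8 4

/-- The edge in the variable 8 is classified by its vitality and the flow in the real array 4. -/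
def verdict : Prog :=
  .ite (.rlt .zero (.get 7 (.var 8)))
    (.ite (.req (.plus (.get 4 (.var 1)) (.get 4 (.plus (.var 1) (.const 1))))
        (.plus (.var 0) (.get 0 (.var 8))))
      (.iput 2 (.var 8) (.const 1)) (.iput 2 (.var 8) (.const 2)))
    (.iput 2 (.var 8) (.const 0))

/-- The edges listed in the integer array 5 are classified one by one. -/
def listedLoop : Prog :=
  .forLoop 7 0 0 (.iset 8 (.get 5 (.var 7)) ;;
    .ite (.ilt (.var 8) (.var 1)) (removal ;; forcedFlow ;; verdict) .skip)

/-- Vitalities of all edges in the real array 7, their types in the integer array 2. -/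
def classify : Prog :=
  candidates ;; flowValue 1 0 ;; arcs ;; allPairs ;; unmarkedLoop ;; listedLoop

end Prog

section

variable {O : Subroutine} {N M n m : ℕ} {G : Network (Fin n) (Fin m)} {σ : State}

/-- The memory holds the vitality and the type of `e`: 0 for edges that are not vital, 1 for tight
ones, 2 for loose ones. -/
structure Classified (G : Network (Fin n) (Fin m)) (σ : State) (e : Fin m) : Prop where
  vitality : σ.ra 7 e = G.vitality e
  type : (σ.ia 2 e = 0 ∧ ¬ G.IsVital e) ∨ (σ.ia 2 e = 1 ∧ G.IsTight e) ∨
    (σ.ia 2 e = 2 ∧ G.IsLoose e)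

theorem Classified.congr {σ' : State} {e : Fin m} (h : Classified G σ e)
    (h1 : σ'.ra 7 e = σ.ra 7 e) (h2 : σ'.ia 2 e = σ.ia 2 e) : Classified G σ' e :=
  ⟨h1.trans h.vitality, by rw [h2]; exact h.type⟩

theorem Classified.of_vitality_eq_zero {e : Fin m} (h1 : σ.ra 7 e = 0) (h2 : σ.ia 2 e = 0)
    (h : G.vitality e = 0) : Classified G σ e :=
  ⟨h1.trans h.symm, Or.inl ⟨h2, by rw [Network.isVital_iff, h]; exact lt_irrefl _⟩⟩

/-- The shortcut for unmarked edges. -/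
theorem unmarked_vitality (hst : G.source ≠ G.sink) (h0 : ∀ e, 0 ≤ G.cap e)
    (hc : Candidates G σ) {e : Fin m} (he : σ.ia 2 e ≠ 1) :
    (¬ (¬ G.tail e = G.head e ∧ G.cap e - σ.ra 1 e < σ.ra 1 e) → G.vitality e = 0) ∧
    ((¬ G.tail e = G.head e ∧ G.cap e - σ.ra 1 e < σ.ra 1 e) →
      G.vitality e = max 0 (G.mincutCap + G.cap e - G.sepCap (G.tail e) (G.head e)) ∧
      ∃ f, G.IsMaxFlow f ∧ f e = G.cap e) := by
  obtain ⟨h1, h2⟩ := hc.unmarked e he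
  constructor
  · intro h
    by_cases hl : G.tail e = G.head e
    · exact Network.vitality_eq_zero_of_loop hst (h0 e) hl
    · obtain ⟨f, hf, hfe⟩ := h1 (not_lt.1 fun hlt => h ⟨hl, hlt⟩)
      exact Network.vitality_eq_zero_of_flow_zero hst (h0 e) hf hfe
  · rintro ⟨hl, hlt⟩
    obtain ⟨f, hf, hfe⟩ := h2 hlt.le
    refine ⟨Network.vitality_eq_of_saturated hst (h0 e) hf hfe ?_ fun C hC hs =>
      G.sepCap_le hC hs, f, hf, hfe⟩
    exact G.exists_sepCap_eq hst hl

theorem unmarkedLoop_spec (hst : G.source ≠ G.sink) (h0 : ∀ e, 0 ≤ G.cap e) (hG : Holds G σ)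
    {τ : State} (hc : Candidates G τ) (h1 : σ.ra 1 = τ.ra 1) (h2 : σ.ia 2 = τ.ia 2)
    (hr : σ.rv 0 = G.mincutCap) (hM : ∀ u v : Fin n, u ≠ v → σ.ra 6 (u * n + v) = G.sepCap u v)
    (hrow : ∀ v < n, σ.ia 17 v = v * n) :
    HaltsWith .unmarkedLoop O σ N M 0 (m * 8 + 2) fun σ' =>
      ∀ e : Fin m, τ.ia 2 e ≠ 1 → Classified G σ' e := by
  refine (HaltsWith.forLoop_pure (K := 6) (fun i σ' =>
      (∀ e : Fin m, (e : ℕ) < i → τ.ia 2 e ≠ 1 → Classified G σ' e) ∧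
        ∀ j, i ≤ j → σ'.ia 2 j = τ.ia 2 j)
    (by decide) (by decide) hG.edges (Nat.zero_le _) (by simp [h2]) fun i σ' _ hi ag hx hI =>
    ?_).mono le_rfl le_rfl fun σ' _ h e => h.1 e e.2
  have hG' := hG.frame ag (by decide)
  have ht : σ'.ia 0 i = G.tail ⟨i, hi⟩ := hG'.tail ⟨i, hi⟩
  have hh : σ'.ia 1 i = G.head ⟨i, hi⟩ := hG'.head ⟨i, hi⟩
  have hw : σ'.ra 0 i = G.cap ⟨i, hi⟩ := hG'.cap ⟨i, hi⟩
  have e1 : σ'.ra 1 = τ.ra 1 := (ag.ra 1 (by decide)).trans h1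
  have e6 : σ'.ra 6 = σ.ra 6 := ag.ra 6 (by decide)
  have e0 : σ'.rv 0 = G.mincutCap := (ag.rv 0 (by decide)).trans hr
  have e17 : ∀ v : Fin n, σ'.ia 17 v = v * n := by
    rw [ag.ia 17 (by decide)]
    exact fun v => hrow v v.2
  -- only the entries of the edge `i` change
  have step : ∀ σ'' : State, (∀ j, j ≠ i → σ''.ia 2 j = σ'.ia 2 j) →
      (∀ j, j ≠ i → σ''.ra 7 j = σ'.ra 7 j) → (τ.ia 2 i ≠ 1 → Classified G σ'' ⟨i, hi⟩) →
      (∀ e : Fin m, (e : ℕ) < i + 1 → τ.ia 2 e ≠ 1 → Classified G (σ''.setI 6 (i + 1)) e) ∧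
        ∀ j, i + 1 ≤ j → (σ''.setI 6 (i + 1)).ia 2 j = τ.ia 2 j := by
    intro σ'' a1 a2 a3
    refine ⟨forall_lt_succ hi (fun e he hm => ?_) fun hm => (a3 hm).congr rfl rfl, fun j hj => ?_⟩
    · exact (hI.1 e he hm).congr (a2 e he.ne) (a1 e he.ne)
    · exact (a1 j (by omega)).trans (hI.2 j (by omega))
  refine HaltsWith.ite (K := 5) (fun hb => HaltsWith.straight rfl (by decide) ?_) fun hb =>
    HaltsWith.ite (K := 4) (fun hb' => ?_) fun hb' => HaltsWith.straight rfl (by decide) ?_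
  · simp only [BExpr.eval, IExpr.eval, hx, hI.2 i le_rfl] at hb
    exact step σ' (fun _ _ => rfl) (fun _ _ => rfl) fun h => absurd hb h
  all_goals
    simp only [BExpr.eval, IExpr.eval, RExpr.eval, hx, hI.2 i le_rfl, ht, hh, hw, e1,
      Fin.val_inj] at hb hb'
    obtain ⟨k1, k2⟩ := unmarked_vitality hst h0 hc (e := ⟨i, hi⟩) hb
  · obtain ⟨k3, k4⟩ := k2 hb'
    rw [← hM _ _ hb'.1] at k3
    refine HaltsWith.seq (q₁ := 0) (K₁ := 1) (q₂ := 0) (K₂ := 3) (mid := fun σ'' =>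
      σ'' = σ'.setR 2 (G.mincutCap + G.cap ⟨i, hi⟩
        - σ.ra 6 (G.tail ⟨i, hi⟩ * n + G.head ⟨i, hi⟩)))
      (HaltsWith.straight rfl le_rfl ?_) fun σ'' _ h'' => HaltsWith.ite (K := 2)
      (fun hp => HaltsWith.straight rfl le_rfl ?_) fun hp => HaltsWith.straight rfl le_rfl ?_
    · simp [hx, ht, hh, hw, e0, e17, e6]
    all_goals
      subst h''
      simp only [BExpr.eval, RExpr.eval, State.setR, if_true] at hp
      refine step _ (fun j hj => ?_) (fun j hj => ?_) fun _ => ?_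
      · simp [hx, hj]
      · simp [hx, hj]
    · rw [max_eq_right hp.le] at k3
      refine ⟨by simp [hx, k3], Or.inr (Or.inl ⟨by simp [hx], ?_, k4⟩)⟩
      rwa [Network.isVital_iff, k3]
    · rw [max_eq_left (not_lt.1 hp)] at k3
      exact Classified.of_vitality_eq_zero (by simp [hx]) (by simp [hx]) k3
  · refine step _ (fun j hj => ?_) (fun j hj => ?_) fun _ => ?_
    · simp [hx, hj]
    · simp [hx, hj]
    · exact Classified.of_vitality_eq_zero (by simp [hx]) (by simp [hx]) (k1 hb')

theorem copyLoop_spec (hG : Holds G σ) :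
    HaltsWith .copyLoop O σ N M 0 (m * 5 + 2) fun σ' => ∀ e : Fin m,
      σ'.ia 18 e = G.tail e ∧ σ'.ia 19 e = G.head e ∧ σ'.ra 8 e = G.cap e := by
  refine (HaltsWith.forLoop_pure (K := 3) (fun i σ' => ∀ e : Fin m, (e : ℕ) < i →
      σ'.ia 18 e = G.tail e ∧ σ'.ia 19 e = G.head e ∧ σ'.ra 8 e = G.cap e)
    (by decide) (by decide) hG.edges
    (Nat.zero_le _) (by simp) fun i σ' _ hi ag hx hI => HaltsWith.straight rfl le_rfl ?_).mono
    le_rfl le_rfl fun σ' _ h e => h e e.2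
  have hG' := hG.frame ag (by decide)
  have ht : σ'.ia 0 i = G.tail ⟨i, hi⟩ := hG'.tail ⟨i, hi⟩
  have hh : σ'.ia 1 i = G.head ⟨i, hi⟩ := hG'.head ⟨i, hi⟩
  have hc : σ'.ra 0 i = G.cap ⟨i, hi⟩ := hG'.cap ⟨i, hi⟩
  refine forall_lt_succ hi (fun e he => ?_) (by simp [hx, ht, hh, hc])
  simpa [hx, he.ne] using hI e he

theorem removal_spec (hO : IsMaxFlowSubroutine O) (hN : n ≤ N) (hM : m ≤ M)
    (hst : G.source ≠ G.sink) (h0 : ∀ e, 0 ≤ G.cap e) (hG : Holds G σ) {e : Fin m}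
    (he : σ.iv 8 = e) (hr : σ.rv 0 = G.mincutCap) :
    HaltsWith .removal O σ N M 1 (m * 13 + 12) fun σ' =>
      (∀ g : Fin m, σ'.ra 7 g = if g = e then G.vitality e else σ.ra 7 g) ∧
      ∀ g : Fin m, σ'.ia 18 g = G.tail g ∧ σ'.ia 19 g = G.head g ∧
        σ'.ra 8 g = if g = e then 0 else G.cap g := by
  refine (HaltsWith.seq (q₂ := 0 + (1 + (0 + 0))) (K₂ := 1 + (1 + ((m * 8 + 7) + 1)))
    (copyLoop_spec hG) fun σ₁ ag₁ h₁ =>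
    HaltsWith.seq (mid := fun σ' => ∀ g : Fin m, σ'.ia 18 g = G.tail g ∧ σ'.ia 19 g = G.head g ∧
        σ'.ra 8 g = if g = e then 0 else G.cap g) (HaltsWith.straight rfl le_rfl ?_)
      fun σ₂ ag₂ h₂ =>
    have hG₂ := (hG.frame ag₁ (by decide)).frame ag₂ (by decide)
    HaltsWith.seq (HaltsWith.flow (nV := .var 0) (nE := .var 1) (s := .var 2) (t := .var 3) hO (G.zeroCap e)
      hG₂.vertices hG₂.edges hN hM hG₂.source
      hG₂.sink hst (fun g => (h₂ g).1) (fun g => (h₂ g).2.1) ?_ ?_) fun σ₃ ag₃ h₃ =>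
    HaltsWith.seq (flowValue_spec (hG₂.frame ag₃ (by decide)) (by decide)) fun σ₄ ag₄ h₄ =>
    HaltsWith.straight rfl le_rfl ?_).mono le_rfl (by omega) fun _ _ h => h
  · intro g
    have e8 : σ₁.iv 8 = e := (ag₁.iv 8 (by decide)).trans he
    have := h₁ g
    by_cases hg : g = e
    · subst hg
      simp [e8, this]
    · have hg' : (g : ℕ) ≠ e := fun h => hg (Fin.ext h)
      simp [e8, this, hg, hg']
  · intro g
    simp only [(h₂ g).2.2, Network.zeroCap, Function.update_apply]
  · intro g
    simp only [Network.zeroCap, Function.update_apply]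
    split_ifs
    exacts [le_rfl, h0 g]
  · have e8 : σ₄.iv 8 = e := (ag₄.iv 8 (by decide)).trans ((ag₃.iv 8 (by decide)).trans
      ((ag₂.iv 8 (by decide)).trans ((ag₁.iv 8 (by decide)).trans he)))
    have e0 : σ₄.rv 0 = G.mincutCap := (ag₄.rv 0 (by decide)).trans ((ag₃.rv 0 (by decide)).trans
      ((ag₂.rv 0 (by decide)).trans ((ag₁.rv 0 (by decide)).trans hr)))
    have e7 : σ₄.ra 7 = σ.ra 7 := (ag₄.ra 7 (by decide)).trans ((ag₃.ra 7 (by decide)).trans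
      ((ag₂.ra 7 (by decide)).trans (ag₁.ra 7 (by decide))))
    have hv := Network.vitality_eq_of_zeroCap hst h₃
    change _ = _ - G.value _ at hv
    refine ⟨fun g => ?_, fun g => ?_⟩
    · by_cases hg : g = e
      · subst hg
        simp [e8, e0, h₄, hv]
      · have hg' : (g : ℕ) ≠ e := fun h => hg (Fin.ext h)
        simp [e8, hg, hg', e7]
    · simp only [Prog.run, State.putR]
      rw [ag₄.ia 18 (by decide), ag₃.ia 18 (by decide), ag₄.ia 19 (by decide),
        ag₃.ia 19 (by decide), ag₄.ra 8 (by decide), ag₃.ra 8 (by decide)]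
      simpa using h₂ g

theorem forcedFlow_spec (hO : IsMaxFlowSubroutine O) (hN : n + 2 ≤ N) (hM : m + 4 ≤ M)
    (h0 : ∀ e, 0 ≤ G.cap e) (hG : Holds G σ) {e : Fin m}
    (he : σ.iv 8 = e) (hr : 0 ≤ σ.rv 0)
    (h : ∀ g : Fin m, σ.ia 18 g = G.tail g ∧ σ.ia 19 g = G.head g ∧
        σ.ra 8 g = if g = e then 0 else G.cap g) :
    HaltsWith .forcedFlow O σ N M 1 13 fun σ' =>
      (G.forceNet e (σ.rv 0)).IsMaxFlow fun g => σ'.ra 4 g := by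
  have ht := hG.tail e
  have hh := hG.head e
  have hc := hG.cap e
  have key : ∀ g : Fin (m + 4), (Prog.newEdges.run σ).ia 18 g = (G.forceNet e (σ.rv 0)).tail g ∧
      (Prog.newEdges.run σ).ia 19 g = (G.forceNet e (σ.rv 0)).head g ∧
      (Prog.newEdges.run σ).ra 8 g = (G.forceNet e (σ.rv 0)).cap g := by
    intro g
    refine Fin.addCases (fun g => ?_) (fun i => ?_) g
    · obtain ⟨h1, h2, h3⟩ := G.forceNet_old e (σ.rv 0) g
      have hg : ∀ i, (g : ℕ) ≠ m + i := by omega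
      have hg0 : (g : ℕ) ≠ m := by omega
      rw [h1, h2, h3]
      simpa [Prog.newEdges, hG.edges, hg, hg0] using h g
    · rw [G.forceNet_tail_new, G.forceNet_head_new, G.forceNet_cap_new]
      fin_cases i <;> simp [Prog.newEdges, hG.edges, hG.vertices, hG.source, hG.sink, he, ht, hh, hc]
  refine (HaltsWith.seq (q₁ := 0) (K₁ := 12) (q₂ := 1) (K₂ := 1)
    (mid := fun τ => τ = Prog.newEdges.run σ)
    (HaltsWith.straight rfl le_rfl rfl) fun τ ag hτ => ?_).mono le_rfl le_rfl fun _ _ h => h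
  have hGτ := hG.frame ag (by decide)
  refine HaltsWith.flow hO (G.forceNet e (σ.rv 0)) (by simp [hGτ.vertices]) (by simp [hGτ.edges])
    hN hM (by simp [hGτ.vertices, Network.forceNet]) (by simp [hGτ.vertices, Network.forceNet])
    ?_ (fun g => by rw [hτ]; exact (key g).1) (fun g => by rw [hτ]; exact (key g).2.1)
    (fun g => by rw [hτ]; exact (key g).2.2) (Network.forceNet_cap_nonneg h0 e hr)
  intro hc
  have := congrArg Fin.val hc
  simp [Network.forceNet] at this

theorem listedLoop_spec (hO : IsMaxFlowSubroutine O) (hN : n + 2 ≤ N) (hM : m + 4 ≤ M)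
    (hst : G.source ≠ G.sink) (h0 : ∀ e, 0 ≤ G.cap e) (hG : Holds G σ)
    {τ : State} (hc : Candidates G τ) (h5 : σ.ia 5 = τ.ia 5) (hr : σ.rv 0 = G.mincutCap)
    (h : ∀ e : Fin m, τ.ia 2 e ≠ 1 → Classified G σ e) :
    HaltsWith .listedLoop O σ N M (n * 2) (n * (m * 13 + 32) + 2) fun σ' =>
      ∀ e : Fin m, Classified G σ' e := by
  refine (HaltsWith.forLoop (q := 2) (K := m * 13 + 30) (fun i σ' =>
      ∀ e : Fin m, (τ.ia 2 e ≠ 1 ∨ ∃ j < i, τ.ia 5 j = e) → Classified G σ' e)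
    (by decide) (by decide) hG.vertices (Nat.zero_le _) ?_ fun i σ' _ hi ag hx hI => ?_).mono
    le_rfl le_rfl fun σ' _ h e => h e ?_
  · intro e he
    simp only [Nat.not_lt_zero, false_and, exists_false, or_false] at he
    exact (h e he).congr rfl rfl
  · have hG' := hG.frame ag (by decide)
    have e5 : σ'.ia 5 = τ.ia 5 := (ag.ia 5 (by decide)).trans h5
    have e0 : σ'.rv 0 = G.mincutCap := (ag.rv 0 (by decide)).trans hr
    refine (HaltsWith.seq (q₁ := 0) (K₁ := 1) (q₂ := 2) (K₂ := m * 13 + 29)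
      (mid := fun σ₁ => σ₁.iv 8 = τ.ia 5 i)
      (HaltsWith.straight rfl le_rfl (by simp [hx, e5])) fun σ₁ ag₁ h₁ =>
      HaltsWith.ite (K := m * 13 + 28) (fun hb => ?_) fun hb =>
        HaltsWith.straight rfl (show 1 ≤ _ by omega) ?_).mono le_rfl (by omega) fun _ _ h => h
    all_goals
      have hG₁ := hG'.frame ag₁ (by decide)
      have a2 : σ₁.ia 2 = σ'.ia 2 := ag₁.ia 2 (by decide)
      have a7 : σ₁.ra 7 = σ'.ra 7 := ag₁.ra 7 (by decide)
      simp only [BExpr.eval, IExpr.eval, hG₁.edges, h₁] at hb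
    · obtain ⟨e, he⟩ : ∃ e : Fin m, τ.ia 5 i = e := ⟨⟨_, hb⟩, rfl⟩
      rw [he] at h₁
      have r1 : σ₁.rv 0 = G.mincutCap := (ag₁.rv 0 (by decide)).trans e0
      refine (HaltsWith.seq (K₂ := 13 + 3) (q₂ := 1 + 0)
        (removal_spec hO (by omega) (by omega) hst h0 hG₁ h₁ r1) fun σ₂ ag₂ h₂ =>
        have hG₂ := hG₁.frame ag₂ (by decide)
        have r2 : σ₂.rv 0 = G.mincutCap := (ag₂.rv 0 (by decide)).trans r1
        have e8 : σ₂.iv 8 = e := (ag₂.iv 8 (by decide)).trans h₁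
        HaltsWith.seq (forcedFlow_spec hO hN hM h0 hG₂ e8 ?_ h₂.2) fun σ₃ ag₃ h₃ => ?_).mono
        le_rfl (by omega) fun _ _ h => h
      · rw [r2, hc.flow.mincutCap_eq hst]
        exact hc.flow.value_nonneg h0
      have hG₃ := hG₂.frame ag₃ (by decide)
      have r3 : σ₃.rv 0 = G.mincutCap := (ag₃.rv 0 (by decide)).trans r2
      have f8 : σ₃.iv 8 = e := (ag₃.iv 8 (by decide)).trans e8
      have hw : σ₃.ra 0 e = G.cap e := hG₃.cap e
      have hv : ∀ g : Fin m, σ₃.ra 7 g = if g = e then G.vitality e else σ'.ra 7 g := by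
        rw [ag₃.ra 7 (by decide), ← a7]
        exact h₂.1
      have hv' := hv e
      rw [if_pos rfl] at hv'
      have f2 : σ₃.ia 2 = σ'.ia 2 :=
        (ag₃.ia 2 (by decide)).trans ((ag₂.ia 2 (by decide)).trans a2)
      -- only the entries of `e` change
      have step : ∀ σ'' : State, σ''.ra 7 = σ₃.ra 7 →
          (∀ g : Fin m, g ≠ e → σ''.ia 2 g = σ₃.ia 2 g) → Classified G σ'' e →
          ∀ g : Fin m, (τ.ia 2 g ≠ 1 ∨ ∃ j < i + 1, τ.ia 5 j = g) →
            Classified G (σ''.setI 7 (i + 1)) g := by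
        intro σ'' k1 k2 k3 g hg
        by_cases hge : g = e
        · subst hge
          exact k3.congr rfl rfl
        · refine (hI g (hg.imp id ?_)).congr ?_ ?_
          · rintro ⟨j, hj, hjg⟩
            refine ⟨j, lt_of_le_of_ne (Nat.lt_succ_iff.1 hj) ?_, hjg⟩
            rintro rfl
            exact hge (Fin.ext (hjg.symm.trans he))
          · change σ''.ra 7 g = _
            rw [k1, hv, if_neg hge]
          · exact (k2 g hge).trans (by rw [f2])
      have htest := Network.exists_saturating_iff hst h0 hc.flow e
        (h := fun g => σ₃.ra 4 g) (by rw [← hc.flow.mincutCap_eq hst, ← r2]; exact h₃)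
      rw [← hc.flow.mincutCap_eq hst] at htest
      simp only [Fin.val_natAdd, Fin.val_zero, Fin.val_one, Nat.add_zero] at htest
      refine HaltsWith.ite (K := 2) (fun hp => HaltsWith.ite (K := 1)
        (fun hq => HaltsWith.straight rfl le_rfl ?_)
        fun hq => HaltsWith.straight rfl le_rfl ?_) fun hp => HaltsWith.straight rfl (by decide) ?_
      all_goals
        simp only [BExpr.eval, IExpr.eval, RExpr.eval, f8, hv', ← Network.isVital_iff] at hp
        refine step _ rfl (fun g hg => ?_) ⟨hv', ?_⟩
        · have : (g : ℕ) ≠ e := fun h => hg (Fin.ext h)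
          simp [f8, this]
      · simp only [BExpr.eval, IExpr.eval, RExpr.eval, f8, hG₃.edges, r3, hw] at hq
        exact Or.inr (Or.inl ⟨by simp [f8], hp, htest.2 hq⟩)
      · simp only [BExpr.eval, IExpr.eval, RExpr.eval, f8, hG₃.edges, r3, hw] at hq
        exact Or.inr (Or.inr ⟨by simp [f8], hp, fun h => hq (htest.1 h)⟩)
      · exact Or.inl ⟨by simp [f8], hp⟩
    · intro g hg
      refine (hI g (hg.imp id ?_)).congr (by simp [a7]) (by simp [a2])
      rintro ⟨j, hj, hjg⟩
      refine ⟨j, lt_of_le_of_ne (Nat.lt_succ_iff.1 hj) ?_, hjg⟩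
      rintro rfl
      exact hb (hjg ▸ g.2)
  · by_cases he : τ.ia 2 e = 1
    · exact Or.inr ((hc.listed e).1 he)
    · exact Or.inl he

theorem classify_spec (hO : IsMaxFlowSubroutine O) (hN : n + 2 ≤ N) (hM : m + 4 ≤ M)
    (hst : G.source ≠ G.sink) (h0 : ∀ e, 0 ≤ G.cap e) (hG : Holds G σ) :
    HaltsWith .classify O σ N M (5 * n) (400 * (n * (n + m))) fun σ' =>
      ∀ e : Fin m, Classified G σ' e := by
  have hn : 0 < n := G.source.pos
  refine (HaltsWith.seq (q₂ := 0 + (0 + (n * 2 + (0 + n * 2)))) (K₂ := (m * 8 + 7) +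
      ((n * 3 + m * 14 + 7) + ((n * 5 + 3 + (n * (90 * (n + m) + 132 + 2) + 2)) +
        ((m * 8 + 2) + (n * (m * 13 + 32) + 2)))))
    (candidates_spec hO (by omega) (by omega) hst h0 hG) fun σ₁ ag₁ h₁ =>
    have hG₁ := hG.frame ag₁ (by decide)
    HaltsWith.seq (flowValue_spec hG₁ (by decide)) fun σ₂ ag₂ h₂ =>
    have hG₂ := hG₁.frame ag₂ (by decide)
    HaltsWith.seq (arcs_spec hG₂) fun σ₃ ag₃ h₃ =>
    have hG₃ := hG₂.frame ag₃ (by decide)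
    HaltsWith.seq (allPairs_spec hO (by omega) (by omega) hst h0 hG₃ h₃) fun σ₄ ag₄ h₄ =>
    have hG₄ := hG₃.frame ag₄ (by decide)
    have hr : σ₄.rv 0 = G.mincutCap := by
      rw [ag₄.rv 0 (by decide), ag₃.rv 0 (by decide), h₂, h₁.flow.mincutCap_eq hst]
    HaltsWith.seq (unmarkedLoop_spec hst h0 hG₄ h₁
      (by rw [ag₄.ra 1 (by decide), ag₃.ra 1 (by decide), ag₂.ra 1 (by decide)])
      (by rw [ag₄.ia 2 (by decide), ag₃.ia 2 (by decide), ag₂.ia 2 (by decide)])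
      hr h₄.1 h₄.2) fun σ₅ ag₅ h₅ =>
    have hG₅ := hG₄.frame ag₅ (by decide)
    listedLoop_spec hO hN hM hst h0 hG₅ h₁
      (by rw [ag₅.ia 5 (by decide), ag₄.ia 5 (by decide), ag₃.ia 5 (by decide),
        ag₂.ia 5 (by decide)])
      ((ag₅.rv 0 (by decide)).trans hr) h₅).mono (by omega) ?_ fun _ _ h => h
  nlinarith [Nat.mul_le_mul hn hn, Nat.mul_le_mul hn (Nat.zero_le m), Nat.mul_le_mul_right m hn,
    Nat.mul_le_mul_right n hn]

end

/-! ### Tournaments -/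

/-- Winner trees: the node `i` has the children `2 * i` and `2 * i + 1`, the leaf of the player `e`
is `m + e`, and `win i` is the player of greatest key below the node `i`. This is required except at
the inner nodes in `S`. -/
structure Tournament (m : ℕ) (key : ℕ → ℝ) (win : ℕ → ℕ) (S : ℕ → Prop) : Prop where
  leaf : ∀ i, m ≤ i → i < 2 * m → win i = i - m
  node : ∀ i, 1 ≤ i → i < m → ¬ S i →
    (key (win (2 * i)) < key (win (2 * i + 1)) → win i = win (2 * i + 1)) ∧
      (¬ key (win (2 * i)) < key (win (2 * i + 1)) → win i = win (2 * i))

/-- `i` lies on the way from `p` to the root, `p` excluded. -/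
def Above (p i : ℕ) : Prop := ∃ j, p / 2 ^ (j + 1) = i

theorem above_iff {p i : ℕ} : Above p i ↔ i = p / 2 ∨ Above (p / 2) i := by
  have h : ∀ j, p / 2 / 2 ^ j = p / 2 ^ (j + 1) := fun j => by
    rw [Nat.div_div_eq_div_mul, pow_succ']
  constructor
  · rintro ⟨j, rfl⟩
    cases j with
    | zero => simp
    | succ j => exact Or.inr ⟨j, h (j + 1)⟩
  · rintro (rfl | ⟨j, rfl⟩)
    · exact ⟨0, by simp⟩
    · exact ⟨j + 1, (h (j + 1)).symm⟩

namespace Tournament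

variable {m : ℕ} {key : ℕ → ℝ} {win win' : ℕ → ℕ} {S S' : ℕ → Prop}

theorem win_lt (h : Tournament m key win fun _ => False) {i : ℕ} (h1 : 1 ≤ i) (h2 : i < 2 * m) :
    win i < m := by
  induction hd : 2 * m - i using Nat.strong_induction_on generalizing i with
  | _ d ih =>
    by_cases hi : m ≤ i
    · rw [h.leaf i hi h2]; omega
    · have hn := h.node i h1 (by omega) id
      by_cases hk : key (win (2 * i)) < key (win (2 * i + 1))
      · rw [hn.1 hk]; exact ih _ (by omega) (by omega) (by omega) rfl
      · rw [hn.2 hk]; exact ih _ (by omega) (by omega) (by omega) rfl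

theorem key_le_root (h : Tournament m key win fun _ => False) {i : ℕ} (h1 : 1 ≤ i)
    (h2 : i < 2 * m) : key (win i) ≤ key (win 1) := by
  induction i using Nat.strong_induction_on with
  | _ i ih =>
    by_cases hi : i = 1
    · rw [hi]
    · refine le_trans ?_ (ih (i / 2) (by omega) (by omega) (by omega))
      have hn := h.node (i / 2) (by omega) (by omega) id
      have h2 : i = 2 * (i / 2) ∨ i = 2 * (i / 2) + 1 := by omega
      by_cases hk : key (win (2 * (i / 2))) < key (win (2 * (i / 2) + 1))
      · rw [hn.1 hk]
        rcases h2 with h2 | h2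
        · rw [congrArg win h2]; exact hk.le
        · rw [congrArg win h2]
      · rw [hn.2 hk]
        rcases h2 with h2 | h2
        · rw [congrArg win h2]
        · rw [congrArg win h2]; exact not_lt.1 hk

theorem key_le (h : Tournament m key win fun _ => False) {e : ℕ} (he : e < m) :
    key e ≤ key (win 1) := by
  have := h.key_le_root (i := m + e) (by omega) (by omega)
  rwa [h.leaf (m + e) (by omega) (by omega), Nat.add_sub_cancel_left] at this

theorem eq_or_above_of_win (h : Tournament m key win fun _ => False) {i : ℕ} (h1 : 1 ≤ i)
    (h2 : i < 2 * m) : i = m + win i ∨ Above (m + win i) i := by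
  induction hd : 2 * m - i using Nat.strong_induction_on generalizing i with
  | _ d ih =>
    by_cases hi : m ≤ i
    · left; rw [h.leaf i hi h2]; omega
    · right
      have hn := h.node i h1 (by omega) id
      have up : ∀ j p, (j = p ∨ Above p j) → i = j / 2 → Above p i := by
        rintro j p (rfl | ⟨k, rfl⟩) rfl
        · exact ⟨0, by simp⟩
        · exact ⟨k + 1, by rw [Nat.div_div_eq_div_mul, ← pow_succ]⟩
      by_cases hk : key (win (2 * i)) < key (win (2 * i + 1))
      · rw [hn.1 hk]
        exact up _ _ (ih _ (by omega) (by omega) (by omega) rfl) (by omega)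
      · rw [hn.2 hk]
        exact up _ _ (ih _ (by omega) (by omega) (by omega) rfl) (by omega)

/-- A new key of `e` can spoil only the nodes above the leaf of `e`. -/
theorem change_key (h : Tournament m key win fun _ => False) {e : ℕ} {key' : ℕ → ℝ}
    (hk : ∀ x, x ≠ e → key' x = key x) : Tournament m key' win (Above (m + e)) := by
  refine ⟨h.leaf, fun i h1 h2 hS => ?_⟩
  have hne : ∀ j, 1 ≤ j → j < 2 * m → j / 2 = i → win j ≠ e := by
    rintro j h3 h4 rfl rfl
    rcases h.eq_or_above_of_win h3 h4 with h5 | ⟨k, hk⟩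
    · exact hS (above_iff.2 (Or.inl (by rw [← h5])))
    · exact hS ⟨k + 1, by rw [pow_succ, ← Nat.div_div_eq_div_mul, hk]⟩
  rw [hk _ (hne (2 * i) (by omega) (by omega) (by omega)),
    hk _ (hne (2 * i + 1) (by omega) (by omega) (by omega))]
  exact h.node i h1 h2 id

/-- The match at the node `q` is played again. -/
theorem step (h : Tournament m key win S) {q : ℕ} (h1 : 1 ≤ q) (h2 : q < m)
    (hq : win' q = if key (win (2 * q)) < key (win (2 * q + 1)) then win (2 * q + 1)
      else win (2 * q)) (hne : ∀ i, i ≠ q → win' i = win i)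
    (h3 : ∀ i, ¬ S' i → i ≠ q → ¬ S i) (h4 : ∀ i, 1 ≤ i → ¬ S' i → 2 * i ≠ q ∧ 2 * i + 1 ≠ q) :
    Tournament m key win' S' := by
  refine ⟨fun i hi hi' => ?_, fun i hi hi' hS => ?_⟩
  · rw [hne i (by omega), h.leaf i hi hi']
  · rw [hne _ (h4 i hi hS).1, hne _ (h4 i hi hS).2]
    by_cases hiq : i = q
    · subst hiq
      rw [hq]
      split_ifs with hk
      · exact ⟨fun _ => rfl, fun h => absurd hk h⟩
      · exact ⟨fun h => absurd h hk, fun _ => rfl⟩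
    · rw [hne i hiq]
      exact h.node i hi hi' (h3 i hS hiq)

end Tournament

/-! ### The program for the `k`-th most vital edge -/

namespace Prog

/-- The leaves of the tournament are filled; the winners stand in the integer array 20. -/
def leafLoop : Prog := .forLoop 6 0 1 (.iput 20 (.plus (.var 1) (.var 6)) (.var 6))

/-- The halves of the numbers below `2 * m` are written to the integer array 21. -/
def halfLoop : Prog :=
  .forLoop 6 1 1 (.iput 21 (.plus (.var 6) (.var 6)) (.var 6) ;;
    .iput 21 (.plus (.plus (.var 6) (.var 6)) (.const 1)) (.var 6))

/-- The match at the node in the variable 8, with the keys in the real array 7. -/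
def playMatch : Prog :=
  .ite (.rlt (.get 7 (.get 20 (.plus (.var 8) (.var 8))))
      (.get 7 (.get 20 (.plus (.plus (.var 8) (.var 8)) (.const 1)))))
    (.iput 20 (.var 8) (.get 20 (.plus (.plus (.var 8) (.var 8)) (.const 1))))
    (.iput 20 (.var 8) (.get 20 (.plus (.var 8) (.var 8))))

/-- All matches are played, from the leaves to the root. -/
def matchLoop : Prog := .forLoop 6 1 1 (.iset 8 (.minus (.var 1) (.var 6)) ;; playMatch)

/-- The player in the variable 5 gets a negative key, and the matches on the way to the root are
played again. As vitalities are nonnegative, a player that has been dropped cannot beat one that is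
still present. -/
def dropWinner : Prog :=
  (.rput 7 (.var 5) (.minus .zero (.get 0 (.var 5))) ;; .iset 8 (.plus (.var 1) (.var 5))) ;;
    .loop (.ilt (.const 1) (.var 8)) (.iset 8 (.get 21 (.var 8)) ;; playMatch)

/-- The variable 5 gets the player whose key in the real array 7 has the rank given by the
variable 4. -/
def selection : Prog :=
  leafLoop ;; halfLoop ;; matchLoop ;; .iset 5 (.get 20 (.const 1)) ;;
    .forLoop 7 1 4 (dropWinner ;; .iset 5 (.get 20 (.const 1)))

end Prog

section

variable {O : Subroutine} {N M n m : ℕ} {G : Network (Fin n) (Fin m)} {σ : State}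

theorem leafLoop_spec (h1 : σ.iv 1 = m) :
    HaltsWith .leafLoop O σ N M 0 (m * 3 + 2) fun σ' => ∀ i < m, σ'.ia 20 (m + i) = i := by
  refine HaltsWith.forLoop_pure (K := 1) (fun i σ' => ∀ j < i, σ'.ia 20 (m + j) = j)
    (by decide) (by decide) h1 (Nat.zero_le _) (by simp) fun i σ' _ hi ag hx hI =>
    HaltsWith.straight rfl le_rfl fun j hj => ?_
  have e1 : σ'.iv 1 = m := (ag.iv 1 (by decide)).trans h1
  rcases Nat.lt_succ_iff_lt_or_eq.1 hj with hj' | rfl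
  · simpa [hx, e1, hj'.ne] using hI j hj'
  · simp [hx, e1]

theorem halfLoop_spec (h1 : σ.iv 1 = m) (hm : 1 ≤ m) :
    HaltsWith .halfLoop O σ N M 0 (m * 4 + 2) fun σ' =>
      ∀ j, 2 ≤ j → j < 2 * m → σ'.ia 21 j = j / 2 := by
  refine HaltsWith.forLoop_pure (K := 2) (fun i σ' => ∀ j, 2 ≤ j → j < 2 * i → σ'.ia 21 j = j / 2)
    (by decide) (by decide) h1 hm (fun j h2 h3 => by omega) fun i σ' _ hi ag hx hI =>
    HaltsWith.straight rfl le_rfl fun j h2 hj => ?_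
  simp only [Prog.run, State.putI, State.setI, IExpr.eval, hx, true_and]
  split_ifs with h3 h4
  · omega
  · omega
  · exact hI j h2 (by omega)

theorem playMatch_spec :
    HaltsWith .playMatch O σ N M 0 2 fun σ' =>
      σ'.ia 20 (σ.iv 8) = (if σ.ra 7 (σ.ia 20 (2 * σ.iv 8)) < σ.ra 7 (σ.ia 20 (2 * σ.iv 8 + 1))
        then σ.ia 20 (2 * σ.iv 8 + 1) else σ.ia 20 (2 * σ.iv 8)) ∧
      ∀ i, i ≠ σ.iv 8 → σ'.ia 20 i = σ.ia 20 i := by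
  refine HaltsWith.ite (K := 1) (fun h => HaltsWith.straight rfl le_rfl ?_)
    fun h => HaltsWith.straight rfl le_rfl ?_ <;>
  · simp only [BExpr.eval, RExpr.eval, IExpr.eval, ← two_mul] at h
    refine ⟨?_, fun i hi => ?_⟩
    · simp [h, ← two_mul]
    · simp [hi]

theorem matchLoop_spec (h1 : σ.iv 1 = m) (hm : 1 ≤ m) (h : ∀ i < m, σ.ia 20 (m + i) = i) :
    HaltsWith .matchLoop O σ N M 0 (m * 5 + 2) fun σ' =>
      Tournament m (σ.ra 7) (σ'.ia 20) fun _ => False := by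
  refine (HaltsWith.forLoop_pure (K := 3) (fun i σ' =>
    Tournament m (σ.ra 7) (σ'.ia 20) fun j => j < m + 1 - i)
    (by decide) (by decide) h1 hm ?_ fun i σ' h1i hi ag hx hI => ?_).mono le_rfl le_rfl
    fun σ' _ h => ⟨h.leaf, fun i k1 k2 _ => h.node i k1 k2 (by omega)⟩
  · refine ⟨fun i k1 k2 => ?_, fun i k1 k2 k3 => absurd k2 (by omega)⟩
    have := h (i - m) (by omega)
    rwa [Nat.add_sub_cancel' k1] at this
  · have e1 : σ'.iv 1 = m := (ag.iv 1 (by decide)).trans h1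
    refine HaltsWith.seq (q₁ := 0) (K₁ := 1) (q₂ := 0) (K₂ := 2)
      (mid := fun σ'' => σ''.iv 8 = m - i) (HaltsWith.straight rfl le_rfl (by simp [e1, hx]))
      fun σ₁ ag₁ h₁ => playMatch_spec.mono le_rfl le_rfl fun σ₂ ag₂ h₂ => ?_
    rw [h₁, ag₁.ia 20 (by decide), ag₁.ra 7 (by decide), ag.ra 7 (by decide)] at h₂
    exact hI.step (q := m - i) (by omega) (by omega) h₂.1 h₂.2 (fun j _ _ => by omega)
      fun j _ _ => by omega

theorem dropWinner_spec (h1 : σ.iv 1 = m) {e : ℕ} (h5 : σ.iv 5 = e) (he : e < m)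
    (hhalf : ∀ j, 2 ≤ j → j < 2 * m → σ.ia 21 j = j / 2)
    (h : Tournament m (σ.ra 7) (σ.ia 20) fun _ => False) :
    HaltsWith .dropWinner O σ N M 0 (2 + ((Nat.log 2 m + 1) * (3 + 1) + 1)) fun σ' =>
      Tournament m (σ'.ra 7) (σ'.ia 20) (fun _ => False) ∧ σ'.ra 7 e = - σ.ra 0 e ∧
        ∀ x, x ≠ e → σ'.ra 7 x = σ.ra 7 x := by
  refine (HaltsWith.seq (q₁ := 0) (K₁ := 2) (q₂ := 0)
    (K₂ := (Nat.log 2 m + 1) * (3 + 1) + 1) (mid := fun σ' => σ'.iv 8 = m + e ∧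
      σ'.ra 7 e = - σ.ra 0 e ∧ ∀ x, x ≠ e → σ'.ra 7 x = σ.ra 7 x)
    (HaltsWith.straight rfl le_rfl ⟨by simp [h1, h5], by simp [h5], fun x hx => by simp [h5, hx]⟩)
    fun σ₁ ag₁ h₁ => ?_).mono le_rfl le_rfl fun _ _ h => h
  refine (HaltsWith.loop (K := 3) (fun σ' => Tournament m (σ₁.ra 7) (σ'.ia 20) (Above (σ'.iv 8)) ∧
    1 ≤ σ'.iv 8 ∧ σ'.iv 8 < 2 * m) (fun σ' => Nat.log 2 (σ'.iv 8))
    ⟨?_, by omega, by omega⟩ fun σ₂ ag₂ h₂ hb => ?_).mono le_rfl ?_ fun σ₃ ag₃ h₃ => ?_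
  · rw [h₁.1, ag₁.ia 20 (by decide)]
    exact h.change_key h₁.2.2
  · simp only [BExpr.eval, IExpr.eval] at hb
    obtain ⟨hT, k1, k2⟩ := h₂
    have e21 : σ₂.ia 21 (σ₂.iv 8) = σ₂.iv 8 / 2 := by
      rw [ag₂.ia 21 (by decide), ag₁.ia 21 (by decide)]
      exact hhalf _ hb k2
    refine HaltsWith.seq (q₁ := 0) (K₁ := 1) (q₂ := 0) (K₂ := 2)
      (mid := fun τ => τ.iv 8 = σ₂.iv 8 / 2) (HaltsWith.straight rfl le_rfl (by simp [e21]))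
      fun τ agτ hτ => playMatch_spec.mono le_rfl le_rfl fun τ' agτ' hτ' => ?_
    rw [hτ, agτ.ia 20 (by decide), agτ.ra 7 (by decide), ag₂.ra 7 (by decide)] at hτ'
    rw [agτ'.iv 8 (by decide), hτ]
    refine ⟨⟨hT.step (by omega) (by omega) hτ'.1 hτ'.2 (fun i k3 k4 k5 => ?_)
      fun i _ k3 => ?_, by omega, by omega⟩, ?_⟩
    · exact (above_iff.1 k5).elim k4 k3
    · constructor <;> intro k4 <;> exact k3 (above_iff.2 (Or.inl (by omega)))
    · rw [Nat.log_div_base]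
      have := Nat.log_pos (b := 2) (by norm_num) hb
      omega
  · rw [h₁.1]
    gcongr
    refine (Nat.log_mono_right (show m + e ≤ m * 2 by omega)).trans_eq ?_
    exact Nat.log_mul_base (by norm_num) (by omega)
  · obtain ⟨⟨hT, k1, k2⟩, k3⟩ := h₃
    simp only [BExpr.eval, IExpr.eval] at k3
    have k4 : σ₃.iv 8 = 1 := by omega
    rw [ag₃.ra 7 (by decide)]
    refine ⟨⟨hT.leaf, fun i k5 k6 _ => hT.node i k5 k6 ?_⟩, h₁.2⟩
    rw [k4]
    rintro ⟨j, hj⟩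
    rw [Nat.div_eq_of_lt (Nat.one_lt_two_pow (by omega))] at hj
    omega

/-- The tournament after the removal of the edges in `X`. -/
structure Selected (G : Network (Fin n) (Fin m)) (X : Finset (Fin m)) (σ : State) : Prop where
  tournament : Tournament m (σ.ra 7) (σ.ia 20) fun _ => False
  winner : σ.iv 5 = σ.ia 20 1
  removed : ∀ e ∈ X, σ.ra 7 e < 0
  present : ∀ e ∉ X, σ.ra 7 e = G.vitality e
  top : ∀ x ∈ X, ∀ y ∉ X, G.vitality y ≤ G.vitality x

theorem Selected.exists_winner (hst : G.source ≠ G.sink) (h0 : ∀ e, 0 ≤ G.cap e)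
    {X : Finset (Fin m)} (h : Selected G X σ) (hX : X.card < m) :
    ∃ e ∉ X, σ.iv 5 = e ∧ ∀ y ∉ X, G.vitality y ≤ G.vitality e := by
  have hlt := h.tournament.win_lt (i := 1) le_rfl (by omega)
  obtain ⟨e, he⟩ : ∃ e : Fin m, σ.ia 20 1 = e := ⟨⟨_, hlt⟩, rfl⟩
  have hmax : ∀ y ∉ X, G.vitality y ≤ σ.ra 7 e := fun y hy => by
    rw [← h.present y hy, ← he]
    exact h.tournament.key_le y.2
  have heX : e ∉ X := by
    obtain ⟨y, hy⟩ : ∃ y, y ∉ X := by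
      by_contra! hall
      rw [Finset.eq_univ_of_forall hall, Finset.card_fin] at hX
      exact lt_irrefl _ hX
    intro he'
    exact absurd ((Network.vitality_nonneg hst (h0 y)).trans (hmax y hy))
      (not_le.2 (h.removed e he'))
  refine ⟨e, heX, h.winner.trans he, fun y hy => ?_⟩
  rw [← h.present e heX]
  exact hmax y hy

theorem selection_spec (hst : G.source ≠ G.sink) (h0 : ∀ e, 0 < G.cap e) (hG : Holds G σ) {k : ℕ}
    (hk1 : 1 ≤ k) (hkm : k ≤ m) (hk : σ.iv 4 = k) (hv : ∀ e : Fin m, σ.ra 7 e = G.vitality e) :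
    HaltsWith .selection O σ N M 0 (40 * (m * (Nat.log 2 m + 1))) fun σ' =>
      ∃ e : Fin m, σ'.iv 5 = e ∧ G.IsKthMostVital k e := by
  have hm : 1 ≤ m := hk1.trans hkm
  refine (HaltsWith.seq (q₂ := 0 + (0 + (0 + 0))) (K₂ := (m * 4 + 2) + ((m * 5 + 2) +
    (1 + (k * ((2 + ((Nat.log 2 m + 1) * (3 + 1) + 1) + 1) + 2) + 2))))
    (leafLoop_spec hG.edges) fun σ₁ ag₁ h₁ =>
    have hG₁ := hG.frame ag₁ (by decide)
    HaltsWith.seq (halfLoop_spec hG₁.edges hm) fun σ₂ ag₂ h₂ =>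
    have hG₂ := hG₁.frame ag₂ (by decide)
    HaltsWith.seq (matchLoop_spec hG₂.edges hm (by rw [ag₂.ia 20 (by decide)]; exact h₁))
      fun σ₃ ag₃ h₃ =>
    have hG₃ := hG₂.frame ag₃ (by decide)
    HaltsWith.seq (mid := fun σ' => σ'.iv 5 = σ₃.ia 20 1) (HaltsWith.straight rfl le_rfl (by simp))
      fun σ₄ ag₄ h₄ =>
    have hG₄ := hG₃.frame ag₄ (by decide)
    (HaltsWith.forLoop_pure (fun i σ' => ∃ X, X.card + 1 = i ∧ Selected G X σ') (by decide)
      (by decide) ?_ hk1 ?_ fun i σ' hi1 hi ag hx hI => ?_).mono le_rfl le_rfl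
      fun σ₅ ag₅ h₅ => ?_).mono le_rfl ?_ fun _ _ h => h
  · rw [ag₄.iv 4 (by decide), ag₃.iv 4 (by decide), ag₂.iv 4 (by decide), ag₁.iv 4 (by decide)]
    exact hk
  · refine ⟨∅, rfl, ?_, ?_, by simp, fun e _ => ?_, by simp⟩
    · change Tournament m (σ₄.ra 7) (σ₄.ia 20) _
      rw [ag₄.ra 7 (by decide), ag₄.ia 20 (by decide), ag₃.ra 7 (by decide)]
      exact h₃
    · change σ₄.iv 5 = σ₄.ia 20 1
      rw [h₄, ag₄.ia 20 (by decide)]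
    · change σ₄.ra 7 e = _
      rw [ag₄.ra 7 (by decide), ag₃.ra 7 (by decide), ag₂.ra 7 (by decide), ag₁.ra 7 (by decide)]
      exact hv e
  · obtain ⟨X, hX, hS⟩ := hI
    have hG' := hG₄.frame ag (by decide)
    obtain ⟨e, heX, he, hmax⟩ := hS.exists_winner hst (fun e => (h0 e).le) (by omega)
    refine HaltsWith.seq (q₁ := 0) (q₂ := 0) (K₂ := 1)
      (dropWinner_spec hG'.edges he e.2 ?_ hS.tournament) fun τ agτ hτ =>
      HaltsWith.straight rfl le_rfl ⟨insert e X, ?_, ?_⟩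
    · rw [ag.ia 21 (by decide), ag₄.ia 21 (by decide), ag₃.ia 21 (by decide)]
      exact h₂
    · rw [Finset.card_insert_of_notMem heX, hX]
    · obtain ⟨t1, t2, t3⟩ := hτ
      rw [hG'.cap e] at t2
      refine ⟨t1, by simp, fun g hg => ?_, fun g hg => ?_, fun x hx y hy => ?_⟩
      · change τ.ra 7 g < 0
        by_cases hge : g = e
        · rw [hge, t2]
          exact neg_lt_zero.2 (h0 e)
        · rw [t3 g fun h => hge (Fin.ext h)]
          exact hS.removed g (Finset.mem_of_mem_insert_of_ne hg hge)
      · change τ.ra 7 g = _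
        rw [Finset.mem_insert, not_or] at hg
        rw [t3 g fun h => hg.1 (Fin.ext h)]
        exact hS.present g hg.2
      · rw [Finset.mem_insert, not_or] at hy
        rcases Finset.mem_insert.1 hx with rfl | hx
        · exact hmax y hy.2
        · exact hS.top x hx y hy.2
  · obtain ⟨X, hX, hS⟩ := h₅
    obtain ⟨e, heX, he, hmax⟩ := hS.exists_winner hst (fun e => (h0 e).le) (by omega)
    exact ⟨e, he, hX ▸ G.isKthMostVital_of X heX hS.top hmax⟩
  · have : k * ((2 + ((Nat.log 2 m + 1) * (3 + 1) + 1) + 1) + 2)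
        ≤ m * ((2 + ((Nat.log 2 m + 1) * (3 + 1) + 1) + 1) + 2) := Nat.mul_le_mul_right _ hkm
    nlinarith [Nat.zero_le (m * Nat.log 2 m)]

end

end VitalEdges

theorem theorem1p3 :
    ∃ c : ℕ,
      -- all vital edges, sorted into tight and loose ones
      (∃ P : Prog, ∀ (n m : ℕ) (G : Network (Fin n) (Fin m)),
        G.source ≠ G.sink → (∀ e, 0 < G.cap e) →
        ∀ O : Subroutine, IsMaxFlowSubroutine O →
          HaltsWith P O (inputState G 0) (n + c) (m + c) (c * n) (c * (n * (n + m)))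
            (fun σ => ∀ e : Fin m,
              (σ.ia 2 e = 0 ↔ ¬ G.IsVital e) ∧
              (σ.ia 2 e = 1 ↔ G.IsTight e) ∧
              (σ.ia 2 e = 2 ↔ G.IsLoose e))) ∧
      -- at most `n - 1` candidates for the loose edges, from one maximum flow
      (∃ P : Prog, ∀ (n m : ℕ) (G : Network (Fin n) (Fin m)),
        G.source ≠ G.sink → (∀ e, 0 < G.cap e) →
        ∀ O : Subroutine, IsMaxFlowSubroutine O →
          HaltsWith P O (inputState G 0) (n + c) (m + c) 1 (c * (n * (n + m)))
            (fun σ => {e : Fin m | σ.ia 2 e = 1}.ncard ≤ n - 1 ∧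
              ∀ e : Fin m, G.IsLoose e → σ.ia 2 e = 1)) ∧
      -- the `k`-th most vital edge
      (∃ P : Prog, ∀ (n m : ℕ) (G : Network (Fin n) (Fin m)),
        G.source ≠ G.sink → (∀ e, 0 < G.cap e) →
        ∀ O : Subroutine, IsMaxFlowSubroutine O →
        ∀ k : ℕ, 1 ≤ k → k ≤ m →
          HaltsWith P O (inputState G k) (n + c) (m + c) (c * n)
            (c * (n * (n + m) + m * Nat.log 2 m))
            (fun σ => ∃ e : Fin m, σ.iv 5 = (e : ℕ) ∧ G.IsKthMostVital k e)) := by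
  refine ⟨440, ⟨.classify, fun n m G hst h0 O hO => ?_⟩, ⟨.candidates, fun n m G hst h0 O hO => ?_⟩,
    .classify ;; .selection, fun n m G hst h0 O hO k hk1 hkm => ?_⟩
  · refine (classify_spec hO (by omega) (by omega) hst (fun e => (h0 e).le)
      (holds_inputState G 0)).mono (by omega) (by gcongr; omega) fun σ _ h e => ?_
    have ht := (h e).type
    have h3 : ¬ (G.IsTight e ∧ G.IsLoose e) := fun h => h.2.2 h.1.2
    have h4 : G.IsTight e → G.IsVital e := And.left
    have h5 : G.IsLoose e → G.IsVital e := And.left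
    rcases ht with ⟨h1, h2⟩ | ⟨h1, h2⟩ | ⟨h1, h2⟩ <;> rw [h1] <;> simp <;> tauto
  · refine (candidates_spec hO (by omega) (by omega) hst (fun e => (h0 e).le)
      (holds_inputState G 0)).mono le_rfl (by gcongr; omega) fun σ _ h => ⟨h.card, fun e he => ?_⟩
    by_contra hne
    exact Network.not_isLoose_of (G := G) (f := fun g => σ.ra 1 g) hst (h0 e).le (h.unmarked e hne) he
  · have hn : 0 < n := G.source.pos
    have hG := holds_inputState G k
    refine (HaltsWith.seq (classify_spec hO (by omega) (by omega) hst (fun e => (h0 e).le) hG)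
      fun σ₁ ag₁ h₁ => selection_spec hst h0 (hG.frame ag₁ (by decide)) hk1 hkm
        ((ag₁.iv 4 (by decide)).trans (by simp [inputState]))
        fun e => (h₁ e).vitality).mono (by omega) ?_ fun _ _ h => h
    nlinarith [Nat.mul_le_mul_right m hn]
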